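/- **Conventions.** A Finsler metric on a smooth manifold $M$ is a function $F:TM\to[0,\infty)$ that is smooth on $TM\setminus 0$, satisfies $F(x,\lambda y)=\lambda F(x,y)$ for $\lambda>0$, and has positive definite matrix $g_{ij}=[\tfrac12F^2]_{y^iy^j}$ at all $y\neq 0$. In induced local coordinates $(x^i,y^i)$ put (summing over repeated indices) $$C_{ijk}=\tfrac12\frac{\partial g_{ij}}{\partial y^k},\quad I_i=C_{ijk}g^{jk},\quad I^i=g^{ij}I_j,\quad G^i=\tfrac14 g^{ip}\bigl([F^2]_{x^qy^p}y^q-[F^2]_{x^p}\bigr),$$ $$B_i{}^l{}_{jk}=\frac{\partial^3G^l}{\partial y^i\partial y^j\partial y^k},\quad L_{ijk}=-\tfrac12\,g_{lm}y^m\,B_i{}^l{}_{jk},\quad J_i=L_{ijk}g^{jk}.$$ $F$ is weakly Landsberg if $J_i=0$ at every point of its domain; it is Riemannian if on each tangent space it is the norm of an inner product; it is reversible if $F(x,-y)=F(x,y)$. **Theorem.** Let $(M_1,F_1)$ and $(M_2,F_2)$ be Finsler manifolds of dimensions $m$ and $n$, where $M_2$ is nonempty and $n\ge 1$; if $n=1$,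 assume that $F_2$ is reversible. Let $f:M_1\times M_2\to(0,\infty)$ be smooth, and assume that $f$ genuinely depends on $M_1$: there is no nonempty open set $V\subseteq M_2$ such that the differential of $f$ in the directions of $M_1$ vanishes identically on $M_1\times V$. Let $$F=\sqrt{F_1^2+f^2F_2^2}$$ be the twisted product, with domain $(TM_1\setminus 0)\times(TM_2\setminus 0)\subset T(M_1\times M_2)$. Then $F$ is weakly Landsberg if and only if the following three conditions hold: 1. $F_1$ is weakly Landsberg; 2. $F_2$ is Riemannian; 3. $\displaystyle I^p\,\frac{\partial f}{\partial x^p}=0$ at every $(x_1,x_2)\in M_1\times M_2$ and every $y_1\in T_{x_1}M_1\setminus\{0\}$, where $I^p$ is the raised mean Cartan torsion of $F_1$ at $(x_1,y_1)$ and $x^1,\dots,x^m$ are local coordinates of $M_1$. -/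

import Mathlib

open scoped Manifold ContDiff

noncomputable section

namespace Finsler

/-! ### Finsler quantities of a function of `(x, y)` in local coordinates

`φ : E × E → ℝ` is the expression of a (locally defined) Finsler function in induced local
coordinates `(x, y)`; the coordinates are taken with respect to a basis `b` of the model space `E`,
so that `y^i = b.repr y i`. -/

section Local

variable {ι E : Type*} [Fintype ι] [DecidableEq ι] [NormedAddCommGroup E] [NormedSpace ℝ E]

/-- The partial derivative `∂φ/∂x^i`. -/
def dx (b : Module.Basis ι ℝ E) (i : ι) (φ : E × E → ℝ) : E × E → ℝ :=
  fun p => fderiv ℝ φ p (b i, 0)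

/-- The partial derivative `∂φ/∂y^i`. -/
def dy (b : Module.Basis ι ℝ E) (i : ι) (φ : E × E → ℝ) : E × E → ℝ :=
  fun p => fderiv ℝ φ p (0, b i)

/-- The fundamental tensor `g_{ij} = [φ² / 2]_{y^i y^j}`. -/
def fundamental (b : Module.Basis ι ℝ E) (φ : E × E → ℝ) (p : E × E) : Matrix ι ι ℝ :=
  Matrix.of fun i j => dy b j (dy b i (fun q => (1 / 2) * φ q ^ 2)) p

/-- The inverse matrix `(g^{ij})` of `(g_{ij})`. -/
def fundamentalInv (b : Module.Basis ι ℝ E) (φ : E × E → ℝ) (p : E × E) : Matrix ι ι ℝ :=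
  (fundamental b φ p)⁻¹

/-- The Cartan torsion `C_{ijk} = (1/2) ∂g_{ij}/∂y^k`. -/
def cartan (b : Module.Basis ι ℝ E) (φ : E × E → ℝ) (i j k : ι) (p : E × E) : ℝ :=
  (1 / 2) * dy b k (fun q => fundamental b φ q i j) p

/-- The mean Cartan torsion `I_i = C_{ijk} g^{jk}`. -/
def meanCartan (b : Module.Basis ι ℝ E) (φ : E × E → ℝ) (i : ι) (p : E × E) : ℝ :=
  ∑ j, ∑ k, cartan b φ i j k p * fundamentalInv b φ p j k

/-- The mean Cartan torsion with its index raised, `I^i = g^{ij} I_j`. -/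
def meanCartanUp (b : Module.Basis ι ℝ E) (φ : E × E → ℝ) (i : ι) (p : E × E) : ℝ :=
  ∑ j, fundamentalInv b φ p i j * meanCartan b φ j p

/-- The spray coefficients `G^i = (1/4) g^{ij} ([φ²]_{x^k y^j} y^k - [φ²]_{x^j})`. -/
def spray (b : Module.Basis ι ℝ E) (φ : E × E → ℝ) (i : ι) (p : E × E) : ℝ :=
  (1 / 4) * ∑ j, fundamentalInv b φ p i j *
    ((∑ k, dy b j (dx b k (fun q => φ q ^ 2)) p * b.repr p.2 k) - dx b j (fun q => φ q ^ 2) p)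

/-- The Berwald curvature `B_i{}^l{}_{jk} = ∂³G^l / ∂y^i ∂y^j ∂y^k`. -/
def berwald (b : Module.Basis ι ℝ E) (φ : E × E → ℝ) (l i j k : ι) (p : E × E) : ℝ :=
  dy b k (dy b j (dy b i (spray b φ l))) p

/-- The Landsberg curvature `L_{ijk} = -(1/2) y_l B_i{}^l{}_{jk}`, where `y_l = g_{lm} y^m`. -/
def landsberg (b : Module.Basis ι ℝ E) (φ : E × E → ℝ) (i j k : ι) (p : E × E) : ℝ :=
  -(1 / 2) * ∑ l, (∑ m, fundamental b φ p l m * b.repr p.2 m) * berwald b φ l i j k p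

/-- The mean Landsberg curvature `J_i = L_{ijk} g^{jk}`. -/
def meanLandsberg (b : Module.Basis ι ℝ E) (φ : E × E → ℝ) (i : ι) (p : E × E) : ℝ :=
  ∑ j, ∑ k, landsberg b φ i j k p * fundamentalInv b φ p j k

end Local

/-! ### Functions on the tangent bundle of a manifold -/

section Manifold

variable {E H M : Type*} [NormedAddCommGroup E] [NormedSpace ℝ E] [TopologicalSpace H]
  [TopologicalSpace M] [ChartedSpace H M]

/-- The parametrization `(x, y) ↦ ∑ y^i ∂/∂x^i` of the tangent bundle by the coordinates induced by
a chart `e`. -/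
def ofCoord (I : ModelWithCorners ℝ E H) (e : OpenPartialHomeomorph M H) (p : E × E) :
    TangentBundle I M :=
  tangentMap 𝓘(ℝ, E) I (e.extend I).symm ⟨p.1, p.2⟩

/-- The expression of a function on the tangent bundle in the coordinates induced by a chart. -/
def coordRep (I : ModelWithCorners ℝ E H) (e : OpenPartialHomeomorph M H)
    (F : TangentBundle I M → ℝ) : E × E → ℝ :=
  fun p => F (ofCoord I e p)

/-- The slit tangent bundle: the tangent bundle without its zero section. -/
def slit (I : ModelWithCorners ℝ E H) (M : Type*) [TopologicalSpace M] [ChartedSpace H M] :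
    Set (TangentBundle I M) :=
  {p | p.2 ≠ 0}

/-- The mean Landsberg curvature of `F`, as a Finsler function with domain `D ⊆ TM`, vanishes: in
every chart of the atlas, `J_i = 0` at all points of `D`. -/
def WeaklyLandsbergOn {ι : Type*} [Fintype ι] [DecidableEq ι] (I : ModelWithCorners ℝ E H)
    (b : Module.Basis ι ℝ E) (F : TangentBundle I M → ℝ) (D : Set (TangentBundle I M)) : Prop :=
  ∀ e ∈ atlas H M, ∀ p : E × E, p.1 ∈ (e.extend I).target → ofCoord I e p ∈ D →
    ∀ i, meanLandsberg b (coordRep I e F) i p = 0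

end Manifold

/-- The standard basis of `ℝᵐ`. -/
def stdBasis (m : ℕ) : Module.Basis (Fin m) ℝ (EuclideanSpace ℝ (Fin m)) :=
  (EuclideanSpace.basisFun (Fin m) ℝ).toBasis

end Finsler

open Finsler

/-- A Finsler metric on a smooth manifold `M` of dimension `m`. -/
structure FinslerMetric (m : ℕ) (M : Type*) [TopologicalSpace M]
    [ChartedSpace (EuclideanSpace ℝ (Fin m)) M] [IsManifold (𝓡 m) ∞ M] where
  /-- The underlying function on the tangent bundle. -/
  toFun : TangentBundle (𝓡 m) M → ℝ
  nonneg : ∀ p, 0 ≤ toFun p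
  smooth : ContMDiffOn (𝓡 m).tangent 𝓘(ℝ, ℝ) ∞ toFun (slit (𝓡 m) M)
  homogeneous : ∀ (x : M) (y : TangentSpace (𝓡 m) x) (c : ℝ), 0 < c →
    toFun ⟨x, c • y⟩ = c * toFun ⟨x, y⟩
  posDef : ∀ e ∈ atlas (EuclideanSpace ℝ (Fin m)) M,
    ∀ p : EuclideanSpace ℝ (Fin m) × EuclideanSpace ℝ (Fin m),
      p.1 ∈ (e.extend (𝓡 m)).target → p.2 ≠ 0 →
        (fundamental (stdBasis m) (coordRep (𝓡 m) e toFun) p).PosDef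

namespace FinslerMetric

variable {m : ℕ} {M : Type*} [TopologicalSpace M] [ChartedSpace (EuclideanSpace ℝ (Fin m)) M]
  [IsManifold (𝓡 m) ∞ M]

/-- `F` is weakly Landsberg: `J_i = 0` on the slit tangent bundle. -/
def IsWeaklyLandsberg (F : FinslerMetric m M) : Prop :=
  WeaklyLandsbergOn (𝓡 m) (stdBasis m) F.toFun (slit (𝓡 m) M)

/-- `F` is Riemannian: on every tangent space it is the norm of an inner product. (The inner product
at `x` is then unique, and depends smoothly on `x` because `F` is smooth.) -/
def IsRiemannian (F : FinslerMetric m M) : Prop :=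
  ∀ x : M, ∃ B : TangentSpace (𝓡 m) x →ₗ[ℝ] TangentSpace (𝓡 m) x →ₗ[ℝ] ℝ,
    (∀ v w, B v w = B w v) ∧ (∀ v, v ≠ 0 → 0 < B v v) ∧
      ∀ v : TangentSpace (𝓡 m) x, F.toFun ⟨x, v⟩ = Real.sqrt (B v v)

/-- `F` is reversible: `F(x, -y) = F(x, y)`. -/
def IsReversible (F : FinslerMetric m M) : Prop :=
  ∀ (x : M) (y : TangentSpace (𝓡 m) x), F.toFun ⟨x, -y⟩ = F.toFun ⟨x, y⟩

end FinslerMetric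

section Twisted

variable {m n : ℕ} {M₁ M₂ : Type*}
  [TopologicalSpace M₁] [ChartedSpace (EuclideanSpace ℝ (Fin m)) M₁] [IsManifold (𝓡 m) ∞ M₁]
  [TopologicalSpace M₂] [ChartedSpace (EuclideanSpace ℝ (Fin n)) M₂] [IsManifold (𝓡 n) ∞ M₂]

/-- The twisted product `F = √(F₁² + f² F₂²)` on `T(M₁ × M₂)`. -/
def twistedProduct (F₁ : FinslerMetric m M₁) (F₂ : FinslerMetric n M₂) (f : M₁ × M₂ → ℝ) :
    TangentBundle ((𝓡 m).prod (𝓡 n)) (M₁ × M₂) → ℝ :=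
  fun p => Real.sqrt
    (F₁.toFun (tangentMap ((𝓡 m).prod (𝓡 n)) (𝓡 m) Prod.fst p) ^ 2 +
      f p.1 ^ 2 * F₂.toFun (tangentMap ((𝓡 m).prod (𝓡 n)) (𝓡 n) Prod.snd p) ^ 2)

variable (m n M₁ M₂) in
/-- The domain `(TM₁ ∖ 0) × (TM₂ ∖ 0)` of the twisted product, as a subset of `T(M₁ × M₂)`. -/
def twistedDomain : Set (TangentBundle ((𝓡 m).prod (𝓡 n)) (M₁ × M₂)) :=
  {p | tangentMap ((𝓡 m).prod (𝓡 n)) (𝓡 m) Prod.fst p ∈ slit (𝓡 m) M₁ ∧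
    tangentMap ((𝓡 m).prod (𝓡 n)) (𝓡 n) Prod.snd p ∈ slit (𝓡 n) M₂}

/-- The twisted product is weakly Landsberg: all `J_α`, `1 ≤ α ≤ m + n`, vanish on its domain. The
atlas of `M₁ × M₂` consists of the products of charts of the factors. -/
def TwistedWeaklyLandsberg (F₁ : FinslerMetric m M₁) (F₂ : FinslerMetric n M₂)
    (f : M₁ × M₂ → ℝ) : Prop :=
  WeaklyLandsbergOn ((𝓡 m).prod (𝓡 n)) ((stdBasis m).prod (stdBasis n))
    (twistedProduct F₁ F₂ f) (twistedDomain m n M₁ M₂)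

/-- The equation `I^p ∂f/∂x^p = 0`, where `I^p` belongs to `F₁` and `x^p` runs through the
coordinates of `M₁`. -/
def TwistEquation (F₁ : FinslerMetric m M₁) (f : M₁ × M₂ → ℝ) : Prop :=
  ∀ e ∈ atlas (EuclideanSpace ℝ (Fin m)) M₁,
    ∀ p : EuclideanSpace ℝ (Fin m) × EuclideanSpace ℝ (Fin m),
      p.1 ∈ (e.extend (𝓡 m)).target → p.2 ≠ 0 → ∀ z : M₂,
        ∑ i, meanCartanUp (stdBasis m) (coordRep (𝓡 m) e F₁.toFun) i p *
          fderiv ℝ (fun u => f ((e.extend (𝓡 m)).symm u, z)) p.1 (stdBasis m i) = 0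

end Twisted

end

set_option linter.unusedSectionVars false

/-! Fix a point of M₁ × M₂ and a vector (y, v). Write h for the value of f, p and q for its
differentials along M₁ and M₂, N₁ and N₂ for the squared norms on the two tangent spaces, and g, I
for the fundamental tensor and mean Cartan torsion of F₁. The fundamental tensor of F is block
diagonal, and the spray coefficients are G^l = G₁^l - (1/2) h p_m g^{lm} N₂(v) along M₁ and G^d =
A^d(v) + h⁻¹ (p·y) v^d along M₂, where A does not involve y. Contracting third derivatives gives

J_i = J_i(F₁) + (h/4) N₂(v) p_m (4 ∂I^m/∂y^i - 2 I_l ∂g^{lm}/∂y^i) along M₁,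

J_i = (h/2) (∂N₂/∂v^i) I^m p_m + h⁻¹ (p·y) I_i(F₂) + T_i(v) along M₂

(`landsbergTrace_twist_inl`, `landsbergTrace_twist_inr`), where T is the Landsberg trace built from
A.

Necessity is a comparison of degrees of homogeneity. In the first formula the two terms have degrees
0 and 2 in v, so J(F₁) = 0. In the second the three terms have degrees -1, 1 and 0 in y, so I^m p_m
= 0, and I(F₂) = 0 wherever p ≠ 0. By assumption such points lie over a dense subset of M₂, and
continuity gives I(F₂) = 0 everywhere. Deicke's theorem (`IsMinkowskiSq.dd_hess_eq_zero`) then makes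
F₂ Riemannian. In dimension one it says nothing, because the slit line is disconnected;
reversibility replaces it.

For sufficiency, a Riemannian F₂ has quadratic spray coefficients and T = 0, so the components along
M₂ vanish. The components along M₁ still contain p_m I_l ∂g^{lm}/∂y^i, which I^m p_m = 0 does not
visibly kill. Here a rigidity statement enters (`IsMinkowskiSq.meanTorsion_eq_zero_of_annihilates`):
if a nonzero constant covector c annihilates I^m at all y ≠ 0, then I = 0. Its proof considers δ =
det g, which is constant along the field Z = g^{lm} c_m because d log δ = 2 I. Extrema of δ + ε
s/√N, with s = c·y, are zeros of Z(s/√N). These are the equality case of Cauchy-Schwarz, and by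
injectivity of the Legendre transformation they lie on at most two rays. Varying ε forces δ to be
constant.

Deicke's theorem is proved by integration. If I = 0, then g^{jl} ∂_j∂_l g_kk is a divergence and
equals tr(g⁻¹P g⁻¹P) ≥ 0 with P = ∂_k g. Against a cut-off depending on N alone its integral
vanishes, hence P = 0. -/

noncomputable section

namespace Finsler

/-! ### Directional derivatives and homogeneous functions -/

section DirectionalDerivative

variable {V : Type*} [NormedAddCommGroup V] [NormedSpace ℝ V]

/-- The derivative of `φ` in the constant direction `v`. -/
def dd (v : V) (φ : V → ℝ) : V → ℝ := fun y => fderiv ℝ φ y v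

variable {S : Set V} {φ ψ : V → ℝ} {y : V} (v w : V)

theorem _root_.ContDiffOn.diffAt (h : ContDiffOn ℝ ∞ φ S) (hS : IsOpen S) (hy : y ∈ S) :
    DifferentiableAt ℝ φ y :=
  (h.contDiffAt (hS.mem_nhds hy)).differentiableAt (by simp)

theorem _root_.ContDiffOn.dd (h : ContDiffOn ℝ ∞ φ S) (hS : IsOpen S) :
    ContDiffOn ℝ ∞ (dd v φ) S :=
  (h.fderiv_of_isOpen hS (m := ∞) (by simp)).clm_apply contDiffOn_const

/-- The basic move of the file: an identity valid on an open set may be differentiated. Stating it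
for `Set.EqOn` lets it be iterated under further derivatives. -/
theorem dd_congr (hS : IsOpen S) (h : Set.EqOn φ ψ S) : Set.EqOn (dd v φ) (dd v ψ) S := by
  intro y hy
  have : φ =ᶠ[nhds y] ψ := h.eventuallyEq_of_mem (hS.mem_nhds hy)
  simp only [dd, this.fderiv_eq]

theorem two_le_infty : (2 : WithTop ℕ∞) ≤ ∞ := by
  exact WithTop.coe_le_coe.2 (le_top : (2 : ℕ∞) ≤ ⊤)

theorem dd_comm (hS : IsOpen S) (h : ContDiffOn ℝ ∞ φ S) :
    Set.EqOn (dd v (dd w φ)) (dd w (dd v φ)) S := by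
  intro y hy
  have hc : ContDiffAt ℝ ∞ φ y := h.contDiffAt (hS.mem_nhds hy)
  have hd : DifferentiableAt ℝ (fderiv ℝ φ) y :=
    (hc.fderiv_right (m := 1) (by simpa [one_add_one_eq_two] using two_le_infty)).differentiableAt (by simp)
  have e : ∀ a c : V, dd a (dd c φ) y = fderiv ℝ (fderiv ℝ φ) y a c := fun a c => by
    have : dd c φ = fun z => fderiv ℝ φ z c := rfl
    rw [this, dd, fderiv_clm_apply hd (by fun_prop)]
    simp
  rw [e, e]
  exact (hc.isSymmSndFDerivAt (by simpa using two_le_infty)).eq v w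

theorem dd_add (hφ : DifferentiableAt ℝ φ y) (hψ : DifferentiableAt ℝ ψ y) :
    dd v (fun z => φ z + ψ z) y = dd v φ y + dd v ψ y := by
  simp [dd, fderiv_fun_add hφ hψ]

theorem dd_mul (hφ : DifferentiableAt ℝ φ y) (hψ : DifferentiableAt ℝ ψ y) :
    dd v (fun z => φ z * ψ z) y = dd v φ y * ψ y + φ y * dd v ψ y := by
  simp [dd, fderiv_fun_mul hφ hψ]; ring

theorem diffAt_div (hφ : DifferentiableAt ℝ φ y) (hψ : DifferentiableAt ℝ ψ y) (h0 : ψ y ≠ 0) :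
    DifferentiableAt ℝ (fun z => φ z / ψ z) y := by
  simpa only [div_eq_mul_inv] using hφ.fun_mul (hψ.fun_inv h0)

theorem dd_const_mul (c : ℝ) :
    dd v (fun z => c * φ z) y = c * dd v φ y := by
  have : (fun z => c * φ z) = c • φ := by ext; simp
  simp [dd, this, fderiv_const_smul_field]

theorem dd_const (c : ℝ) : dd v (fun _ => c) y = 0 := by simp [dd]

theorem dd_sum {κ : Type*} (s : Finset κ) {φ : κ → V → ℝ}
    (h : ∀ i ∈ s, DifferentiableAt ℝ (φ i) y) :
    dd v (fun z => ∑ i ∈ s, φ i z) y = ∑ i ∈ s, dd v (φ i) y := by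
  simp [dd, fderiv_fun_sum h]

theorem dd_sum_mul {κ : Type*} [Fintype κ] {φ ψ : κ → V → ℝ}
    (hφ : ∀ i, DifferentiableAt ℝ (φ i) y) (hψ : ∀ i, DifferentiableAt ℝ (ψ i) y) :
    dd v (fun z => ∑ i, φ i z * ψ i z) y = ∑ i, (dd v (φ i) y * ψ i y + φ i y * dd v (ψ i) y) := by
  rw [dd_sum (φ := fun i z => φ i z * ψ i z) v _ fun i _ => (hφ i).mul (hψ i)]
  exact Finset.sum_congr rfl fun i _ => dd_mul v (hφ i) (hψ i)

theorem fderiv_eq_sum_dd {ι : Type*} [Fintype ι] (b : Module.Basis ι ℝ V) (φ : V → ℝ) (y z : V) :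
    fderiv ℝ φ y z = ∑ i, b.repr z i * dd (b i) φ y := by
  conv_lhs => rw [← b.sum_repr z]
  simp only [map_sum, map_smul, smul_eq_mul, dd]

/-- Directional derivatives of a `k`-homogeneous function are `k - 1`-homogeneous. -/
theorem dd_homogeneous {k : ℤ} {c : ℝ} (hc : 0 < c)
    (h : ∀ y : V, y ≠ 0 → φ (c • y) = c ^ k * φ y) (hy : y ≠ 0) :
    dd v φ (c • y) = c ^ (k - 1) * dd v φ y := by
  have h1 : (fun z => φ (c • z)) =ᶠ[nhds y] (c ^ k) • φ := by
    filter_upwards [isOpen_ne.mem_nhds hy] with z hz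
    simpa using h z hz
  have h2 := h1.fderiv_eq (𝕜 := ℝ)
  have h3 : fderiv ℝ (fun z => φ (c • z)) y = c • fderiv ℝ φ (c • y) := by
    simpa using fderiv_comp_smul (𝕜 := ℝ) (f := φ) (x := y) c
  rw [h3, fderiv_const_smul_field] at h2
  have h4 : c * dd v φ (c • y) = c ^ k * dd v φ y := by
    simpa [dd] using congrArg (fun L : V →L[ℝ] ℝ => L v) h2
  rw [zpow_sub_one₀ hc.ne']
  field_simp
  linarith

/-- Differentiate c ↦ φ(c y) at c = 1 in two ways. Integer exponents are needed because derivatives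
of 0-homogeneous functions have degree -1. -/
theorem euler_identity {k : ℤ} (hφ : DifferentiableAt ℝ φ y)
    (h : ∀ c : ℝ, 0 < c → φ (c • y) = c ^ k * φ y) : fderiv ℝ φ y y = k * φ y := by
  have h1 : HasDerivAt (fun c : ℝ => φ (c • y)) (fderiv ℝ φ y y) 1 := by
    have h2 : HasDerivAt (fun c : ℝ => c • y) y 1 := by
      simpa using (hasDerivAt_id (1 : ℝ)).smul_const y
    have h3 : HasFDerivAt φ (fderiv ℝ φ y) ((1 : ℝ) • y) := by simpa using hφ.hasFDerivAt
    exact h3.comp_hasDerivAt (1 : ℝ) h2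
  have h2 : HasDerivAt (fun c : ℝ => c ^ k * φ y) (k * φ y) 1 := by
    simpa using (hasDerivAt_zpow k (1 : ℝ) (by simp)).mul_const (φ y)
  refine h1.unique (h2.congr_of_eventuallyEq ?_)
  filter_upwards [lt_mem_nhds (zero_lt_one (α := ℝ))] with c hc using h c hc

end DirectionalDerivative

/-! ### Determinants and inverses of matrix-valued functions -/

section MatrixFunctions

variable {V ι : Type*} [NormedAddCommGroup V] [NormedSpace ℝ V] [Fintype ι] [DecidableEq ι]
  {S : Set V} {g : V → Matrix ι ι ℝ} {y : V}

theorem contDiffOn_det (hg : ∀ i j, ContDiffOn ℝ ∞ (fun y => g y i j) S) :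
    ContDiffOn ℝ ∞ (fun y => (g y).det) S := by
  simp only [Matrix.det_apply']
  exact ContDiffOn.sum fun σ _ => contDiffOn_const.mul (contDiffOn_prod fun i _ => hg _ _)

/-- By Cramer's rule an entry of the inverse is a cofactor, itself a determinant, divided by the
determinant. -/
theorem contDiffOn_inv (hg : ∀ i j, ContDiffOn ℝ ∞ (fun y => g y i j) S)
    (hdet : ∀ y ∈ S, (g y).det ≠ 0) (i j : ι) :
    ContDiffOn ℝ ∞ (fun y => (g y)⁻¹ i j) S := by
  have h : ContDiffOn ℝ ∞ (fun y => (g y).det⁻¹ * ((g y).updateRow j (Pi.single i 1)).det) S := by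
    refine ((contDiffOn_det hg).inv hdet).mul (contDiffOn_det fun k l => ?_)
    by_cases hk : k = j
    · simpa [hk] using contDiffOn_const
    · simpa [Matrix.updateRow_apply, hk] using hg k l
  refine h.congr fun y _ => ?_
  simp [Matrix.inv_def, Matrix.adjugate_apply]

/-- Differentiate g g⁻¹ = 1 and multiply by g⁻¹ from the left. -/
theorem dd_inv (hS : IsOpen S) (hg : ∀ i j, ContDiffOn ℝ ∞ (fun y => g y i j) S)
    (hdet : ∀ y ∈ S, (g y).det ≠ 0) (hy : y ∈ S) (v : V) :
    (Matrix.of fun i j => dd v (fun y => (g y)⁻¹ i j) y) =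
      -((g y)⁻¹ * (Matrix.of fun i j => dd v (fun y => g y i j) y) * (g y)⁻¹) := by
  have hK := contDiffOn_inv hg hdet
  have h1 : g y * (Matrix.of fun i j => dd v (fun y => (g y)⁻¹ i j) y) +
      (Matrix.of fun i j => dd v (fun y => g y i j) y) * (g y)⁻¹ = 0 := by
    ext i j
    have h2 : Set.EqOn (fun y => ∑ k, g y i k * (g y)⁻¹ k j)
        (fun _ => (1 : Matrix ι ι ℝ) i j) S := by
      intro z hz
      simp only
      rw [← Matrix.mul_apply, Matrix.mul_nonsing_inv _ (Ne.isUnit (hdet z hz))]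
    have h3 := dd_congr v hS h2 hy
    rw [dd_const, dd_sum] at h3
    · simp only [Matrix.add_apply, Matrix.mul_apply, Matrix.of_apply, Matrix.zero_apply]
      rw [← Finset.sum_add_distrib, ← h3]
      refine Finset.sum_congr rfl fun k _ => ?_
      rw [dd_mul v ((hg _ _).diffAt hS hy) ((hK _ _).diffAt hS hy)]
      ring
    · exact fun k _ => ((hg _ _).diffAt hS hy).mul ((hK _ _).diffAt hS hy)
  have hu : IsUnit (g y).det := Ne.isUnit (hdet y hy)
  have h4 := congrArg (fun M => (g y)⁻¹ * M) h1
  simp only [Matrix.mul_add, ← Matrix.mul_assoc, Matrix.nonsing_inv_mul _ hu, Matrix.one_mul,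
    Matrix.mul_zero] at h4
  exact eq_neg_of_add_eq_zero_left h4

/-- Jacobi's formula. -/
theorem dd_det (hS : IsOpen S) (hg : ∀ i j, ContDiffOn ℝ ∞ (fun y => g y i j) S)
    (hdet : ∀ y ∈ S, (g y).det ≠ 0) (hy : y ∈ S) (v : V) :
    dd v (fun y => (g y).det) y =
      (g y).det * ∑ i, ∑ j, dd v (fun y => g y i j) y * (g y)⁻¹ j i := by
  have hd : ∀ i j, DifferentiableAt ℝ (fun y => g y i j) y := fun i j => (hg i j).diffAt hS hy
  -- The determinant is multilinear in its columns, so its derivative is the sum over columns of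
  -- determinants with one column differentiated; Cramer's rule turns each of these into an adjugate
  -- entry.
  have h1 : dd v (fun y => (g y).det) y =
      ∑ j, ((g y).updateCol j fun i => dd v (fun y => g y i j) y).det := by
    simp only [Matrix.det_apply']
    have hp : ∀ σ : Equiv.Perm ι, DifferentiableAt ℝ
        (fun y => ((Equiv.Perm.sign σ : ℤ) : ℝ) * ∏ i, g y (σ i) i) y := fun σ =>
      (HasFDerivAt.finsetProd fun i _ => (hd (σ i) i).hasFDerivAt).differentiableAt.const_mul _
    rw [dd_sum v _ fun σ _ => hp σ, Finset.sum_comm]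
    refine Finset.sum_congr rfl fun σ _ => ?_
    rw [dd_const_mul, ← Finset.mul_sum]
    congr 1
    simp only [dd]
    rw [fderiv_finsetProd fun i _ => hd (σ i) i]
    simp only [sum_apply, smul_apply, smul_eq_mul]
    refine Finset.sum_congr rfl fun i _ => ?_
    rw [← Finset.mul_prod_erase _ _ (Finset.mem_univ i), mul_comm]
    congr 1
    · simp
    · refine Finset.prod_congr rfl fun j hj => ?_
      simp [Finset.ne_of_mem_erase hj]
  rw [h1, Finset.sum_comm, Finset.mul_sum]
  refine Finset.sum_congr rfl fun j _ => ?_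
  rw [← Matrix.cramer_apply, Matrix.cramer_eq_adjugate_mulVec, Matrix.mulVec, dotProduct,
    Finset.mul_sum]
  refine Finset.sum_congr rfl fun i _ => ?_
  have := hdet y hy
  simp only [Matrix.inv_def, Ring.inverse_eq_inv', Matrix.smul_apply, smul_eq_mul]
  field_simp

end MatrixFunctions

/-! ### Contraction identities for a single Minkowski norm -/

section Fiber

variable {ι E : Type*} [Fintype ι] [DecidableEq ι] [NormedAddCommGroup E] [NormedSpace ℝ E]

/-- The Hessian matrix of `N / 2`. -/
def hess (b : Module.Basis ι ℝ E) (N : E → ℝ) (y : E) : Matrix ι ι ℝ :=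
  Matrix.of fun i j => dd (b j) (dd (b i) (fun q => (1 / 2) * N q)) y

/-- The inverse of the Hessian matrix of `N / 2`. -/
def hessInv (b : Module.Basis ι ℝ E) (N : E → ℝ) (y : E) : Matrix ι ι ℝ :=
  (hess b N y)⁻¹

/-- The mean Cartan torsion of the norm with square `N`. -/
def meanTorsion (b : Module.Basis ι ℝ E) (N : E → ℝ) (i : ι) (y : E) : ℝ :=
  ∑ j, ∑ k, (1 / 2) * dd (b k) (fun q => hess b N q i j) y * hessInv b N y j k

/-- The mean Cartan torsion of the norm with square `N`, with its index raised. -/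
def meanTorsionUp (b : Module.Basis ι ℝ E) (N : E → ℝ) (i : ι) (y : E) : ℝ :=
  ∑ j, hessInv b N y i j * meanTorsion b N j y

/-- `N` is the square of a Minkowski norm. -/
structure IsMinkowskiSq (b : Module.Basis ι ℝ E) (N : E → ℝ) : Prop where
  smooth : ContDiffOn ℝ ∞ N {0}ᶜ
  homog : ∀ c : ℝ, 0 < c → ∀ y, N (c • y) = c ^ 2 * N y
  posDef : ∀ y, y ≠ 0 → (hess b N y).PosDef

namespace IsMinkowskiSq

variable {b : Module.Basis ι ℝ E} {N : E → ℝ} {y : E}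

theorem smooth_half (h : IsMinkowskiSq b N) : ContDiffOn ℝ ∞ (fun q => (1 / 2) * N q) {0}ᶜ :=
  contDiffOn_const.mul h.smooth

theorem smooth_hess (h : IsMinkowskiSq b N) (i j : ι) :
    ContDiffOn ℝ ∞ (fun y => hess b N y i j) {0}ᶜ :=
  (h.smooth_half.dd _ isOpen_compl_singleton).dd _ isOpen_compl_singleton

theorem det_ne_zero (h : IsMinkowskiSq b N) (hy : y ≠ 0) : (hess b N y).det ≠ 0 :=
  (h.posDef y hy).det_pos.ne'

theorem smooth_inv (h : IsMinkowskiSq b N) (i j : ι) :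
    ContDiffOn ℝ ∞ (fun y => hessInv b N y i j) {0}ᶜ :=
  contDiffOn_inv h.smooth_hess (fun _ hy => h.det_ne_zero hy) i j

theorem hess_mul_inv (h : IsMinkowskiSq b N) (hy : y ≠ 0) : hess b N y * hessInv b N y = 1 :=
  Matrix.mul_nonsing_inv _ (h.det_ne_zero hy).isUnit

theorem inv_mul_hess (h : IsMinkowskiSq b N) (hy : y ≠ 0) : hessInv b N y * hess b N y = 1 :=
  Matrix.nonsing_inv_mul _ (h.det_ne_zero hy).isUnit

theorem sum_hess_mul_inv (h : IsMinkowskiSq b N) (hy : y ≠ 0) (i j : ι) :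
    ∑ k, hess b N y i k * hessInv b N y k j = if i = j then 1 else 0 := by
  rw [← Matrix.mul_apply, h.hess_mul_inv hy, Matrix.one_apply]

theorem sum_inv_mul_hess (h : IsMinkowskiSq b N) (hy : y ≠ 0) (i j : ι) :
    ∑ k, hessInv b N y i k * hess b N y k j = if i = j then 1 else 0 := by
  rw [← Matrix.mul_apply, h.inv_mul_hess hy, Matrix.one_apply]

theorem hess_symm (h : IsMinkowskiSq b N) (hy : y ≠ 0) (i j : ι) :
    hess b N y i j = hess b N y j i :=
  dd_comm _ _ isOpen_compl_singleton h.smooth_half hy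

theorem inv_symm (h : IsMinkowskiSq b N) (hy : y ≠ 0) (i j : ι) :
    hessInv b N y i j = hessInv b N y j i := by
  have : (hessInv b N y).transpose = hessInv b N y := by
    rw [hessInv, Matrix.transpose_nonsing_inv]
    congr 1
    ext i j
    exact h.hess_symm hy j i
  exact congrFun (congrFun this j) i

theorem inv_posDef (h : IsMinkowskiSq b N) (hy : y ≠ 0) : (hessInv b N y).PosDef :=
  (h.posDef y hy).inv

theorem dd_hess_symm (h : IsMinkowskiSq b N) (hy : y ≠ 0) (i j : ι) (v : E) :
    dd v (fun q => hess b N q i j) y = dd v (fun q => hess b N q j i) y :=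
  dd_congr v isOpen_compl_singleton (fun _ hz => h.hess_symm hz i j) hy

/-- Together with the symmetry of the Hessian this is the total symmetry of the Cartan torsion, a
third derivative of a single function. -/
theorem dd_hess_swap (h : IsMinkowskiSq b N) (hy : y ≠ 0) (i j k : ι) :
    dd (b k) (fun q => hess b N q i j) y = dd (b j) (fun q => hess b N q i k) y :=
  dd_comm (b k) (b j) isOpen_compl_singleton (h.smooth_half.dd (b i) isOpen_compl_singleton) hy

theorem dd_hess_swap' (h : IsMinkowskiSq b N) (hy : y ≠ 0) (i j k : ι) :
    dd (b k) (fun q => hess b N q i j) y = dd (b i) (fun q => hess b N q k j) y := by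
  rw [h.dd_hess_symm hy, h.dd_hess_swap hy, h.dd_hess_symm hy]

theorem dd_half_homog (h : IsMinkowskiSq b N) (hy : y ≠ 0) {c : ℝ} (hc : 0 < c) (v : E) :
    dd v (fun q => (1 / 2) * N q) (c • y) = c ^ (1 : ℤ) * dd v (fun q => (1 / 2) * N q) y := by
  have := dd_homogeneous (k := 2) (φ := fun q => (1 / 2) * N q) v hc (fun y _ => by
    have := h.homog c hc y
    simp only [this]
    norm_cast
    ring) hy
  simpa using this

theorem hess_homog (h : IsMinkowskiSq b N) (hy : y ≠ 0) {c : ℝ} (hc : 0 < c) :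
    hess b N (c • y) = hess b N y := by
  ext i j
  have := dd_homogeneous (k := 1) (b j) hc (fun y hy => h.dd_half_homog hy hc (b i)) hy
  simpa [hess] using this

theorem inv_homog (h : IsMinkowskiSq b N) (hy : y ≠ 0) {c : ℝ} (hc : 0 < c) :
    hessInv b N (c • y) = hessInv b N y := by
  rw [hessInv, hessInv, h.hess_homog hy hc]

theorem dd_inv_homog (h : IsMinkowskiSq b N) (hy : y ≠ 0) {c : ℝ} (hc : 0 < c) (i j : ι) (v : E) :
    dd v (fun q => hessInv b N q i j) (c • y) = c⁻¹ * dd v (fun q => hessInv b N q i j) y := by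
  have := dd_homogeneous (k := 0) (φ := fun q => hessInv b N q i j) v hc
    (fun y hy => by simp [h.inv_homog hy hc]) hy
  simpa using this

/-- Euler's identity `[N / 2]_{y^l} = g_{lm} y^m`. -/
theorem dd_half (h : IsMinkowskiSq b N) (hy : y ≠ 0) (l : ι) :
    dd (b l) (fun q => (1 / 2) * N q) y = ∑ m, hess b N y l m * b.repr y m := by
  have h1 := euler_identity (k := 1) ((h.smooth_half.dd (b l) isOpen_compl_singleton).diffAt isOpen_compl_singleton hy)
    (fun c hc => h.dd_half_homog hy hc (b l))
  rw [fderiv_eq_sum_dd b] at h1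
  simp only [Int.cast_one, one_mul] at h1
  rw [← h1]
  exact Finset.sum_congr rfl fun m _ => mul_comm _ _

theorem half_eq (h : IsMinkowskiSq b N) (hy : y ≠ 0) :
    N y = ∑ l, b.repr y l * ∑ m, hess b N y l m * b.repr y m := by
  have h1 := euler_identity (k := 2) (h.smooth_half.diffAt isOpen_compl_singleton hy)
    (fun c hc => by
      have := h.homog c hc y
      simp only [this]
      norm_cast
      ring)
  rw [fderiv_eq_sum_dd b] at h1
  simp only [h.dd_half hy] at h1
  rw [h1]; push_cast; ring

/-- Not part of the definition of a Minkowski norm here: by Euler's identity N(y) = g_{lm} y^l y^m,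
and g is positive definite. -/
theorem pos (h : IsMinkowskiSq b N) (hy : y ≠ 0) : 0 < N y := by
  rw [h.half_eq hy]
  have h1 : (fun i => b.repr y i) ≠ 0 := fun h0 => hy <| b.repr.map_eq_zero_iff.1 <| by
    ext i; exact congrFun h0 i
  simpa [dotProduct, Matrix.mulVec] using (h.posDef y hy).dotProduct_mulVec_pos h1

/-- `y_l g^{lm} = y^m`. -/
theorem sum_lower_inv (h : IsMinkowskiSq b N) (hy : y ≠ 0) (m : ι) :
    ∑ l, dd (b l) (fun q => (1 / 2) * N q) y * hessInv b N y l m = b.repr y m := by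
  simp only [h.dd_half hy, Finset.sum_mul]
  rw [Finset.sum_comm]
  have h1 : ∀ k, ∑ l, hess b N y l k * b.repr y k * hessInv b N y l m =
      b.repr y k * if k = m then 1 else 0 := fun k => by
    rw [← h.sum_hess_mul_inv hy k m, Finset.mul_sum]
    exact Finset.sum_congr rfl fun l _ => by rw [h.hess_symm hy l k]; ring
  simp [h1]

/-- Product rule for y_l φ^l, using ∂y_l/∂y^i = g_{li}. Applied to successively higher derivatives
of g^{lm}, it trades a derivative on the inverse metric for a contraction with g; this is how the
y_l in the Landsberg curvature is absorbed. -/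
theorem contract_lower (h : IsMinkowskiSq b N) (hy : y ≠ 0) {φ : ι → E → ℝ}
    (hφ : ∀ l, ContDiffOn ℝ ∞ (φ l) {0}ᶜ) (i : ι) :
    dd (b i) (fun z => ∑ l, dd (b l) (fun q => (1 / 2) * N q) z * φ l z) y =
      (∑ l, hess b N y l i * φ l y) +
        ∑ l, dd (b l) (fun q => (1 / 2) * N q) y * dd (b i) (φ l) y := by
  have h1 : ∀ l, DifferentiableAt ℝ (dd (b l) (fun q => (1 / 2) * N q)) y := fun l =>
    (h.smooth_half.dd (b l) isOpen_compl_singleton).diffAt isOpen_compl_singleton hy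
  have h2 : ∀ l, DifferentiableAt ℝ (φ l) y := fun l => (hφ l).diffAt isOpen_compl_singleton hy
  rw [dd_sum_mul _ h1 h2, Finset.sum_add_distrib]
  rfl

theorem _root_.Finsler.dd_repr (b : Module.Basis ι ℝ E) (i m : ι) (y : E) :
    dd (b i) (fun z => b.repr z m) y = if i = m then 1 else 0 := by
  have := b.finiteDimensional_of_finite
  have : (fun z => b.repr z m) = (b.coord m).toContinuousLinearMap := rfl
  simp only [dd, this, ContinuousLinearMap.fderiv]
  simp [Finsupp.single_apply]

/-- Differentiate y_l g^{lm} = y^m: the term g_{li} g^{lm} already accounts for the whole right-hand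
side. -/
theorem sum_lower_dd_inv (h : IsMinkowskiSq b N) (hy : y ≠ 0) (i m : ι) :
    ∑ l, dd (b l) (fun q => (1 / 2) * N q) y * dd (b i) (fun q => hessInv b N q l m) y = 0 := by
  have h1 := h.contract_lower hy (fun l => h.smooth_inv l m) i
  rw [dd_congr (b i) isOpen_compl_singleton (fun z hz => h.sum_lower_inv hz m) hy, dd_repr] at h1
  have h2 := h.sum_hess_mul_inv hy i m
  simp only [fun l => h.hess_symm hy l i, h2] at h1
  linarith

/-- Differentiate y_l ∂_i g^{lm} = 0 once more. -/
theorem sum_lower_dd_dd_inv (h : IsMinkowskiSq b N) (hy : y ≠ 0) (i j m : ι) :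
    ∑ l, dd (b l) (fun q => (1 / 2) * N q) y * dd (b j) (dd (b i) fun q => hessInv b N q l m) y =
      - ∑ l, hess b N y j l * dd (b i) (fun q => hessInv b N q l m) y := by
  have h1 := h.contract_lower hy (fun l => (h.smooth_inv l m).dd (b i) isOpen_compl_singleton) j
  rw [dd_congr (b j) isOpen_compl_singleton (fun z hz => h.sum_lower_dd_inv hz i m) hy, dd_const] at h1
  simp only [fun l => h.hess_symm hy l j] at h1
  linarith

/-- `∂g^{km}/∂y^k = -2 I^m`. -/
theorem sum_dd_inv (h : IsMinkowskiSq b N) (hy : y ≠ 0) (m : ι) :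
    ∑ k, dd (b k) (fun q => hessInv b N q k m) y = -2 * meanTorsionUp b N m y := by
  -- ∂g^{-1} = -g^{-1} (∂g) g^{-1}; after summation over k, total symmetry of ∂g produces the trace
  -- that defines the mean torsion, and C = ∂g/2 accounts for the factor 2.
  have h1 : ∀ k, dd (b k) (fun q => hessInv b N q k m) y = - ∑ q, ∑ p, hessInv b N y k p *
      dd (b k) (fun z => hess b N z p q) y * hessInv b N y q m := fun k => by
    have := dd_inv isOpen_compl_singleton h.smooth_hess (fun _ hz => h.det_ne_zero hz) hy (b k)
    have := congrFun (congrFun this k) m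
    simpa only [Matrix.of_apply, Matrix.neg_apply, Matrix.mul_apply, Finset.sum_mul] using! this
  simp only [h1, meanTorsionUp, meanTorsion, Finset.mul_sum, Finset.sum_neg_distrib]
  rw [Finset.sum_comm, ← Finset.sum_neg_distrib]
  refine Finset.sum_congr rfl fun q _ => ?_
  rw [← Finset.sum_neg_distrib]
  refine Finset.sum_congr rfl fun k _ => ?_
  rw [← Finset.sum_neg_distrib]
  refine Finset.sum_congr rfl fun p _ => ?_
  rw [h.inv_symm hy m q, h.dd_hess_symm hy p q, h.dd_hess_swap hy q p k]
  rw [h.dd_hess_swap hy q k p]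
  ring

/-- The contraction met in the components of the mean Landsberg curvature along the second factor,
where only two derivatives fall on g^{lm}. -/
theorem sum_inv_sum_lower (h : IsMinkowskiSq b N) (hy : y ≠ 0) (m : ι) :
    ∑ i, ∑ j, hessInv b N y i j * ∑ l, dd (b l) (fun q => (1 / 2) * N q) y *
      dd (b j) (dd (b i) fun q => hessInv b N q l m) y = 2 * meanTorsionUp b N m y := by
  have h1 := h.sum_dd_inv hy m
  have h2 : ∀ i, ∑ j, hessInv b N y i j * ∑ l, dd (b l) (fun q => (1 / 2) * N q) y *
      dd (b j) (dd (b i) fun q => hessInv b N q l m) y =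
      - dd (b i) (fun q => hessInv b N q i m) y := fun i => by
    simp only [h.sum_lower_dd_dd_inv hy, Finset.mul_sum, mul_neg, Finset.sum_neg_distrib]
    rw [Finset.sum_comm]
    simp only [← mul_assoc, ← Finset.sum_mul, h.sum_inv_mul_hess hy]
    simp
  simp only [h2, Finset.sum_neg_distrib, h1]
  ring

theorem _root_.Finsler.sum_inv_dd_hess (b : Module.Basis ι ℝ E) (N : E → ℝ) (y : E) (l : ι) :
    ∑ j, ∑ k, hessInv b N y j k * dd (b k) (fun q => hess b N q l j) y =
      2 * meanTorsion b N l y := by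
  simp only [meanTorsion, Finset.mul_sum]
  exact Finset.sum_congr rfl fun j _ => Finset.sum_congr rfl fun k _ => by ring

/-- The contraction met in the components along the first factor. Differentiating the second-order
identity gives three terms: two of them reduce to ∂_j∂_i g^{jm}, that is 2 ∂_i I^m each, and the one
with ∂g contracts to the mean torsion. -/
theorem sum_inv_sum_lower_three (h : IsMinkowskiSq b N) (hy : y ≠ 0) (i m : ι) :
    ∑ j, ∑ k, hessInv b N y j k * ∑ l, dd (b l) (fun q => (1 / 2) * N q) y *
      dd (b k) (dd (b j) (dd (b i) fun q => hessInv b N q l m)) y =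
      4 * dd (b i) (meanTorsionUp b N m) y -
        2 * ∑ l, meanTorsion b N l y * dd (b i) (fun q => hessInv b N q l m) y := by
  have hd : ∀ l, ContDiffOn ℝ ∞ (dd (b i) fun q => hessInv b N q l m) {0}ᶜ := fun l =>
    (h.smooth_inv l m).dd _ isOpen_compl_singleton
  have hd2 : ∀ l j, ContDiffOn ℝ ∞ (dd (b j) (dd (b i) fun q => hessInv b N q l m)) {0}ᶜ :=
    fun l j => (hd l).dd _ isOpen_compl_singleton
  have h1 : ∀ j k, ∑ l, dd (b l) (fun q => (1 / 2) * N q) y *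
      dd (b k) (dd (b j) (dd (b i) fun q => hessInv b N q l m)) y =
      - (∑ l, hess b N y k l * dd (b j) (dd (b i) fun q => hessInv b N q l m) y)
      - (∑ l, dd (b k) (fun q => hess b N q l j) y * dd (b i) (fun q => hessInv b N q l m) y)
      - ∑ l, hess b N y j l * dd (b k) (dd (b i) fun q => hessInv b N q l m) y := fun j k => by
    have e1 := h.contract_lower hy (fun l => hd2 l j) k
    rw [dd_congr (b k) isOpen_compl_singleton (fun z hz => h.sum_lower_dd_dd_inv hz i j m) hy] at e1
    have e2 : ∀ l, DifferentiableAt ℝ (fun z => hess b N z j l) y := fun l =>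
      (h.smooth_hess j l).diffAt isOpen_compl_singleton hy
    have e3 : ∀ l, DifferentiableAt ℝ (dd (b i) fun q => hessInv b N q l m) y := fun l =>
      (hd l).diffAt isOpen_compl_singleton hy
    have e4 : dd (b k) (fun z => - ∑ l, hess b N z j l * dd (b i) (fun q => hessInv b N q l m) z) y
        = - ∑ l, (dd (b k) (fun q => hess b N q l j) y * dd (b i) (fun q => hessInv b N q l m) y +
          hess b N y j l * dd (b k) (dd (b i) fun q => hessInv b N q l m) y) := by
      have : (fun z => - ∑ l, hess b N z j l * dd (b i) (fun q => hessInv b N q l m) z) =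
        fun z => (-1) * ∑ l, hess b N z j l * dd (b i) (fun q => hessInv b N q l m) z := by
        ext; ring
      rw [this, dd_const_mul, dd_sum_mul _ e2 e3, neg_one_mul]
      simp only [h.dd_hess_symm hy j]
    rw [e4, Finset.sum_add_distrib] at e1
    simp only [fun l => h.hess_symm hy l k] at e1
    linarith
  have hI : dd (b i) (meanTorsionUp b N m) y =
      - (1 / 2) * ∑ l, dd (b l) (dd (b i) fun q => hessInv b N q l m) y := by
    have e1 : Set.EqOn (meanTorsionUp b N m)
        (fun z => - (1 / 2) * ∑ k, dd (b k) (fun q => hessInv b N q k m) z) {0}ᶜ := fun z hz => by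
      have := h.sum_dd_inv hz m
      simp only [this]; ring
    rw [dd_congr (b i) isOpen_compl_singleton e1 hy, dd_const_mul, dd_sum _ _ fun k _ =>
      ((h.smooth_inv k m).dd _ isOpen_compl_singleton).diffAt isOpen_compl_singleton hy]
    congr 1
    exact Finset.sum_congr rfl fun k _ => dd_comm _ _ isOpen_compl_singleton (h.smooth_inv k m) hy
  have hA : ∑ j, ∑ k, hessInv b N y j k *
      ∑ l, hess b N y k l * dd (b j) (dd (b i) fun q => hessInv b N q l m) y =
      ∑ j, dd (b j) (dd (b i) fun q => hessInv b N q j m) y := by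
    refine Finset.sum_congr rfl fun j _ => ?_
    simp only [Finset.mul_sum]
    rw [Finset.sum_comm]
    simp only [← mul_assoc, ← Finset.sum_mul, h.sum_inv_mul_hess hy]
    simp
  have hC : ∑ j, ∑ k, hessInv b N y j k *
      ∑ l, hess b N y j l * dd (b k) (dd (b i) fun q => hessInv b N q l m) y =
      ∑ j, dd (b j) (dd (b i) fun q => hessInv b N q j m) y := by
    rw [← hA, Finset.sum_comm]
    exact Finset.sum_congr rfl fun j _ => Finset.sum_congr rfl fun k _ => by
      rw [h.inv_symm hy]
  have hB : ∑ j, ∑ k, hessInv b N y j k * ∑ l, dd (b k) (fun q => hess b N q l j) y *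
      dd (b i) (fun q => hessInv b N q l m) y =
      2 * ∑ l, meanTorsion b N l y * dd (b i) (fun q => hessInv b N q l m) y := by
    rw [Finset.mul_sum]
    simp only [← mul_assoc, ← sum_inv_dd_hess, Finset.mul_sum, Finset.sum_mul]
    rw [Finset.sum_comm' (t' := Finset.univ) (s' := fun _ => Finset.univ) (by simp)]
    rw [Finset.sum_comm]
    conv_rhs => rw [Finset.sum_comm]
    refine Finset.sum_congr rfl fun j _ => ?_
    rw [Finset.sum_comm]
  simp only [h1, mul_sub, mul_neg, Finset.sum_sub_distrib, Finset.sum_neg_distrib]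
  rw [hA, hB, hC, hI]
  ring

end IsMinkowskiSq

end Fiber

/-! ### Rigidity: a constant covector annihilating the mean Cartan torsion -/

section Rigidity

variable {ι E : Type*} [Fintype ι] [DecidableEq ι] [NormedAddCommGroup E] [NormedSpace ℝ E]

/-- A continuous `0`-homogeneous function on the complement of the origin attains its maximum. -/
theorem exists_forall_le_of_homogeneous [FiniteDimensional ℝ E] [Nontrivial E] {ψ : E → ℝ}
    (hψ : ContinuousOn ψ {0}ᶜ) (hom : ∀ c : ℝ, 0 < c → ∀ y, y ≠ 0 → ψ (c • y) = ψ y) :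
    ∃ y, y ≠ 0 ∧ ∀ z, z ≠ 0 → ψ z ≤ ψ y := by
  have hne : (Metric.sphere (0 : E) 1).Nonempty := NormedSpace.sphere_nonempty.2 zero_le_one
  have hS : Metric.sphere (0 : E) 1 ⊆ {0}ᶜ := fun y hy h0 => by
    rw [Set.mem_singleton_iff] at h0
    simp [h0] at hy
  obtain ⟨y, hy, hmax⟩ := (isCompact_sphere (0 : E) 1).exists_isMaxOn hne (hψ.mono hS)
  refine ⟨y, hS hy, fun z hz => ?_⟩
  have hz' : 0 < ‖z‖ := norm_pos_iff.2 hz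
  rw [← hom ‖z‖⁻¹ (inv_pos.2 hz') z hz]
  refine hmax ?_
  simp [norm_smul, hz'.ne']

namespace IsMinkowskiSq

variable {b : Module.Basis ι ℝ E} {N : E → ℝ} {y : E}

theorem sum_lower_repr (h : IsMinkowskiSq b N) (hy : y ≠ 0) :
    ∑ l, dd (b l) (fun q => (1 / 2) * N q) y * b.repr y l = N y := by
  rw [h.half_eq hy]
  exact Finset.sum_congr rfl fun l _ => by rw [h.dd_half hy, mul_comm]

/-- The Legendre transformation is injective. -/
theorem lower_injective (h : IsMinkowskiSq b N) {y z : E} (hy : y ≠ 0) (hz : z ≠ 0)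
    (heq : ∀ l, dd (b l) (fun q => (1 / 2) * N q) y = dd (b l) (fun q => (1 / 2) * N q) z) :
    y = z := by
  by_contra hne
  have hw : z - y ≠ 0 := sub_ne_zero.2 (Ne.symm hne)
  set w := z - y with hwdef
  -- N is not smooth at the origin, so a segment through it is treated separately: y and z then
  -- point in opposite directions, and pairing with the common Legendre image gives (1 - τ) N(y) + τ
  -- N(z) = 0, against positivity.
  by_cases h0 : ∃ τ ∈ Set.Icc (0 : ℝ) 1, y + τ • w = 0
  · obtain ⟨τ, ⟨h1, h2⟩, h3⟩ := h0
    have h4 : (1 - τ) • y + τ • z = 0 := by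
      rw [← h3, hwdef]; module
    have hτ : τ ≠ 0 := fun h5 => hy (by simpa [h5] using h4)
    have h5 : ∀ l, (1 - τ) * b.repr y l + τ * b.repr z l = 0 := fun l => by
      have := congrArg (fun v => b.repr v l) h4
      simpa using this
    have h6 := h.sum_lower_repr hy
    have h7 := h.sum_lower_repr hz
    have h8 : (1 - τ) * N y + τ * N z = 0 := by
      rw [← h6, ← h7, Finset.mul_sum, Finset.mul_sum, ← Finset.sum_add_distrib]
      refine Finset.sum_eq_zero fun l _ => ?_
      rw [heq l]
      linear_combination (dd (b l) (fun q => (1 / 2) * N q) z) * h5 l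
    have h9 := h.pos hy
    have h10 := h.pos hz
    have h11 : 0 < τ := lt_of_le_of_ne h1 hτ.symm
    nlinarith [mul_pos h11 h10, mul_nonneg (sub_nonneg.2 h2) h9.le]
  · push Not at h0
    -- The derivative of N/2 along the segment, tested on w. It agrees at both ends, so by Rolle its
    -- derivative g(w, w) vanishes somewhere between, contradicting positive definiteness.
    set θ : ℝ → ℝ := fun τ => ∑ l, b.repr w l * dd (b l) (fun q => (1 / 2) * N q) (y + τ • w)
    have hd : ∀ τ ∈ Set.Icc (0 : ℝ) 1, HasDerivAt θ
        (∑ l, b.repr w l * ∑ m, hess b N (y + τ • w) l m * b.repr w m) τ := fun τ hτ => by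
      refine HasDerivAt.fun_sum fun l _ => HasDerivAt.const_mul _ ?_
      have h1 : HasDerivAt (fun τ : ℝ => y + τ • w) w τ := by
        simpa using ((hasDerivAt_id τ).smul_const w).const_add y
      have h2 := ((h.smooth_half.dd (b l) isOpen_compl_singleton).diffAt isOpen_compl_singleton
        (h0 τ hτ)).hasFDerivAt
      have h3 := h2.comp_hasDerivAt τ h1
      rw [fderiv_eq_sum_dd b] at h3
      refine h3.congr_deriv (Finset.sum_congr rfl fun m _ => ?_)
      rw [mul_comm]
      rfl
    obtain ⟨τ, hτ, h1⟩ := exists_hasDerivAt_eq_zero (f := θ) zero_lt_one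
      (fun τ hτ => (hd τ hτ).continuousAt.continuousWithinAt)
      (by
        have e1 : y + (0 : ℝ) • w = y := by simp
        have e2 : y + (1 : ℝ) • w = z := by simp [hwdef]
        simp only [θ, e1, e2, heq]) (fun τ hτ => hd τ (Set.Ioo_subset_Icc_self hτ))
    have h2 := h.posDef _ (h0 τ (Set.Ioo_subset_Icc_self hτ))
    have h3 : (fun i => b.repr w i) ≠ 0 := fun h0 => hw <| b.repr.map_eq_zero_iff.1 <| by
      ext i; exact congrFun h0 i
    have h4 := h2.dotProduct_mulVec_pos h3
    simp only [dotProduct, Matrix.mulVec, star_trivial] at h4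
    linarith

/-- The derivative of the determinant of the fundamental tensor. -/
theorem dd_det_hess (h : IsMinkowskiSq b N) (hy : y ≠ 0) (l : ι) :
    dd (b l) (fun q => (hess b N q).det) y = (hess b N y).det * (2 * meanTorsion b N l y) := by
  rw [dd_det isOpen_compl_singleton h.smooth_hess (fun _ hz => h.det_ne_zero hz) hy,
    ← sum_inv_dd_hess]
  congr 1
  refine Finset.sum_congr rfl fun i _ => Finset.sum_congr rfl fun j _ => ?_
  rw [h.dd_hess_swap' hy i j l, h.dd_hess_swap hy l j i, h.dd_hess_swap hy l i j]
  rw [mul_comm]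
  congr 1
  exact h.inv_symm hy j i

/-- Euler's identity for the 0-homogeneous functions g_{ij}. -/
theorem dd_hess_radial (h : IsMinkowskiSq b N) (hy : y ≠ 0) (i j : ι) :
    ∑ k, b.repr y k * dd (b k) (fun q => hess b N q i j) y = 0 := by
  rw [← fderiv_eq_sum_dd b (fun q => hess b N q i j)]
  have := euler_identity (k := 0) ((h.smooth_hess i j).diffAt isOpen_compl_singleton hy)
    (fun c hc => by simp [h.hess_homog hy hc])
  simpa using this

/-- In dimension one the Cartan torsion vanishes. -/
theorem dd_hess_eq_zero_of_subsingleton [Subsingleton ι] (h : IsMinkowskiSq b N) (hy : y ≠ 0)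
    (i j k : ι) : dd (b k) (fun q => hess b N q i j) y = 0 := by
  have h1 := h.dd_hess_radial hy i j
  rw [Fintype.sum_subsingleton _ k] at h1
  refine (mul_eq_zero.1 h1).resolve_left fun h2 => hy <| b.repr.map_eq_zero_iff.1 <| ?_
  ext l
  rw [Subsingleton.elim l k, h2]
  rfl

theorem sqrt_homog (h : IsMinkowskiSq b N) {c : ℝ} (hc : 0 < c) (y : E) :
    √(N (c • y)) = c * √(N y) := by
  rw [h.homog c hc, Real.sqrt_mul (by positivity), Real.sqrt_sq hc.le]

/-- Where the derivative of `s / √N`, `s = c_m y^m`, along the dual vector field `g^{lm} c_m`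
vanishes, `c` is a multiple of the Legendre transform of `y`. -/
theorem eq_smul_lower (h : IsMinkowskiSq b N) (hy : y ≠ 0) (c : ι → ℝ)
    (hcrit : fderiv ℝ (fun q => (∑ m, c m * b.repr q m) / √(N q)) y
      (∑ l, (∑ m, hessInv b N y l m * c m) • b l) = 0) (l : ι) :
    c l = (∑ m, c m * b.repr y m) / N y * dd (b l) (fun q => (1 / 2) * N q) y := by
  have := b.finiteDimensional_of_finite
  set Y : ι → ℝ := fun l => dd (b l) (fun q => (1 / 2) * N q) y
  set K := hessInv b N y with hK
  set s := ∑ m, c m * b.repr y m with hs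
  set z := ∑ l, (∑ m, K l m * c m) • b l with hz
  have hpos := h.pos hy
  have hN : DifferentiableAt ℝ N y := h.smooth.diffAt isOpen_compl_singleton hy
  have hr : DifferentiableAt ℝ (fun q => √(N q)) y := hN.sqrt hpos.ne'
  have hrpos : 0 < √(N y) := Real.sqrt_pos.2 hpos
  have hrep : ∀ i, b.repr z i = ∑ m, K i m * c m := fun i => by
    rw [hz, b.repr_sum_self]
  have hsd : DifferentiableAt ℝ (fun q => ∑ m, c m * b.repr q m) y := by
    have : (fun q => ∑ m, c m * b.repr q m) =
      fun q => ∑ m, c m * (b.coord m).toContinuousLinearMap q := rfl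
    rw [this]; fun_prop
  have hYc : ∑ l, Y l * ∑ m, K l m * c m = s := by
    simp only [Finset.mul_sum, ← mul_assoc]
    rw [Finset.sum_comm]
    simp only [← Finset.sum_mul]
    exact Finset.sum_congr rfl fun m _ => by rw [h.sum_lower_inv hy, mul_comm]
  have hDN : fderiv ℝ N y z = 2 * s := by
    have e1 : fderiv ℝ (fun q => (1 / 2) * N q) y z = s := by
      rw [fderiv_eq_sum_dd b, ← hYc]
      exact Finset.sum_congr rfl fun l _ => by rw [hrep, mul_comm]
    have e2 : dd z (fun q => (1 / 2) * N q) y = (1 / 2) * dd z N y := dd_const_mul z _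
    simp only [dd] at e2
    linarith
  have hDs : fderiv ℝ (fun q => ∑ m, c m * b.repr q m) y z = ∑ l, c l * ∑ m, K l m * c m := by
    rw [fderiv_eq_sum_dd b]
    refine Finset.sum_congr rfl fun l _ => ?_
    rw [hrep, mul_comm]
    congr 1
    have e0 : ∀ m, DifferentiableAt ℝ (fun q => b.repr q m) y := fun m =>
      (b.coord m).toContinuousLinearMap.differentiableAt
    rw [dd_sum (φ := fun m q => c m * b.repr q m) _ _ fun m _ => (e0 m).const_mul _]
    simp [dd_const_mul, dd_repr]
  have hDr : 2 * √(N y) * fderiv ℝ (fun q => √(N q)) y z = 2 * s := by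
    have e1 : dd z (fun q => √(N q) * √(N q)) y = dd z N y := by
      refine dd_congr (S := {0}ᶜ) z isOpen_compl_singleton (fun q hq => ?_) hy
      exact Real.mul_self_sqrt (h.pos hq).le
    rw [dd_mul z hr hr] at e1
    simp only [dd, hDN] at e1
    linarith
  -- Criticality says that |c|² = s²/N in the dual metric. Since the Legendre covector Y has |Y|² =
  -- N and ⟨c, Y⟩ = s, this is equality in Cauchy-Schwarz.
  have hcKc : (∑ l, c l * ∑ m, K l m * c m) = s ^ 2 / N y := by
    have e1 : dd z (fun q => (∑ m, c m * b.repr q m) / √(N q) * √(N q)) y =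
        dd z (fun q => ∑ m, c m * b.repr q m) y := by
      refine dd_congr (S := {0}ᶜ) z isOpen_compl_singleton (fun q hq => ?_) hy
      exact div_mul_cancel₀ _ (Real.sqrt_pos.2 (h.pos hq)).ne'
    have hφd : DifferentiableAt ℝ (fun q => (∑ m, c m * b.repr q m) / √(N q)) y :=
      diffAt_div hsd hr hrpos.ne'
    rw [dd_mul z hφd hr] at e1
    simp only [dd, hDs] at e1
    rw [hcrit] at e1
    rw [← e1]
    have e2 : fderiv ℝ (fun q => √(N q)) y z = s / √(N y) := by
      field_simp; linarith
    rw [e2, zero_mul, zero_add, div_mul_div_comm, Real.mul_self_sqrt hpos.le]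
    ring
  have hYY : ∑ l, Y l * ∑ m, K l m * Y m = N y := by
    rw [← h.sum_lower_repr hy]
    simp only [Finset.mul_sum, ← mul_assoc]
    rw [Finset.sum_comm]
    simp only [← Finset.sum_mul]
    exact Finset.sum_congr rfl fun m _ => by rw [h.sum_lower_inv hy, mul_comm]
  have hcY : ∑ l, c l * ∑ m, K l m * Y m = s := by
    rw [← hYc]
    simp only [Finset.mul_sum]
    rw [Finset.sum_comm]
    exact Finset.sum_congr rfl fun m _ => Finset.sum_congr rfl fun l _ => by
      rw [hK, h.inv_symm hy m l]; ring
  -- The component of c orthogonal to Y has square length |c|² - s²/N = 0.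
  have hzero : (fun l => c l - s / N y * Y l) = 0 := by
    by_contra hne
    have h1 := (h.inv_posDef hy).dotProduct_mulVec_pos hne
    simp only [dotProduct, Matrix.mulVec, star_trivial, ← hK] at h1
    have h2 : ∑ l, (c l - s / N y * Y l) * ∑ m, K l m * (c m - s / N y * Y m) =
        (∑ l, c l * ∑ m, K l m * c m) - s / N y * (∑ l, c l * ∑ m, K l m * Y m)
        - s / N y * (∑ l, Y l * ∑ m, K l m * c m)
        + (s / N y) ^ 2 * ∑ l, Y l * ∑ m, K l m * Y m := by
      simp only [Finset.mul_sum, ← Finset.sum_sub_distrib, ← Finset.sum_add_distrib]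
      exact Finset.sum_congr rfl fun l _ => Finset.sum_congr rfl fun m _ => by ring
    rw [h2, hcKc, hcY, hYc, hYY] at h1
    have h3 : s ^ 2 / N y - s / N y * s - s / N y * s + (s / N y) ^ 2 * N y = 0 := by
      field_simp; ring
    linarith
  have := congrFun hzero l
  simp only [Pi.zero_apply] at this
  linarith

end IsMinkowskiSq

end Rigidity

section Rigidity

variable {ι E : Type*} [Fintype ι] [DecidableEq ι] [NormedAddCommGroup E] [NormedSpace ℝ E]

namespace IsMinkowskiSq

variable {b : Module.Basis ι ℝ E} {N : E → ℝ} {y : E}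

/-- A covector has a nontrivial kernel in dimension at least two. On this kernel s = 0, so no
critical point of s/√N lies there. -/
theorem exists_repr_eq_zero [Nontrivial ι] (b : Module.Basis ι ℝ E) (c : ι → ℝ) :
    ∃ y : E, y ≠ 0 ∧ ∑ m, c m * b.repr y m = 0 := by
  obtain ⟨i, j, hij⟩ := exists_pair_ne ι
  by_cases hi : c i = 0
  · refine ⟨b i, b.ne_zero i, ?_⟩
    simp [Finsupp.single_apply, hi]
  · refine ⟨c j • b i - c i • b j, fun h0 => hi ?_, ?_⟩
    · have := congrArg (fun v => b.repr v j) h0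
      simpa [Finsupp.single_apply, hij] using this
    · simp [Finsupp.single_apply, mul_sub, Finset.sum_sub_distrib, mul_comm]

/-- If the raised mean Cartan torsion of a Minkowski norm is annihilated by a nonzero covector, then
the mean Cartan torsion vanishes. -/
theorem meanTorsion_eq_zero_of_annihilates (h : IsMinkowskiSq b N) {c : ι → ℝ} (hc : c ≠ 0)
    (hI : ∀ y, y ≠ 0 → ∑ m, meanTorsionUp b N m y * c m = 0) (hy : y ≠ 0) (l : ι) :
    meanTorsion b N l y = 0 := by
  have hfin := b.finiteDimensional_of_finite
  -- In dimension one the torsion vanishes outright; the argument below needs a nonzero vector in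
  -- the kernel of c.
  rcases subsingleton_or_nontrivial ι with hss | hnt
  · simp [meanTorsion, h.dd_hess_eq_zero_of_subsingleton hy]
  have hnE : Nontrivial E := ⟨⟨y, 0, hy⟩⟩
  set δ : E → ℝ := fun q => (hess b N q).det with hδ
  set s : E → ℝ := fun q => ∑ m, c m * b.repr q m with hs
  set φ : E → ℝ := fun q => s q / √(N q) with hφ
  have hδs : ContDiffOn ℝ ∞ δ {0}ᶜ := contDiffOn_det h.smooth_hess
  have hδd : ∀ y, y ≠ 0 → DifferentiableAt ℝ δ y := fun y hy =>
    hδs.diffAt isOpen_compl_singleton hy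
  have hsd : Differentiable ℝ s := by
    have : s = fun q => ∑ m, c m * (b.coord m).toContinuousLinearMap q := rfl
    rw [this]; fun_prop
  have hφd : ∀ y, y ≠ 0 → DifferentiableAt ℝ φ y := fun y hy =>
    diffAt_div (hsd y) ((h.smooth.diffAt isOpen_compl_singleton hy).sqrt (h.pos hy).ne')
      (Real.sqrt_pos.2 (h.pos hy)).ne'
  have hδh : ∀ a : ℝ, 0 < a → ∀ y, y ≠ 0 → δ (a • y) = δ y := fun a ha y hy => by
    simp only [hδ, h.hess_homog hy ha]
  have hsh : ∀ (a : ℝ) y, s (a • y) = a * s y := fun a y => by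
    simp only [hs, map_smul, Finset.mul_sum]
    exact Finset.sum_congr rfl fun m _ => by simp; ring
  have hφh : ∀ a : ℝ, 0 < a → ∀ y, y ≠ 0 → φ (a • y) = φ y := fun a ha y hy => by
    simp only [hφ, hsh, h.sqrt_homog ha]
    exact mul_div_mul_left _ _ ha.ne'
  set Z : E → E := fun y => ∑ l, (∑ m, hessInv b N y l m * c m) • b l with hZ
  -- dδ(Z) = 2 δ I_l g^{lm} c_m = 2 δ I^m c_m, which is the hypothesis.
  have hZδ : ∀ y, y ≠ 0 → fderiv ℝ δ y (Z y) = 0 := fun y hy => by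
    rw [fderiv_eq_sum_dd b]
    have e1 : ∀ l, b.repr (Z y) l = ∑ m, hessInv b N y l m * c m := fun l => by
      rw [hZ, b.repr_sum_self]
    simp only [e1, hδ, h.dd_det_hess hy]
    have e2 := hI y hy
    simp only [meanTorsionUp, Finset.sum_mul] at e2
    rw [Finset.sum_comm] at e2
    calc _ = (hess b N y).det * 2 *
        ∑ l, ∑ m, hessInv b N y m l * meanTorsion b N l y * c m := by
          simp only [Finset.mul_sum, Finset.sum_mul]
          exact Finset.sum_congr rfl fun l _ => Finset.sum_congr rfl fun m _ => by
            rw [h.inv_symm hy l m]; ring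
      _ = 0 := by rw [e2, mul_zero]
  have hcrit : ∀ y, y ≠ 0 → fderiv ℝ φ y (Z y) = 0 → ∀ l,
      c l = s y / N y * dd (b l) (fun q => (1 / 2) * N q) y := fun y hy h0 l =>
    h.eq_smul_lower hy c h0 l
  have hs0 : ∀ y, y ≠ 0 → fderiv ℝ φ y (Z y) = 0 → s y ≠ 0 := fun y hy h0 h1 => hc <| by
    ext l
    simp [hcrit y hy h0 l, h1]
  -- critical points on which `s` has the same sign lie on the same ray
  have hray : ∀ y z, y ≠ 0 → z ≠ 0 → fderiv ℝ φ y (Z y) = 0 → fderiv ℝ φ z (Z z) = 0 →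
      0 < s y * s z → ∃ a : ℝ, 0 < a ∧ z = a • y := by
    intro y z hy hz h1 h2 h3
    have hp : ∀ y, y ≠ 0 → s y ≠ 0 → 0 < |s y / N y| := fun y hy h0 =>
      abs_pos.2 (div_ne_zero h0 (h.pos hy).ne')
    have hpy := hp y hy (hs0 y hy h1)
    have hpz := hp z hz (hs0 z hz h2)
    -- At a critical point c = (s/N) Y, so the Legendre image of |s/N| y is c or -c according to the
    -- sign of s; equal signs give equal images.
    have e1 : |s y / N y| • y = |s z / N z| • z := by
      refine h.lower_injective (smul_ne_zero hpy.ne' hy) (smul_ne_zero hpz.ne' hz) fun l => ?_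
      rw [h.dd_half_homog hy hpy, h.dd_half_homog hz hpz, zpow_one, zpow_one]
      have e2 := hcrit y hy h1 l
      have e3 := hcrit z hz h2 l
      have hNy := h.pos hy
      have hNz := h.pos hz
      rcases lt_or_gt_of_ne (hs0 y hy h1) with h4 | h4
      · have h5 : s z < 0 := neg_of_mul_pos_right h3 h4.le
        rw [abs_of_neg (div_neg_of_neg_of_pos h4 hNy), abs_of_neg (div_neg_of_neg_of_pos h5 hNz)]
        linarith
      · have h5 : 0 < s z := pos_of_mul_pos_right h3 h4.le
        rw [abs_of_pos (div_pos h4 hNy), abs_of_pos (div_pos h5 hNz)]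
        linarith
    refine ⟨|s z / N z|⁻¹ * |s y / N y|, by positivity, ?_⟩
    rw [mul_smul, e1, smul_smul, inv_mul_cancel₀ hpz.ne', one_smul]
  -- extrema of `δ + ε φ` are critical points
  have hmax : ∀ ε σ : ℝ, ε ≠ 0 → σ ≠ 0 → ∃ y, y ≠ 0 ∧ fderiv ℝ φ y (Z y) = 0 ∧
      ∀ z, z ≠ 0 → σ * (δ z + ε * φ z) ≤ σ * (δ y + ε * φ y) := by
    intro ε σ hε hσ
    have hd : ∀ y, y ≠ 0 → DifferentiableAt ℝ (fun q => σ * (δ q + ε * φ q)) y := fun y hy =>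
      ((hδd y hy).add ((hφd y hy).const_mul ε)).const_mul σ
    obtain ⟨y, hy, hm⟩ := exists_forall_le_of_homogeneous (ψ := fun q => σ * (δ q + ε * φ q))
      (fun y hy => (hd y hy).continuousAt.continuousWithinAt)
      (fun a ha y hy => by simp only [hδh a ha y hy, hφh a ha y hy])
    refine ⟨y, hy, ?_, hm⟩
    have hlm : IsLocalMax (fun q => σ * (δ q + ε * φ q)) y := by
      filter_upwards [isOpen_ne.mem_nhds hy] with z hz using hm z hz
    have e1 : dd (Z y) (fun q => σ * (δ q + ε * φ q)) y = 0 := by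
      simp [dd, hlm.fderiv_eq_zero]
    rw [dd_const_mul, dd_add _ (hδd y hy) ((hφd y hy).const_mul ε), dd_const_mul] at e1
    have e2 : dd (Z y) δ y = 0 := hZδ y hy
    rw [e2, zero_add] at e1
    exact (mul_eq_zero.1 ((mul_eq_zero.1 e1).resolve_left hσ)).resolve_left hε
  -- `δ + ε φ` is not constant
  have hnc : ∀ ε : ℝ, ε ≠ 0 → ∀ C : ℝ, ¬ ∀ z, z ≠ 0 → δ z + ε * φ z = C := by
    intro ε hε C hC
    -- Were δ + εφ constant, every point would be critical for φ along Z, including this one with s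
    -- = 0.
    obtain ⟨y, hy, hsy⟩ := exists_repr_eq_zero b c
    refine hs0 y hy ?_ hsy
    have e1 : dd (Z y) (fun q => δ q + ε * φ q) y = dd (Z y) (fun _ => C) y :=
      dd_congr (S := {0}ᶜ) _ isOpen_compl_singleton (fun z hz => hC z hz) hy
    rw [dd_const, dd_add _ (hδd y hy) ((hφd y hy).const_mul ε), dd_const_mul] at e1
    have e2 : dd (Z y) δ y = 0 := hZδ y hy
    rw [e2, zero_add] at e1
    exact (mul_eq_zero.1 e1).resolve_left hε
  have hsame : ∀ y z, y ≠ 0 → z ≠ 0 → fderiv ℝ φ y (Z y) = 0 → fderiv ℝ φ z (Z z) = 0 →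
      0 < s y * s z → δ z = δ y ∧ φ z = φ y := by
    intro y z hy hz h1 h2 h3
    obtain ⟨a, ha, rfl⟩ := hray y z hy hz h1 h2 h3
    exact ⟨hδh a ha y hy, hφh a ha y hy⟩
  -- The maximum and the minimum of δ + φ are both attained on critical rays. If these coincided,
  -- the function would be constant; hence both signs of s occur.
  obtain ⟨p, q, hp, hq, hcp, hcq, hsp, hsq⟩ : ∃ p q, p ≠ 0 ∧ q ≠ 0 ∧ fderiv ℝ φ p (Z p) = 0 ∧
      fderiv ℝ φ q (Z q) = 0 ∧ 0 < s p ∧ s q < 0 := by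
    obtain ⟨a, ha, hca, hma⟩ := hmax 1 1 one_ne_zero one_ne_zero
    obtain ⟨d, hd, hcd, hmd⟩ := hmax 1 (-1) one_ne_zero (by norm_num)
    have key : ¬ 0 < s a * s d := fun h3 => by
      obtain ⟨e1, e2⟩ := hsame a d ha hd hca hcd h3
      refine hnc 1 one_ne_zero (δ a + 1 * φ a) fun z hz => le_antisymm ?_ ?_
      · linarith [hma z hz]
      · have := hmd z hz
        rw [e1, e2] at this
        linarith
    rcases lt_or_gt_of_ne (hs0 a ha hca) with h1 | h1 <;>
      rcases lt_or_gt_of_ne (hs0 d hd hcd) with h2 | h2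
    · exact absurd (mul_pos_of_neg_of_neg h1 h2) key
    · exact ⟨d, a, hd, ha, hcd, hca, h2, h1⟩
    · exact ⟨a, d, ha, hd, hca, hcd, h1, h2⟩
    · exact absurd (mul_pos h1 h2) key
  have hval : ∀ y, y ≠ 0 → fderiv ℝ φ y (Z y) = 0 →
      (δ y = δ p ∧ φ y = φ p) ∨ (δ y = δ q ∧ φ y = φ q) := fun y hy h0 => by
    rcases lt_or_gt_of_ne (hs0 y hy h0) with h1 | h1
    · exact Or.inr (hsame q y hq hy hcq h0 (mul_pos_of_neg_of_neg hsq h1))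
    · exact Or.inl (hsame p y hp hy hcp h0 (mul_pos hsp h1))
  have hφpq : φ q < φ p :=
    (div_neg_of_neg_of_pos hsq (Real.sqrt_pos.2 (h.pos hq))).trans
      (div_pos hsp (Real.sqrt_pos.2 (h.pos hp)))
  have hδpq : δ p = δ q := by
    by_contra hne
    -- The value for which δ + εφ agrees on the two critical rays; its maximum and minimum then
    -- coincide, making it constant.
    set ε := (δ q - δ p) / (φ p - φ q) with hε
    have hε0 : ε ≠ 0 := div_ne_zero (sub_ne_zero.2 (Ne.symm hne)) (sub_pos.2 hφpq).ne'
    have e0 : δ q + ε * φ q = δ p + ε * φ p := by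
      have : ε * (φ p - φ q) = δ q - δ p := div_mul_cancel₀ _ (sub_pos.2 hφpq).ne'
      linarith
    obtain ⟨a, ha, hca, hma⟩ := hmax ε 1 hε0 one_ne_zero
    obtain ⟨d, hd, hcd, hmd⟩ := hmax ε (-1) hε0 (by norm_num)
    have e1 : ∀ y, y ≠ 0 → fderiv ℝ φ y (Z y) = 0 → δ y + ε * φ y = δ p + ε * φ p :=
      fun y hy h0 => by
        rcases hval y hy h0 with ⟨h1, h2⟩ | ⟨h1, h2⟩
        · rw [h1, h2]
        · rw [h1, h2, e0]
    refine hnc ε hε0 (δ p + ε * φ p) fun z hz => le_antisymm ?_ ?_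
    · linarith [hma z hz, e1 a ha hca]
    · linarith [hmd z hz, e1 d hd hcd]
  have hconst : ∀ z, z ≠ 0 → δ z = δ p := by
    intro z hz
    -- At the extrema of δ + εφ the value of δ is the common value δ(p) = δ(q), so δ is within O(ε)
    -- of it everywhere.
    have hb : ∀ ε : ℝ, 0 < ε → |δ z - δ p| ≤ ε * (|φ p| + |φ q| + |φ z|) := by
      intro ε hε
      have e1 : ∀ y, y ≠ 0 → fderiv ℝ φ y (Z y) = 0 → δ y = δ p ∧ |φ y| ≤ |φ p| + |φ q| :=
        fun y hy h0 => by
          rcases hval y hy h0 with ⟨h1, h2⟩ | ⟨h1, h2⟩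
          · exact ⟨h1, by rw [h2]; linarith [abs_nonneg (φ q)]⟩
          · exact ⟨h1.trans hδpq.symm, by rw [h2]; linarith [abs_nonneg (φ p)]⟩
      obtain ⟨a, ha, hca, hma⟩ := hmax ε 1 hε.ne' one_ne_zero
      obtain ⟨d, hd, hcd, hmd⟩ := hmax ε (-1) hε.ne' (by norm_num)
      obtain ⟨a1, a2⟩ := e1 a ha hca
      obtain ⟨d1, d2⟩ := e1 d hd hcd
      have m1 := hma z hz
      have m2 := hmd z hz
      rw [a1] at m1
      rw [d1] at m2
      rw [abs_le] at a2 d2 ⊢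
      have z1 := neg_abs_le (φ z)
      have z2 := le_abs_self (φ z)
      constructor <;> nlinarith
    by_contra hne
    have h1 : 0 < |δ z - δ p| := abs_pos.2 (sub_ne_zero.2 hne)
    set B := |φ p| + |φ q| + |φ z| with hB
    have hB0 : 0 ≤ B := by positivity
    -- With this ε the bound is at most half of |δ(z) - δ(p)|, a contradiction; B + 1 avoids
    -- division by zero.
    have h2 := hb (|δ z - δ p| / (2 * (B + 1))) (by positivity)
    rw [div_mul_eq_mul_div, le_div_iff₀ (by positivity)] at h2
    nlinarith
  have e1 : dd (b l) δ y = dd (b l) (fun _ => δ p) y :=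
    dd_congr (S := {0}ᶜ) _ isOpen_compl_singleton (fun z hz => hconst z hz) hy
  rw [dd_const, h.dd_det_hess hy] at e1
  have := (mul_eq_zero.1 e1).resolve_left (h.det_ne_zero hy)
  linarith

end IsMinkowskiSq

end Rigidity

/-! ### Deicke's theorem by integration by parts -/

section Deicke

open MeasureTheory

open scoped MatrixOrder Matrix.Norms.L2Operator in
/-- For `A` positive definite and `P` symmetric, `tr (A P A P) = ‖B P Bᵀ‖²` with `A = Bᵀ B`. -/
theorem trace_sq_nonneg {ι : Type*} [Fintype ι] [DecidableEq ι] {A P : Matrix ι ι ℝ}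
    (hA : A.PosDef) (hP : P.transpose = P) :
    0 ≤ (A * P * A * P).trace ∧ ((A * P * A * P).trace = 0 → P = 0) := by
  obtain ⟨B, hB⟩ := CStarAlgebra.nonneg_iff_eq_star_mul_self.mp hA.posSemidef.nonneg
  rw [Matrix.star_eq_conjTranspose, Matrix.conjTranspose_eq_transpose_of_trivial] at hB
  set X := B * P * B.transpose with hX
  have hXs : X.transpose = X := by
    simp [hX, Matrix.transpose_mul, hP, Matrix.mul_assoc]
  have h1 : (A * P * A * P).trace = ∑ i, ∑ j, X i j ^ 2 := by
    have e1 : (A * P * A * P).trace = (X * X.transpose).trace := by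
      rw [hXs, hB, hX]
      simp only [Matrix.mul_assoc]
      rw [Matrix.trace_mul_comm]
      simp only [Matrix.mul_assoc]
    rw [e1]
    simp [Matrix.trace, Matrix.mul_apply, sq]
  refine ⟨h1 ▸ by positivity, fun h0 => ?_⟩
  rw [h1] at h0
  have hX0 : X = 0 := by
    ext i j
    have h2 := (Finset.sum_eq_zero_iff_of_nonneg
      (fun i _ => Finset.sum_nonneg fun j _ => sq_nonneg (X i j))).1 h0 i (Finset.mem_univ i)
    have h3 := (Finset.sum_eq_zero_iff_of_nonneg
      (fun j _ => sq_nonneg (X i j))).1 h2 j (Finset.mem_univ j)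
    simpa using h3
  have hdet : A.det ≠ 0 := hA.det_pos.ne'
  have hu : IsUnit A.det := hdet.isUnit
  have h2 : A * P * A = 0 := by
    rw [hB]
    calc _ = B.transpose * X * B := by simp only [hX, Matrix.mul_assoc]
      _ = 0 := by rw [hX0, Matrix.mul_zero, Matrix.zero_mul]
  calc P = A⁻¹ * (A * P * A) * A⁻¹ := by
        rw [Matrix.mul_assoc A P A, Matrix.nonsing_inv_mul_cancel_left _ _ hu,
          Matrix.mul_nonsing_inv_cancel_right _ _ hu]
    _ = 0 := by rw [h2, Matrix.mul_zero, Matrix.zero_mul]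

variable {ι E : Type*} [Fintype ι] [DecidableEq ι] [NormedAddCommGroup E] [NormedSpace ℝ E]

theorem integral_dd_eq_zero [FiniteDimensional ℝ E] [MeasurableSpace E] [BorelSpace E]
    (μ : Measure E) [μ.IsAddHaarMeasure] {ψ : E → ℝ} (hψ : ContDiff ℝ ∞ ψ)
    (hs : HasCompactSupport ψ) (v : E) : Integrable (dd v ψ) μ ∧ ∫ y, dd v ψ y ∂μ = 0 := by
  have hc : Continuous (dd v ψ) := (hψ.continuous_fderiv (by simp)).clm_apply continuous_const
  have hi : Integrable (dd v ψ) μ :=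
    hc.integrable_of_hasCompactSupport (hs.fderiv_apply (𝕜 := ℝ) v)
  refine ⟨hi, ?_⟩
  -- Integration by parts against the constant function 1.
  have := integral_mul_fderiv_eq_neg_fderiv_mul_of_integrable (𝕜 := ℝ) (μ := μ)
    (f := fun _ : E => (1 : ℝ)) (g := ψ) (v := v) (by simp)
    (by simpa [dd] using! hi)
    (by simpa using hψ.continuous.integrable_of_hasCompactSupport hs)
    (by fun_prop) (fun x _ => (hψ.differentiable (by simp)).differentiableAt)
  simpa [dd] using this

namespace IsMinkowskiSq

variable {b : Module.Basis ι ℝ E} {N : E → ℝ} {y : E}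

/-- `N` is comparable to the square of the norm. -/
theorem exists_bounds [FiniteDimensional ℝ E] [Nontrivial E] (h : IsMinkowskiSq b N) :
    ∃ c C : ℝ, 0 < c ∧ 0 < C ∧ ∀ y, c * ‖y‖ ^ 2 ≤ N y ∧ N y ≤ C * ‖y‖ ^ 2 := by
  have hdiv : ContinuousOn (fun y => N y / ‖y‖ ^ 2) {0}ᶜ :=
    h.smooth.continuousOn.div (by fun_prop) fun y hy => by
      have : ‖y‖ ≠ 0 := norm_ne_zero_iff.2 hy
      positivity
  have hom : ∀ c : ℝ, 0 < c → ∀ y : E, y ≠ 0 → N (c • y) / ‖c • y‖ ^ 2 = N y / ‖y‖ ^ 2 := by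
    intro c hc y hy
    have : ‖y‖ ≠ 0 := norm_ne_zero_iff.2 hy
    rw [h.homog c hc, norm_smul, Real.norm_of_nonneg hc.le, mul_pow]
    exact mul_div_mul_left _ _ (by positivity)
  obtain ⟨y₁, hy₁, h1⟩ := exists_forall_le_of_homogeneous hdiv hom
  obtain ⟨y₀, hy₀, h0⟩ := exists_forall_le_of_homogeneous hdiv.neg
    (fun c hc y hy => by simp only [Pi.neg_apply, hom c hc y hy])
  have hp : ∀ y : E, y ≠ 0 → 0 < N y / ‖y‖ ^ 2 := fun y hy =>
    div_pos (h.pos hy) (by have := norm_pos_iff.2 hy; positivity)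
  refine ⟨_, _, hp y₀ hy₀, hp y₁ hy₁, fun y => ?_⟩
  by_cases hy : y = 0
  · have h2 := h.homog 2 (by norm_num) 0
    rw [smul_zero] at h2
    have : N 0 = 0 := by linarith
    simp [hy, this]
  · have hn : 0 < ‖y‖ ^ 2 := by have := norm_pos_iff.2 hy; positivity
    refine ⟨(le_div_iff₀ hn).1 ?_, (div_le_iff₀ hn).1 (h1 y hy)⟩
    have := h0 y hy
    simp only [Pi.neg_apply] at this
    linarith

/-- The `g`-Laplacian of a component `g_{ii}` if the mean Cartan torsion vanishes. -/
theorem sum_inv_dd_dd_hess (h : IsMinkowskiSq b N)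
    (hI : ∀ y, y ≠ 0 → ∀ l, meanTorsion b N l y = 0) (hy : y ≠ 0) (i : ι) :
    ∑ j, ∑ k, hessInv b N y j k * dd (b j) (dd (b k) fun q => hess b N q i i) y =
      (hessInv b N y * (Matrix.of fun j k => dd (b i) (fun q => hess b N q j k) y) *
        hessInv b N y * (Matrix.of fun j k => dd (b i) (fun q => hess b N q j k) y)).trace := by
  set P : Matrix ι ι ℝ := Matrix.of fun j k => dd (b i) (fun q => hess b N q j k) y with hP
  have hd : ∀ j k, ContDiffOn ℝ ∞ (dd (b k) fun q => hess b N q i j) {0}ᶜ := fun j k =>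
    (h.smooth_hess i j).dd _ isOpen_compl_singleton
  -- Fourth derivatives of N/2 commute, so one of the indices i can be moved to the outermost
  -- derivative.
  have h1 : ∀ j k, dd (b j) (dd (b k) fun q => hess b N q i i) y =
      dd (b i) (dd (b k) fun q => hess b N q i j) y := fun j k => by
    have e1 : Set.EqOn (dd (b k) fun q => hess b N q i i) (dd (b i) fun q => hess b N q i k)
        {0}ᶜ := fun z hz => h.dd_hess_swap hz i i k
    have e2 : Set.EqOn (dd (b j) fun q => hess b N q i k) (dd (b k) fun q => hess b N q i j)
        {0}ᶜ := fun z hz => h.dd_hess_swap hz i k j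
    rw [dd_congr _ isOpen_compl_singleton e1 hy,
      dd_comm _ _ isOpen_compl_singleton (h.smooth_hess i k) hy,
      dd_congr _ isOpen_compl_singleton e2 hy]
  -- Differentiate g^{jk} ∂_k g_{ij} = 2 I_i = 0 along b_i; the derivative of the inverse metric
  -- supplies the trace term.
  have h2 : dd (b i) (fun z => ∑ p : ι × ι, hessInv b N z p.1 p.2 *
      dd (b p.2) (fun q => hess b N q i p.1) z) y = 0 := by
    have e1 : Set.EqOn (fun z => ∑ p : ι × ι, hessInv b N z p.1 p.2 *
      dd (b p.2) (fun q => hess b N q i p.1) z) (fun _ => 0) {0}ᶜ := fun z hz => by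
      simp only
      rw [Fintype.sum_prod_type, sum_inv_dd_hess, hI z hz, mul_zero]
    rw [dd_congr _ isOpen_compl_singleton e1 hy, dd_const]
  rw [dd_sum_mul (φ := fun (p : ι × ι) z => hessInv b N z p.1 p.2)
    (ψ := fun p z => dd (b p.2) (fun q => hess b N q i p.1) z) _
    (fun p => (h.smooth_inv p.1 p.2).diffAt isOpen_compl_singleton hy)
    (fun p => (hd p.1 p.2).diffAt isOpen_compl_singleton hy), Finset.sum_add_distrib,
    Fintype.sum_prod_type, Fintype.sum_prod_type] at h2
  have h3 : ∀ j k, dd (b i) (fun q => hessInv b N q j k) y =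
      -(hessInv b N y * P * hessInv b N y) j k := fun j k => by
    have := dd_inv isOpen_compl_singleton h.smooth_hess (fun _ hz => h.det_ne_zero hz) hy (b i)
    exact congrFun (congrFun this j) k
  have h4 : ∀ j k, dd (b k) (fun q => hess b N q i j) y = P k j := fun j k =>
    h.dd_hess_swap' hy i j k
  simp only [h1, h3, h4] at h2 ⊢
  rw [Matrix.trace]
  simp only [Matrix.diag_apply, Matrix.mul_apply (N := P) (M := hessInv b N y * P * hessInv b N y)]
  simp only [neg_mul, Finset.sum_neg_distrib] at h2
  linarith

/-- **Deicke's theorem**: if the mean Cartan torsion of a Minkowski norm vanishes, then so does its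
Cartan torsion. -/
theorem dd_hess_eq_zero (h : IsMinkowskiSq b N)
    (hI : ∀ y, y ≠ 0 → ∀ l, meanTorsion b N l y = 0) (hy : y ≠ 0) (i j k : ι) :
    dd (b k) (fun q => hess b N q i j) y = 0 := by
  have hfin := b.finiteDimensional_of_finite
  have hnE : Nontrivial E := ⟨⟨y, 0, hy⟩⟩
  let _ : MeasurableSpace E := borel E
  have _ : BorelSpace E := ⟨rfl⟩
  let μ : Measure E := Measure.addHaar
  -- The cut-off ζ = η(N) lives on the shell 1 < N < 3: it is compactly supported and avoids the
  -- origin, where the fundamental tensor is not smooth.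
  let η : ContDiffBump (2 : ℝ) := ⟨1 / 2, 1, by norm_num, by norm_num⟩
  obtain ⟨c, C, hc, hC, hN⟩ := h.exists_bounds
  set u : E → ℝ := fun q => hess b N q k k with hu
  set W : ι → E → ℝ := fun j q => ∑ l, hessInv b N q j l * dd (b l) u q with hW
  set ζ : E → ℝ := fun q => η (N q) with hζ
  set Δ : E → ℝ := fun q => ∑ j, ∑ l, hessInv b N q j l * dd (b j) (dd (b l) u) q with hΔ
  have hus : ContDiffOn ℝ ∞ u {0}ᶜ := h.smooth_hess k k
  have hWs : ∀ j, ContDiffOn ℝ ∞ (W j) {0}ᶜ := fun j => ContDiffOn.sum fun l _ =>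
    (h.smooth_inv j l).mul (hus.dd _ isOpen_compl_singleton)
  have hζs : ContDiffOn ℝ ∞ ζ {0}ᶜ := η.contDiff.comp_contDiffOn h.smooth
  have hη0 : ∀ t : ℝ, η t ≠ 0 → 1 < t ∧ t < 3 := fun t ht => by
    have : t ∈ Function.support η := ht
    rw [η.support_eq, Metric.mem_ball, Real.dist_eq, abs_lt] at this
    constructor <;> linarith [this.1, this.2]
  have hζ0 : ∀ᶠ q in nhds (0 : E), ζ q = 0 := by
    have h1 : ∀ᶠ q in nhds (0 : E), C * ‖q‖ ^ 2 < 1 := by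
      have : Continuous fun q : E => C * ‖q‖ ^ 2 := by fun_prop
      exact this.tendsto' 0 0 (by simp) |>.eventually (gt_mem_nhds one_pos)
    filter_upwards [h1] with q hq
    by_contra hne
    linarith [(hη0 _ hne).1, (hN q).2]
  have hV0 : ∀ j, (fun q => ζ q * W j q) =ᶠ[nhds 0] fun _ => 0 := fun j => by
    filter_upwards [hζ0] with q hq
    rw [hq, zero_mul]
  have hVs : ∀ j, ContDiff ℝ ∞ (fun q => ζ q * W j q) := fun j => by
    rw [contDiff_iff_contDiffAt]
    intro q
    by_cases hq : q = 0
    · rw [hq]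
      exact contDiffAt_const.congr_of_eventuallyEq (hV0 j)
    · exact (hζs.mul (hWs j)).contDiffAt (isOpen_compl_singleton.mem_nhds hq)
  have hVc : ∀ j, HasCompactSupport (fun q => ζ q * W j q) := fun j => by
    refine HasCompactSupport.of_support_subset_isCompact (isCompact_closedBall (0 : E) √(3 / c))
      fun q hq => ?_
    have h1 := (hη0 _ (left_ne_zero_of_mul hq)).2
    rw [mem_closedBall_zero_iff]
    refine Real.le_sqrt_of_sq_le ?_
    rw [le_div_iff₀ hc]
    linarith [(hN q).1]
  have hint := fun j => integral_dd_eq_zero μ (hVs j) (hVc j) (b j)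
  have hT : ∀ q, ∑ j, dd (b j) (fun q => ζ q * W j q) q = ζ q * Δ q := fun q => by
    by_cases hq : q = 0
    · have h1 : ζ q = 0 := hq ▸ hζ0.self_of_nhds
      rw [h1, zero_mul]
      refine Finset.sum_eq_zero fun j _ => ?_
      rw [hq]
      simp only [dd, (hV0 j).fderiv_eq]
      simp
    have hζd : DifferentiableAt ℝ ζ q := hζs.diffAt isOpen_compl_singleton hq
    have h1 : ∀ j, dd (b j) ζ q = deriv η (N q) * (2 * dd (b j) (fun q => (1 / 2) * N q) q) :=
      fun j => by
        have e1 : DifferentiableAt ℝ η (N q) := (η.contDiff (n := 1)).differentiable (by simp) _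
        have e2 : DifferentiableAt ℝ N q := h.smooth.diffAt isOpen_compl_singleton hq
        have e3 : dd (b j) ζ q = deriv η (N q) * dd (b j) N q := by
          have := (e1.hasDerivAt.comp_hasFDerivAt q e2.hasFDerivAt).fderiv
          simp only [dd, hζ]
          rw [show (fun q => η (N q)) = η ∘ N from rfl, this]
          simp
        rw [e3, dd_const_mul]
        ring
    -- The gradient of ζ is a multiple of y_j, and y_j g^{jl} ∂_l u = y^l ∂_l u = 0 by homogeneity.
    -- A cut-off depending on N alone therefore leaves no error term.
    have h2 : ∑ j, dd (b j) (fun q => (1 / 2) * N q) q * W j q = 0 := by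
      simp only [hW, Finset.mul_sum, ← mul_assoc]
      rw [Finset.sum_comm]
      simp only [← Finset.sum_mul, h.sum_lower_inv hq]
      exact h.dd_hess_radial hq k k
    -- The first-order term involves ∂_j g^{jl} = -2 I^l = 0, so the Laplacian is in divergence
    -- form.
    have h3 : ∑ j, dd (b j) (W j) q = Δ q := by
      have e1 : ∀ j, dd (b j) (W j) q = ∑ l, (dd (b j) (fun q => hessInv b N q j l) q *
          dd (b l) u q + hessInv b N q j l * dd (b j) (dd (b l) u) q) := fun j =>
        dd_sum_mul _ (fun l => (h.smooth_inv j l).diffAt isOpen_compl_singleton hq)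
          (fun l => (hus.dd (b l) isOpen_compl_singleton).diffAt isOpen_compl_singleton hq)
      simp only [e1, Finset.sum_add_distrib]
      rw [Finset.sum_comm]
      simp only [← Finset.sum_mul, h.sum_dd_inv hq, meanTorsionUp, hI q hq]
      simp [hΔ]
    have h4 : ∀ j, dd (b j) (fun q => ζ q * W j q) q =
        dd (b j) ζ q * W j q + ζ q * dd (b j) (W j) q := fun j =>
      dd_mul _ hζd ((hWs j).diffAt isOpen_compl_singleton hq)
    have h5 : ∑ j, dd (b j) ζ q * W j q = 0 := by
      simp only [h1]
      calc _ = deriv η (N q) * 2 * ∑ j, dd (b j) (fun q => (1 / 2) * N q) q * W j q := by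
            rw [Finset.mul_sum]
            exact Finset.sum_congr rfl fun j _ => by ring
        _ = 0 := by rw [h2, mul_zero]
    simp only [h4, Finset.sum_add_distrib, h5, ← Finset.mul_sum, h3, zero_add]
  have hPs : ∀ q, q ≠ 0 → (Matrix.of fun i j => dd (b k) (fun q => hess b N q i j) q).transpose =
      Matrix.of fun i j => dd (b k) (fun q => hess b N q i j) q := fun q hq => by
    ext i j
    exact h.dd_hess_symm hq j i _
  have hΔ0 : ∀ q, q ≠ 0 → 0 ≤ Δ q ∧ (Δ q = 0 →
      (Matrix.of fun i j => dd (b k) (fun q => hess b N q i j) q) = 0) := fun q hq => by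
    have e1 : Δ q = _ := h.sum_inv_dd_dd_hess hI hq k
    rw [e1]
    exact trace_sq_nonneg (h.inv_posDef hq) (hPs q hq)
  have hzero : (fun q => ∑ j, dd (b j) (fun q => ζ q * W j q) q) = fun _ => 0 := by
    have h1 : Continuous fun q => ∑ j, dd (b j) (fun q => ζ q * W j q) q :=
      continuous_finsetSum _ fun j _ =>
        ((hVs j).continuous_fderiv (by simp)).clm_apply continuous_const
    -- A continuous nonnegative function with zero integral vanishes identically.
    refine (h1.ae_eq_iff_eq μ continuous_const).1 ?_
    refine (integral_eq_zero_iff_of_nonneg (fun q => ?_)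
      (integrable_finsetSum _ fun j _ => (hint j).1)).1 ?_
    · simp only [hT, Pi.zero_apply]
      by_cases hq : q = 0
      · have h1 : ζ q = 0 := hq ▸ hζ0.self_of_nhds
        rw [h1, zero_mul]
      · exact mul_nonneg η.nonneg (hΔ0 q hq).1
    · rw [integral_finsetSum _ fun j _ => (hint j).1]
      exact Finset.sum_eq_zero fun j _ => (hint j).2
  have hNy := h.pos hy
  -- Rescale y to N = 2, the centre of the bump, where ζ ≠ 0; the conclusion returns to y by
  -- homogeneity.
  have ha : 0 < √(2 / N y) := Real.sqrt_pos.2 (by positivity)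
  have hy' : √(2 / N y) • y ≠ 0 := smul_ne_zero ha.ne' hy
  have h1 : N (√(2 / N y) • y) = 2 := by
    rw [h.homog _ ha, Real.sq_sqrt (by positivity)]
    field_simp
  have h2 := (hT (√(2 / N y) • y)).symm.trans (congrFun hzero _)
  have h3 : ζ (√(2 / N y) • y) ≠ 0 := by
    simp only [hζ, h1]
    exact (η.pos_of_mem_ball (by simp [η])).ne'
  have h4 := (hΔ0 _ hy').2 ((mul_eq_zero.1 h2).resolve_left h3)
  have h5 : dd (b k) (fun q => hess b N q i j) (√(2 / N y) • y) = 0 :=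
    congrFun (congrFun h4 i) j
  rw [dd_homogeneous (k := 0) (b k) ha (fun y hy => by rw [h.hess_homog hy ha]; simp) hy] at h5
  exact (mul_eq_zero.1 h5).resolve_left (zpow_ne_zero _ ha.ne')

/-- A Minkowski norm in dimension at least two whose mean Cartan torsion vanishes is Euclidean. -/
theorem hess_eq_of_meanTorsion_eq_zero [Nontrivial ι] (h : IsMinkowskiSq b N)
    (hI : ∀ y, y ≠ 0 → ∀ l, meanTorsion b N l y = 0) {z : E} (hy : y ≠ 0) (hz : z ≠ 0) :
    hess b N y = hess b N z := by
  have hfin := b.finiteDimensional_of_finite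
  -- In dimension at least two the complement of the origin is connected, so a locally constant
  -- fundamental tensor is constant.
  have hrank : 1 < Module.rank ℝ E := by
    rw [← Module.finrank_eq_rank, Module.finrank_eq_card_basis b]
    exact_mod_cast Fintype.one_lt_card
  ext i j
  refine (isOpen_compl_singleton (x := (0 : E))).is_const_of_fderiv_eq_zero
    (isConnected_compl_singleton_of_one_lt_rank hrank 0).isPreconnected (𝕜 := ℝ)
    (f := fun q => hess b N q i j)
    (fun q hq => ((h.smooth_hess i j).diffAt isOpen_compl_singleton hq).differentiableWithinAt)
    (fun q hq => ?_) hy hz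
  ext v
  rw [fderiv_eq_sum_dd b]
  simp [h.dd_hess_eq_zero hI hq]

end IsMinkowskiSq

end Deicke

/-! ### Mean Landsberg curvature of a twisted product on one fibre -/

section FiberProduct

/-- The trace of the Landsberg curvature on one fiber, for spray coefficients `G`. -/
def landsbergTrace {ι E : Type*} [Fintype ι] [DecidableEq ι] [NormedAddCommGroup E]
    [NormedSpace ℝ E] (b : Module.Basis ι ℝ E) (N : E → ℝ) (G : ι → E → ℝ) (i : ι) (y : E) : ℝ :=
  ∑ j, ∑ k, (-(1 / 2) * ∑ l, (∑ m, hess b N y l m * b.repr y m) *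
    dd (b k) (dd (b j) (dd (b i) (G l))) y) * hessInv b N y j k

variable {ι₁ ι₂ E₁ E₂ : Type*} [Fintype ι₁] [DecidableEq ι₁] [Fintype ι₂] [DecidableEq ι₂]
  [NormedAddCommGroup E₁] [NormedSpace ℝ E₁] [NormedAddCommGroup E₂] [NormedSpace ℝ E₂]
  (b₁ : Module.Basis ι₁ ℝ E₁) (b₂ : Module.Basis ι₂ ℝ E₂)

theorem prod_inl (i : ι₁) : (b₁.prod b₂) (Sum.inl i) = (b₁ i, 0) := by
  ext <;> simp

theorem prod_inr (i : ι₂) : (b₁.prod b₂) (Sum.inr i) = (0, b₂ i) := by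
  ext <;> simp

variable (E₁ E₂) in
/-- The vectors of `E₁ × E₂` with both components nonzero. -/
def slit₂ : Set (E₁ × E₂) := {0}ᶜ ×ˢ {0}ᶜ

theorem isOpen_slit₂ : IsOpen (slit₂ E₁ E₂) := isOpen_compl_singleton.prod isOpen_compl_singleton

/-- The effect on the first factor of the partial derivative of a product `a(y) c(v)`. -/
def leftD (α : ι₁ ⊕ ι₂) (a : E₁ → ℝ) : E₁ → ℝ := Sum.elim (fun i => dd (b₁ i) a) (fun _ => a) α

/-- The effect on the second factor of the partial derivative of a product `a(y) c(v)`. -/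
def rightD (α : ι₁ ⊕ ι₂) (c : E₂ → ℝ) : E₂ → ℝ := Sum.elim (fun _ => c) (fun i => dd (b₂ i) c) α

@[simp] theorem leftD_inl (i : ι₁) (a : E₁ → ℝ) :
    leftD b₁ (Sum.inl i : ι₁ ⊕ ι₂) a = dd (b₁ i) a := rfl
@[simp] theorem leftD_inr (i : ι₂) (a : E₁ → ℝ) : leftD b₁ (Sum.inr i) a = a := rfl
@[simp] theorem rightD_inl (i : ι₁) (c : E₂ → ℝ) :
    rightD b₂ (Sum.inl i) c = c := rfl
@[simp] theorem rightD_inr (i : ι₂) (c : E₂ → ℝ) :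
    rightD b₂ (Sum.inr i : ι₁ ⊕ ι₂) c = dd (b₂ i) c := rfl

theorem smooth_leftD (α : ι₁ ⊕ ι₂) {a : E₁ → ℝ} (ha : ContDiffOn ℝ ∞ a {0}ᶜ) :
    ContDiffOn ℝ ∞ (leftD b₁ α a) {0}ᶜ := by
  cases α
  · exact ha.dd _ isOpen_compl_singleton
  · exact ha

theorem smooth_rightD (α : ι₁ ⊕ ι₂) {c : E₂ → ℝ} (hc : ContDiffOn ℝ ∞ c {0}ᶜ) :
    ContDiffOn ℝ ∞ (rightD b₂ α c) {0}ᶜ := by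
  cases α
  · exact hc
  · exact hc.dd _ isOpen_compl_singleton

/-- Each twisted spray coefficient is a sum of two products a(y) c(v). This shape is preserved by
every coordinate derivative, so the lemma can be iterated to third order. -/
theorem dd_tensor (α : ι₁ ⊕ ι₂) {a a' : E₁ → ℝ} {c c' : E₂ → ℝ}
    (ha : ContDiffOn ℝ ∞ a {0}ᶜ) (ha' : ContDiffOn ℝ ∞ a' {0}ᶜ)
    (hc : ContDiffOn ℝ ∞ c {0}ᶜ) (hc' : ContDiffOn ℝ ∞ c' {0}ᶜ) :
    Set.EqOn (dd ((b₁.prod b₂) α) (fun z => a z.1 * c z.2 + a' z.1 * c' z.2))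
      (fun z => leftD b₁ α a z.1 * rightD b₂ α c z.2 + leftD b₁ α a' z.1 * rightD b₂ α c' z.2)
      (slit₂ E₁ E₂) := by
  rintro ⟨y, v⟩ ⟨hy, hv⟩
  have key : ∀ {a : E₁ → ℝ} {c : E₂ → ℝ}, ContDiffOn ℝ ∞ a {0}ᶜ → ContDiffOn ℝ ∞ c {0}ᶜ →
      DifferentiableAt ℝ (fun z : E₁ × E₂ => a z.1 * c z.2) (y, v) ∧
      dd ((b₁.prod b₂) α) (fun z => a z.1 * c z.2) (y, v) =
        leftD b₁ α a y * rightD b₂ α c v := by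
    intro a c ha hc
    have h1 : HasFDerivAt (fun z : E₁ × E₂ => a z.1) _ (y, v) :=
      (ha.diffAt isOpen_compl_singleton hy).hasFDerivAt.comp (y, v) hasFDerivAt_fst
    have h2 : HasFDerivAt (fun z : E₁ × E₂ => c z.2) _ (y, v) :=
      (hc.diffAt isOpen_compl_singleton hv).hasFDerivAt.comp (y, v) hasFDerivAt_snd
    refine ⟨h1.differentiableAt.mul h2.differentiableAt, ?_⟩
    rw [dd_mul _ h1.differentiableAt h2.differentiableAt]
    simp only [dd, h1.fderiv, h2.fderiv]
    cases α with
    | inl i => simp [dd]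
    | inr i => simp [dd]
  rw [dd_add _ (key ha hc).1 (key ha' hc').1, (key ha hc).2, (key ha' hc').2]

theorem dd_two_tensor (α β : ι₁ ⊕ ι₂) {a a' : E₁ → ℝ} {c c' : E₂ → ℝ}
    (ha : ContDiffOn ℝ ∞ a {0}ᶜ) (ha' : ContDiffOn ℝ ∞ a' {0}ᶜ)
    (hc : ContDiffOn ℝ ∞ c {0}ᶜ) (hc' : ContDiffOn ℝ ∞ c' {0}ᶜ) :
    Set.EqOn (dd ((b₁.prod b₂) β) (dd ((b₁.prod b₂) α)
        (fun z => a z.1 * c z.2 + a' z.1 * c' z.2)))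
      (fun z => leftD b₁ β (leftD b₁ α a) z.1 * rightD b₂ β (rightD b₂ α c) z.2 +
        leftD b₁ β (leftD b₁ α a') z.1 * rightD b₂ β (rightD b₂ α c') z.2)
      (slit₂ E₁ E₂) :=
  (dd_congr _ isOpen_slit₂ (dd_tensor b₁ b₂ α ha ha' hc hc')).trans
    (dd_tensor b₁ b₂ β (smooth_leftD b₁ α ha) (smooth_leftD b₁ α ha')
      (smooth_rightD b₂ α hc) (smooth_rightD b₂ α hc'))

theorem dd_three_tensor (α β γ : ι₁ ⊕ ι₂) {a a' : E₁ → ℝ} {c c' : E₂ → ℝ}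
    (ha : ContDiffOn ℝ ∞ a {0}ᶜ) (ha' : ContDiffOn ℝ ∞ a' {0}ᶜ)
    (hc : ContDiffOn ℝ ∞ c {0}ᶜ) (hc' : ContDiffOn ℝ ∞ c' {0}ᶜ) :
    Set.EqOn (dd ((b₁.prod b₂) γ) (dd ((b₁.prod b₂) β) (dd ((b₁.prod b₂) α)
        (fun z => a z.1 * c z.2 + a' z.1 * c' z.2))))
      (fun z => leftD b₁ γ (leftD b₁ β (leftD b₁ α a)) z.1 *
          rightD b₂ γ (rightD b₂ β (rightD b₂ α c)) z.2 +
        leftD b₁ γ (leftD b₁ β (leftD b₁ α a')) z.1 *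
          rightD b₂ γ (rightD b₂ β (rightD b₂ α c')) z.2)
      (slit₂ E₁ E₂) :=
  (dd_congr _ isOpen_slit₂ (dd_two_tensor b₁ b₂ α β ha ha' hc hc')).trans
    (dd_tensor b₁ b₂ γ (smooth_leftD b₁ β (smooth_leftD b₁ α ha))
      (smooth_leftD b₁ β (smooth_leftD b₁ α ha'))
      (smooth_rightD b₂ β (smooth_rightD b₂ α hc)) (smooth_rightD b₂ β (smooth_rightD b₂ α hc')))

@[simp] theorem dd_const' {V : Type*} [NormedAddCommGroup V] [NormedSpace ℝ V] (v : V) (c : ℝ) :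
    dd v (fun _ => c) = fun _ => 0 := by
  ext; exact dd_const v c

variable {b₁ b₂} {N₁ : E₁ → ℝ} {N₂ : E₂ → ℝ} {h : ℝ}

theorem hess_prod (h₁ : IsMinkowskiSq b₁ N₁) (h₂ : IsMinkowskiSq b₂ N₂) {z : E₁ × E₂}
    (hz : z ∈ slit₂ E₁ E₂) :
    hess (b₁.prod b₂) (fun z => N₁ z.1 + h ^ 2 * N₂ z.2) z =
      Matrix.fromBlocks (hess b₁ N₁ z.1) 0 0 (h ^ 2 • hess b₂ N₂ z.2) := by
  have e : (fun z : E₁ × E₂ => 1 / 2 * (N₁ z.1 + h ^ 2 * N₂ z.2)) =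
      fun z => (fun y => 1 / 2 * N₁ y) z.1 * (fun _ => 1) z.2 +
        (fun _ => h ^ 2) z.1 * (fun v => 1 / 2 * N₂ v) z.2 := by
    ext z; ring
  ext α β
  rw [hess, Matrix.of_apply, e, dd_two_tensor b₁ b₂ α β h₁.smooth_half contDiffOn_const
    contDiffOn_const h₂.smooth_half hz]
  rcases α with i | i <;> rcases β with j | j <;> simp [hess]

theorem hessInv_prod (h₁ : IsMinkowskiSq b₁ N₁) (h₂ : IsMinkowskiSq b₂ N₂) (h0 : h ≠ 0)
    {z : E₁ × E₂} (hz : z ∈ slit₂ E₁ E₂) :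
    hessInv (b₁.prod b₂) (fun z => N₁ z.1 + h ^ 2 * N₂ z.2) z =
      Matrix.fromBlocks (hessInv b₁ N₁ z.1) 0 0 ((h ^ 2)⁻¹ • hessInv b₂ N₂ z.2) := by
  rw [hessInv, hess_prod h₁ h₂ hz]
  refine Matrix.inv_eq_right_inv ?_
  rw [Matrix.fromBlocks_multiply]
  have h2 : h ^ 2 ≠ 0 := pow_ne_zero 2 h0
  simp [h₁.hess_mul_inv hz.1, h₂.hess_mul_inv hz.2, smul_smul, h2]

theorem lower_prod (h₁ : IsMinkowskiSq b₁ N₁) (h₂ : IsMinkowskiSq b₂ N₂) {z : E₁ × E₂}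
    (hz : z ∈ slit₂ E₁ E₂) (l : ι₁ ⊕ ι₂) :
    ∑ m, hess (b₁.prod b₂) (fun z => N₁ z.1 + h ^ 2 * N₂ z.2) z l m * (b₁.prod b₂).repr z m =
      Sum.elim (fun l => dd (b₁ l) (fun q => (1 / 2) * N₁ q) z.1)
        (fun l => h ^ 2 * dd (b₂ l) (fun q => (1 / 2) * N₂ q) z.2) l := by
  rw [hess_prod h₁ h₂ hz, Fintype.sum_sum_type]
  cases l with
  | inl l => rw [Sum.elim_inl, h₁.dd_half hz.1]; simp
  | inr l => rw [Sum.elim_inr, h₂.dd_half hz.2]; simp [Finset.mul_sum, mul_assoc]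

/-- The Landsberg trace of a product, split into blocks. -/
theorem landsbergTrace_prod (h₁ : IsMinkowskiSq b₁ N₁) (h₂ : IsMinkowskiSq b₂ N₂) (h0 : h ≠ 0)
    {G : ι₁ ⊕ ι₂ → E₁ × E₂ → ℝ} {z : E₁ × E₂} (hz : z ∈ slit₂ E₁ E₂) (α : ι₁ ⊕ ι₂) :
    landsbergTrace (b₁.prod b₂) (fun z => N₁ z.1 + h ^ 2 * N₂ z.2) G α z =
      (∑ j, ∑ k, (-(1 / 2) * ((∑ l, dd (b₁ l) (fun q => (1 / 2) * N₁ q) z.1 *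
          dd ((b₁.prod b₂) (Sum.inl k)) (dd ((b₁.prod b₂) (Sum.inl j))
            (dd ((b₁.prod b₂) α) (G (Sum.inl l)))) z) +
        ∑ l, h ^ 2 * dd (b₂ l) (fun q => (1 / 2) * N₂ q) z.2 *
          dd ((b₁.prod b₂) (Sum.inl k)) (dd ((b₁.prod b₂) (Sum.inl j))
            (dd ((b₁.prod b₂) α) (G (Sum.inr l)))) z)) * hessInv b₁ N₁ z.1 j k) +
      ∑ j, ∑ k, (-(1 / 2) * ((∑ l, dd (b₁ l) (fun q => (1 / 2) * N₁ q) z.1 *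
          dd ((b₁.prod b₂) (Sum.inr k)) (dd ((b₁.prod b₂) (Sum.inr j))
            (dd ((b₁.prod b₂) α) (G (Sum.inl l)))) z) +
        ∑ l, h ^ 2 * dd (b₂ l) (fun q => (1 / 2) * N₂ q) z.2 *
          dd ((b₁.prod b₂) (Sum.inr k)) (dd ((b₁.prod b₂) (Sum.inr j))
            (dd ((b₁.prod b₂) α) (G (Sum.inr l)))) z)) *
              ((h ^ 2)⁻¹ * hessInv b₂ N₂ z.2 j k) := by
  rw [landsbergTrace]
  simp only [lower_prod h₁ h₂ hz, hessInv_prod h₁ h₂ h0 hz, Fintype.sum_sum_type]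
  simp only [Sum.elim_inl, Sum.elim_inr, Matrix.fromBlocks_apply₁₁, Matrix.fromBlocks_apply₁₂,
    Matrix.fromBlocks_apply₂₁, Matrix.fromBlocks_apply₂₂, Matrix.zero_apply, mul_zero,
    Finset.sum_const_zero, add_zero, zero_add, Matrix.smul_apply, smul_eq_mul]

/-- The spray coefficients of a twisted product in the directions of the first factor. -/
def twistSpray₁ (b₁ : Module.Basis ι₁ ℝ E₁) (N₁ : E₁ → ℝ) (N₂ : E₂ → ℝ) (h : ℝ) (p : ι₁ → ℝ)
    (G₁ : ι₁ → E₁ → ℝ) (l : ι₁) : E₁ × E₂ → ℝ :=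
  fun z => G₁ l z.1 * 1 + (∑ m, -(1 / 2) * h * p m * hessInv b₁ N₁ z.1 l m) * N₂ z.2

/-- The part of the spray coefficients of a twisted product in the directions of the second factor
that does not depend on the vector in the first factor. -/
def twistSprayVert (b₂ : Module.Basis ι₂ ℝ E₂) (N₂ : E₂ → ℝ) (h : ℝ) (q : ι₂ → ℝ)
    (G₂ : ι₂ → E₂ → ℝ) (d : ι₂) : E₂ → ℝ :=
  fun v => G₂ d v + ((∑ c, h⁻¹ * q c * b₂.repr v c) * b₂.repr v d -
    (∑ e, (1 / 2) * h⁻¹ * q e * hessInv b₂ N₂ v d e) * N₂ v)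

/-- The spray coefficients of a twisted product in the directions of the second factor. -/
def twistSpray₂ (b₁ : Module.Basis ι₁ ℝ E₁) (b₂ : Module.Basis ι₂ ℝ E₂) (N₂ : E₂ → ℝ) (h : ℝ)
    (p : ι₁ → ℝ) (q : ι₂ → ℝ) (G₂ : ι₂ → E₂ → ℝ) (d : ι₂) : E₁ × E₂ → ℝ :=
  fun z => 1 * twistSprayVert b₂ N₂ h q G₂ d z.2 + (∑ k, h⁻¹ * p k * b₁.repr z.1 k) * b₂.repr z.2 d

theorem smooth_repr {ι E : Type*} [Finite ι] [NormedAddCommGroup E] [NormedSpace ℝ E]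
    (b : Module.Basis ι ℝ E) (i : ι) : ContDiff ℝ ∞ (fun y => b.repr y i) := by
  have := b.finiteDimensional_of_finite
  exact (b.coord i).toContinuousLinearMap.contDiff

theorem dd_repr' {ι E : Type*} [Finite ι] [DecidableEq ι] [NormedAddCommGroup E] [NormedSpace ℝ E]
    (b : Module.Basis ι ℝ E) (i m : ι) :
    dd (b i) (fun z => b.repr z m) = fun _ => if i = m then 1 else 0 := by
  have := Fintype.ofFinite ι
  ext y
  exact dd_repr b i m y

theorem dd_sum_const_mul_repr {ι E : Type*} [Fintype ι] [DecidableEq ι] [NormedAddCommGroup E]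
    [NormedSpace ℝ E] (b : Module.Basis ι ℝ E) (c : ι → ℝ) (i : ι) :
    dd (b i) (fun z => ∑ k, c k * b.repr z k) = fun _ => c i := by
  ext y
  rw [dd_sum (φ := fun k z => c k * b.repr z k) _ _ fun k _ =>
    ((smooth_repr b k).differentiable (by simp) y).const_mul _]
  simp [dd_const_mul, dd_repr']

theorem smooth_twistSprayVert (h₂ : IsMinkowskiSq b₂ N₂) {q : ι₂ → ℝ} {G₂ : ι₂ → E₂ → ℝ}
    (hG₂ : ∀ d, ContDiffOn ℝ ∞ (G₂ d) {0}ᶜ) (d : ι₂) :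
    ContDiffOn ℝ ∞ (twistSprayVert b₂ N₂ h q G₂ d) {0}ᶜ :=
  (hG₂ d).add (((ContDiff.sum fun c _ => contDiff_const.mul (smooth_repr b₂ c)).mul
    (smooth_repr b₂ d)).contDiffOn.sub ((ContDiffOn.sum fun e _ =>
      contDiffOn_const.mul (h₂.smooth_inv d e)).mul h₂.smooth))

section Formulas

/-- The factor 1 in the first product records that G₁ does not depend on v; a single derivative in
the second factor kills that term. -/
theorem dd_three_twistSpray₁ (h₁ : IsMinkowskiSq b₁ N₁) (h₂ : IsMinkowskiSq b₂ N₂) {p : ι₁ → ℝ}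
    {G₁ : ι₁ → E₁ → ℝ} (hG₁ : ∀ l, ContDiffOn ℝ ∞ (G₁ l) {0}ᶜ)
    {G : ι₁ ⊕ ι₂ → E₁ × E₂ → ℝ} {l : ι₁}
    (hG : Set.EqOn (G (Sum.inl l)) (twistSpray₁ b₁ N₁ N₂ h p G₁ l) (slit₂ E₁ E₂))
    (α β γ : ι₁ ⊕ ι₂) {z : E₁ × E₂} (hz : z ∈ slit₂ E₁ E₂) :
    dd ((b₁.prod b₂) γ) (dd ((b₁.prod b₂) β) (dd ((b₁.prod b₂) α) (G (Sum.inl l)))) z =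
      leftD b₁ γ (leftD b₁ β (leftD b₁ α (G₁ l))) z.1 *
          rightD b₂ γ (rightD b₂ β (rightD b₂ α fun _ => 1)) z.2 +
        leftD b₁ γ (leftD b₁ β (leftD b₁ α
          (fun y => ∑ m, -(1 / 2) * h * p m * hessInv b₁ N₁ y l m))) z.1 *
          rightD b₂ γ (rightD b₂ β (rightD b₂ α N₂)) z.2 := by
  rw [dd_congr _ isOpen_slit₂ (dd_congr _ isOpen_slit₂ (dd_congr _ isOpen_slit₂ hG)) hz]
  exact dd_three_tensor b₁ b₂ α β γ (a' := fun y => ∑ m, -(1 / 2) * h * p m * hessInv b₁ N₁ y l m)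
    (hG₁ l) (ContDiffOn.sum fun m _ => contDiffOn_const.mul (h₁.smooth_inv l m))
    contDiffOn_const h₂.smooth hz

theorem dd_three_twistSpray₂ (h₂ : IsMinkowskiSq b₂ N₂) {p : ι₁ → ℝ} {q : ι₂ → ℝ}
    {G₂ : ι₂ → E₂ → ℝ} (hG₂ : ∀ d, ContDiffOn ℝ ∞ (G₂ d) {0}ᶜ)
    {G : ι₁ ⊕ ι₂ → E₁ × E₂ → ℝ} {d : ι₂}
    (hG : Set.EqOn (G (Sum.inr d)) (twistSpray₂ b₁ b₂ N₂ h p q G₂ d) (slit₂ E₁ E₂))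
    (α β γ : ι₁ ⊕ ι₂) {z : E₁ × E₂} (hz : z ∈ slit₂ E₁ E₂) :
    dd ((b₁.prod b₂) γ) (dd ((b₁.prod b₂) β) (dd ((b₁.prod b₂) α) (G (Sum.inr d)))) z =
      leftD b₁ γ (leftD b₁ β (leftD b₁ α (fun _ => 1))) z.1 *
          rightD b₂ γ (rightD b₂ β (rightD b₂ α (twistSprayVert b₂ N₂ h q G₂ d))) z.2 +
        leftD b₁ γ (leftD b₁ β (leftD b₁ α
          (fun y => ∑ k, h⁻¹ * p k * b₁.repr y k))) z.1 *
          rightD b₂ γ (rightD b₂ β (rightD b₂ α (fun v => b₂.repr v d))) z.2 := by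
  rw [dd_congr _ isOpen_slit₂ (dd_congr _ isOpen_slit₂ (dd_congr _ isOpen_slit₂ hG)) hz]
  exact dd_three_tensor b₁ b₂ α β γ (a' := fun y => ∑ k, h⁻¹ * p k * b₁.repr y k)
    (c' := fun v => b₂.repr v d)
    contDiffOn_const (ContDiff.sum fun k _ => contDiff_const.mul (smooth_repr b₁ k)).contDiffOn
    (smooth_twistSprayVert h₂ hG₂ d) (smooth_repr b₂ d).contDiffOn hz

theorem sum_sum_sum_mul {ι κ : Type*} [Fintype ι] [Fintype κ] (A : ι → ι → ℝ) (p : κ → ℝ)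
    (X : κ → ι → ι → ℝ) :
    ∑ j, ∑ k, ∑ m, p m * (A j k * X m j k) = ∑ m, p m * ∑ j, ∑ k, A j k * X m j k := by
  simp only [Finset.mul_sum]
  rw [Finset.sum_comm (γ := κ)]
  exact Finset.sum_congr rfl fun j _ => Finset.sum_comm

theorem dd_sum_const_mul {V κ : Type*} [NormedAddCommGroup V] [NormedSpace ℝ V] [Fintype κ]
    {S : Set V} (hS : IsOpen S) {φ : κ → V → ℝ} (hφ : ∀ m, ContDiffOn ℝ ∞ (φ m) S) (c : κ → ℝ)
    (v : V) : Set.EqOn (dd v fun y => ∑ m, c m * φ m y) (fun y => ∑ m, c m * dd v (φ m) y) S := by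
  intro y hy
  rw [dd_sum (φ := fun m y => c m * φ m y) _ _ fun m _ => ((hφ m).diffAt hS hy).const_mul _]
  simp only [dd_const_mul]

/-- The factor 4 combines the 1/2 in g = Hess(N)/2 with the 1/2 in C = ∂g/2. -/
theorem sum_inv_dd_three {ι E : Type*} [Fintype ι] [DecidableEq ι] [NormedAddCommGroup E]
    [NormedSpace ℝ E] (b : Module.Basis ι ℝ E) (N : E → ℝ) (i : ι) (y : E) :
    ∑ j, ∑ k, hessInv b N y j k * dd (b k) (dd (b j) (dd (b i) N)) y = 4 * meanTorsion b N i y := by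
  have h1 : ∀ (v : E) (φ : E → ℝ), dd v (fun q => (1 / 2) * φ q) = fun q => (1 / 2) * dd v φ q :=
    fun v φ => funext fun q => dd_const_mul v _
  have h2 := sum_inv_dd_hess b N y i
  simp only [hess, Matrix.of_apply, h1] at h2
  have h3 : (4 : ℝ) * meanTorsion b N i y = 2 * (2 * meanTorsion b N i y) := by ring
  rw [h3, ← h2, Finset.mul_sum]
  refine Finset.sum_congr rfl fun j _ => ?_
  rw [Finset.mul_sum]
  exact Finset.sum_congr rfl fun k _ => by ring

/-- The mean Landsberg curvature of a twisted product in the directions of the first factor. -/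
theorem landsbergTrace_twist_inl (h₁ : IsMinkowskiSq b₁ N₁) (h₂ : IsMinkowskiSq b₂ N₂)
    (h0 : h ≠ 0) {p : ι₁ → ℝ} {q : ι₂ → ℝ} {G₁ : ι₁ → E₁ → ℝ} {G₂ : ι₂ → E₂ → ℝ}
    (hG₁ : ∀ l, ContDiffOn ℝ ∞ (G₁ l) {0}ᶜ) (hG₂ : ∀ d, ContDiffOn ℝ ∞ (G₂ d) {0}ᶜ)
    {G : ι₁ ⊕ ι₂ → E₁ × E₂ → ℝ}
    (hGl : ∀ l, Set.EqOn (G (Sum.inl l)) (twistSpray₁ b₁ N₁ N₂ h p G₁ l) (slit₂ E₁ E₂))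
    (hGr : ∀ d, Set.EqOn (G (Sum.inr d)) (twistSpray₂ b₁ b₂ N₂ h p q G₂ d) (slit₂ E₁ E₂))
    {y : E₁} {v : E₂} (hy : y ≠ 0) (hv : v ≠ 0) (i : ι₁) :
    landsbergTrace (b₁.prod b₂) (fun z => N₁ z.1 + h ^ 2 * N₂ z.2) G (Sum.inl i) (y, v) =
      landsbergTrace b₁ N₁ G₁ i y + (1 / 4) * h * N₂ v * ∑ m, p m *
        (4 * dd (b₁ i) (meanTorsionUp b₁ N₁ m) y -
          2 * ∑ l, meanTorsion b₁ N₁ l y * dd (b₁ i) (fun q => hessInv b₁ N₁ q l m) y) := by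
  have hz : (y, v) ∈ slit₂ E₁ E₂ := ⟨hy, hv⟩
  have hK : ∀ l m, ContDiffOn ℝ ∞ (fun q => hessInv b₁ N₁ q l m) {0}ᶜ := h₁.smooth_inv
  have e1 : ∀ l, Set.EqOn (dd (b₁ i) fun y => ∑ m, -(1 / 2) * h * p m * hessInv b₁ N₁ y l m)
      (fun y => ∑ m, -(1 / 2) * h * p m * dd (b₁ i) (fun y => hessInv b₁ N₁ y l m) y) {0}ᶜ :=
    fun l => dd_sum_const_mul isOpen_compl_singleton (hK l) _ _
  have e2 : ∀ l j, Set.EqOn (dd (b₁ j) (dd (b₁ i) fun y =>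
      ∑ m, -(1 / 2) * h * p m * hessInv b₁ N₁ y l m))
      (fun y => ∑ m, -(1 / 2) * h * p m * dd (b₁ j) (dd (b₁ i) fun y => hessInv b₁ N₁ y l m) y)
      {0}ᶜ := fun l j => (dd_congr _ isOpen_compl_singleton (e1 l)).trans
    (dd_sum_const_mul isOpen_compl_singleton (fun m => (hK l m).dd _ isOpen_compl_singleton) _ _)
  have e3 : ∀ l j k, dd (b₁ k) (dd (b₁ j) (dd (b₁ i) fun y =>
      ∑ m, -(1 / 2) * h * p m * hessInv b₁ N₁ y l m)) y =
      ∑ m, -(1 / 2) * h * p m *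
        dd (b₁ k) (dd (b₁ j) (dd (b₁ i) fun y => hessInv b₁ N₁ y l m)) y := fun l j k =>
    ((dd_congr _ isOpen_compl_singleton (e2 l j)).trans (dd_sum_const_mul isOpen_compl_singleton
      (fun m => ((hK l m).dd _ isOpen_compl_singleton).dd _ isOpen_compl_singleton) _ _)) hy
  rw [landsbergTrace_prod h₁ h₂ h0 hz]
  simp only [dd_three_twistSpray₁ h₁ h₂ hG₁ (hGl _) _ _ _ hz,
    dd_three_twistSpray₂ h₂ hG₂ (hGr _) _ _ _ hz, leftD_inl, leftD_inr, rightD_inl, rightD_inr,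
    dd_const', dd_sum_const_mul_repr, dd_repr']
  -- The block with both traced indices in the second factor contributes nothing, since y_l ∂_i
  -- g^{lm} = 0. In the other block the second-factor spray drops out because it is affine in y.
  have v1 : ∑ l, dd (b₁ l) (fun q => (1 / 2) * N₁ q) y *
      dd (b₁ i) (fun y => ∑ m, -(1 / 2) * h * p m * hessInv b₁ N₁ y l m) y = 0 := by
    simp only [e1 _ hy, Finset.mul_sum]
    rw [Finset.sum_comm]
    refine Finset.sum_eq_zero fun m _ => ?_
    calc _ = -(1 / 2) * h * p m * ∑ l, dd (b₁ l) (fun q => (1 / 2) * N₁ q) y *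
          dd (b₁ i) (fun y => hessInv b₁ N₁ y l m) y := by
          rw [Finset.mul_sum]
          exact Finset.sum_congr rfl fun l _ => by ring
      _ = 0 := by rw [h₁.sum_lower_dd_inv hy, mul_zero]
  have v2 : ∀ t : ℝ, ∑ l, dd (b₁ l) (fun q => (1 / 2) * N₁ q) y * (dd (b₁ i) (G₁ l) y * 0 +
      dd (b₁ i) (fun y => ∑ m, -(1 / 2) * h * p m * hessInv b₁ N₁ y l m) y * t) = 0 := fun t => by
    simp only [mul_zero, zero_add, ← mul_assoc, ← Finset.sum_mul, v1, zero_mul]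
  simp only [v2]
  simp only [zero_mul, mul_zero, add_zero, Finset.sum_const_zero, mul_one]
  rw [landsbergTrace]
  simp only [← h₁.dd_half hy, ← h₁.sum_inv_sum_lower_three hy, e3]
  simp only [mul_add, add_mul, Finset.sum_add_distrib]
  congr 1
  rw [← sum_sum_sum_mul (fun j k => hessInv b₁ N₁ y j k) p (fun m j k =>
    ∑ l, dd (b₁ l) (fun q => 1 / 2 * N₁ q) y *
      dd (b₁ k) (dd (b₁ j) (dd (b₁ i) fun q => hessInv b₁ N₁ q l m)) y), Finset.mul_sum]
  refine Finset.sum_congr rfl fun j _ => ?_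
  rw [Finset.mul_sum]
  refine Finset.sum_congr rfl fun k _ => ?_
  simp only [Finset.mul_sum, Finset.sum_mul]
  rw [Finset.sum_comm]
  exact Finset.sum_congr rfl fun m _ => Finset.sum_congr rfl fun l _ => by ring

/-- The mean Landsberg curvature of a twisted product in the directions of the second factor. -/
theorem landsbergTrace_twist_inr (h₁ : IsMinkowskiSq b₁ N₁) (h₂ : IsMinkowskiSq b₂ N₂)
    (h0 : h ≠ 0) {p : ι₁ → ℝ} {q : ι₂ → ℝ} {G₁ : ι₁ → E₁ → ℝ} {G₂ : ι₂ → E₂ → ℝ}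
    (hG₁ : ∀ l, ContDiffOn ℝ ∞ (G₁ l) {0}ᶜ) (hG₂ : ∀ d, ContDiffOn ℝ ∞ (G₂ d) {0}ᶜ)
    {G : ι₁ ⊕ ι₂ → E₁ × E₂ → ℝ}
    (hGl : ∀ l, Set.EqOn (G (Sum.inl l)) (twistSpray₁ b₁ N₁ N₂ h p G₁ l) (slit₂ E₁ E₂))
    (hGr : ∀ d, Set.EqOn (G (Sum.inr d)) (twistSpray₂ b₁ b₂ N₂ h p q G₂ d) (slit₂ E₁ E₂))
    {y : E₁} {v : E₂} (hy : y ≠ 0) (hv : v ≠ 0) (i : ι₂) :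
    landsbergTrace (b₁.prod b₂) (fun z => N₁ z.1 + h ^ 2 * N₂ z.2) G (Sum.inr i) (y, v) =
      (1 / 2) * h * dd (b₂ i) N₂ v * (∑ m, meanTorsionUp b₁ N₁ m y * p m) +
        h⁻¹ * (∑ m, p m * b₁.repr y m) * meanTorsion b₂ N₂ i v +
          landsbergTrace b₂ N₂ (twistSprayVert b₂ N₂ h q G₂) i v := by
  have hz : (y, v) ∈ slit₂ E₁ E₂ := ⟨hy, hv⟩
  have hK : ∀ l m, ContDiffOn ℝ ∞ (fun q => hessInv b₁ N₁ q l m) {0}ᶜ := h₁.smooth_inv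
  have e2 : ∀ l j k, dd (b₁ k) (dd (b₁ j) fun y =>
      ∑ m, -(1 / 2) * h * p m * hessInv b₁ N₁ y l m) y =
      ∑ m, -(1 / 2) * h * p m * dd (b₁ k) (dd (b₁ j) fun y => hessInv b₁ N₁ y l m) y :=
    fun l j k => ((dd_congr _ isOpen_compl_singleton
      (dd_sum_const_mul isOpen_compl_singleton (hK l) _ _)).trans
        (dd_sum_const_mul isOpen_compl_singleton
          (fun m => (hK l m).dd _ isOpen_compl_singleton) _ _)) hy
  -- For indices in the second factor no derivative falls on g^{lm}, and y_l g^{lm} = y^m produces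
  -- the linear factor p·y in front of the torsion of the second norm.
  have e4 : ∑ l, dd (b₁ l) (fun q => (1 / 2) * N₁ q) y *
      (∑ m, -(1 / 2) * h * p m * hessInv b₁ N₁ y l m) =
      -(1 / 2) * h * ∑ m, p m * b₁.repr y m := by
    simp only [← h₁.sum_lower_inv hy, Finset.mul_sum]
    rw [Finset.sum_comm]
    exact Finset.sum_congr rfl fun m _ => Finset.sum_congr rfl fun l _ => by ring
  rw [landsbergTrace_prod h₁ h₂ h0 hz]
  simp only [dd_three_twistSpray₁ h₁ h₂ hG₁ (hGl _) _ _ _ hz,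
    dd_three_twistSpray₂ h₂ hG₂ (hGr _) _ _ _ hz, leftD_inl, leftD_inr, rightD_inl, rightD_inr,
    dd_const', dd_sum_const_mul_repr, dd_repr']
  simp only [zero_mul, mul_zero, add_zero, zero_add, Finset.sum_const_zero, one_mul]
  rw [add_assoc]
  congr 1
  · have e5 : ∑ m, meanTorsionUp b₁ N₁ m y * p m = (1 / 2) * ∑ m, p m *
        (2 * meanTorsionUp b₁ N₁ m y) := by
      rw [Finset.mul_sum]
      exact Finset.sum_congr rfl fun m _ => by ring
    rw [e5]
    simp only [← h₁.sum_inv_sum_lower hy, e2]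
    rw [← sum_sum_sum_mul (fun j k => hessInv b₁ N₁ y j k) p (fun m j k =>
      ∑ l, dd (b₁ l) (fun q => 1 / 2 * N₁ q) y *
        dd (b₁ k) (dd (b₁ j) fun q => hessInv b₁ N₁ q l m) y), Finset.mul_sum, Finset.mul_sum]
    refine Finset.sum_congr rfl fun j _ => ?_
    rw [Finset.mul_sum, Finset.mul_sum]
    refine Finset.sum_congr rfl fun k _ => ?_
    simp only [Finset.mul_sum, Finset.sum_mul]
    rw [Finset.sum_comm]
    exact Finset.sum_congr rfl fun m _ => Finset.sum_congr rfl fun l _ => by ring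
  · have h4 : meanTorsion b₂ N₂ i v = (1 / 4) * (4 * meanTorsion b₂ N₂ i v) := by ring
    rw [h4, ← sum_inv_dd_three, landsbergTrace]
    generalize ∑ m, p m * b₁.repr y m = s₀ at e4 ⊢
    simp only [← h₂.dd_half hv, ← mul_assoc, ← Finset.sum_mul, e4]
    rw [Finset.mul_sum, ← Finset.sum_add_distrib]
    refine Finset.sum_congr rfl fun j _ => ?_
    rw [Finset.mul_sum, ← Finset.sum_add_distrib]
    refine Finset.sum_congr rfl fun k _ => ?_
    simp only [mul_assoc (h ^ 2), ← Finset.mul_sum]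
    field_simp
    ring

end Formulas

end FiberProduct

/-! ### Restriction of local Finsler quantities to a fibre -/

section Slices

variable {ι E : Type*} [Fintype ι] [DecidableEq ι] [NormedAddCommGroup E] [NormedSpace ℝ E]
  {b : Module.Basis ι ℝ E} {φ ψ : E × E → ℝ} {U S : Set E} {x y : E}

theorem dx_eq_dd (i : ι) : dx b i φ = dd (b i, 0) φ := rfl

theorem dy_eq_dd (i : ι) : dy b i φ = dd (0, b i) φ := rfl

theorem hasFDerivAt_slice (x y : E) :
    HasFDerivAt (fun y : E => (x, y)) (ContinuousLinearMap.inr ℝ E E) y :=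
  (hasFDerivAt_const x y).prodMk (hasFDerivAt_id y)

theorem dd_slice (hψ : DifferentiableAt ℝ ψ (x, y)) (w : E) :
    dd (0, w) ψ (x, y) = dd w (fun y => ψ (x, y)) y := by
  have h1 : HasFDerivAt (fun y => ψ (x, y)) _ y := hψ.hasFDerivAt.comp y (hasFDerivAt_slice x y)
  simp [dd, h1.fderiv]

theorem _root_.ContDiffOn.slice (hψ : ContDiffOn ℝ ∞ ψ (U ×ˢ S)) (hx : x ∈ U) :
    ContDiffOn ℝ ∞ (fun y => ψ (x, y)) S :=
  hψ.comp (contDiff_prodMk_right x).contDiffOn fun _ hy => ⟨hx, hy⟩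

/-- Vertical derivatives do not move the base point. Hence, once the spray coefficients are known,
the curvature can be computed on a single tangent space. -/
theorem dd_slice_eqOn (hU : IsOpen U) (hS : IsOpen S) (hψ : ContDiffOn ℝ ∞ ψ (U ×ˢ S))
    (hx : x ∈ U) (w : E) :
    Set.EqOn (fun y => dd (0, w) ψ (x, y)) (dd w (fun y => ψ (x, y))) S := fun _ hy =>
  dd_slice (hψ.diffAt (hU.prod hS) ⟨hx, hy⟩) w

theorem dd_two_slice_eqOn (hU : IsOpen U) (hS : IsOpen S) (hψ : ContDiffOn ℝ ∞ ψ (U ×ˢ S))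
    (hx : x ∈ U) (w w' : E) :
    Set.EqOn (fun y => dd (0, w') (dd (0, w) ψ) (x, y)) (dd w' (dd w (fun y => ψ (x, y)))) S :=
  (dd_slice_eqOn hU hS (hψ.dd _ (hU.prod hS)) hx w').trans
    (dd_congr _ hS (dd_slice_eqOn hU hS hψ hx w))

theorem dd_three_slice_eqOn (hU : IsOpen U) (hS : IsOpen S) (hψ : ContDiffOn ℝ ∞ ψ (U ×ˢ S))
    (hx : x ∈ U) (w w' w'' : E) :
    Set.EqOn (fun y => dd (0, w'') (dd (0, w') (dd (0, w) ψ)) (x, y))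
      (dd w'' (dd w' (dd w (fun y => ψ (x, y))))) S :=
  (dd_two_slice_eqOn hU hS (hψ.dd _ (hU.prod hS)) hx w' w'').trans
    (dd_congr _ hS (dd_congr _ hS (dd_slice_eqOn hU hS hψ hx w)))

theorem fundamental_slice (hU : IsOpen U) (hS : IsOpen S)
    (hφ : ContDiffOn ℝ ∞ (fun p => φ p ^ 2) (U ×ˢ S)) (hx : x ∈ U) (hy : y ∈ S) :
    fundamental b φ (x, y) = hess b (fun y => φ (x, y) ^ 2) y := by
  ext i j
  exact dd_two_slice_eqOn hU hS (contDiffOn_const.mul hφ) hx (b i) (b j) hy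

theorem smooth_fundamental (hU : IsOpen U) (hS : IsOpen S)
    (hφ : ContDiffOn ℝ ∞ (fun p => φ p ^ 2) (U ×ˢ S)) (i j : ι) :
    ContDiffOn ℝ ∞ (fun p => fundamental b φ p i j) (U ×ˢ S) :=
  ((contDiffOn_const.mul hφ).dd _ (hU.prod hS)).dd _ (hU.prod hS)

theorem smooth_fundamentalInv (hU : IsOpen U) (hS : IsOpen S)
    (hφ : ContDiffOn ℝ ∞ (fun p => φ p ^ 2) (U ×ˢ S))
    (hdet : ∀ p ∈ U ×ˢ S, (fundamental b φ p).det ≠ 0) (i j : ι) :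
    ContDiffOn ℝ ∞ (fun p => fundamentalInv b φ p i j) (U ×ˢ S) :=
  contDiffOn_inv (smooth_fundamental hU hS hφ) hdet i j

theorem smooth_spray (hU : IsOpen U) (hS : IsOpen S)
    (hφ : ContDiffOn ℝ ∞ (fun p => φ p ^ 2) (U ×ˢ S))
    (hdet : ∀ p ∈ U ×ˢ S, (fundamental b φ p).det ≠ 0) (l : ι) :
    ContDiffOn ℝ ∞ (spray b φ l) (U ×ˢ S) := by
  refine contDiffOn_const.mul (ContDiffOn.sum fun j _ =>
    (smooth_fundamentalInv hU hS hφ hdet l j).mul (ContDiffOn.sub (ContDiffOn.sum fun k _ => ?_) ?_))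
  · exact ((hφ.dd _ (hU.prod hS)).dd _ (hU.prod hS)).mul
      ((smooth_repr b k).comp contDiff_snd).contDiffOn
  · exact hφ.dd _ (hU.prod hS)

/-- The mean Landsberg curvature is computed on a single fiber from the spray coefficients. -/
theorem meanLandsberg_slice (hU : IsOpen U) (hS : IsOpen S)
    (hφ : ContDiffOn ℝ ∞ (fun p => φ p ^ 2) (U ×ˢ S))
    (hdet : ∀ p ∈ U ×ˢ S, (fundamental b φ p).det ≠ 0) (hx : x ∈ U) (hy : y ∈ S) (i : ι) :
    meanLandsberg b φ i (x, y) =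
      landsbergTrace b (fun y => φ (x, y) ^ 2) (fun l y => spray b φ l (x, y)) i y := by
  have h1 : ∀ l j k, berwald b φ l i j k (x, y) =
      dd (b k) (dd (b j) (dd (b i) fun y => spray b φ l (x, y))) y := fun l j k =>
    dd_three_slice_eqOn hU hS (smooth_spray hU hS hφ hdet l) hx (b i) (b j) (b k) hy
  simp only [meanLandsberg, landsberg, landsbergTrace, h1, fundamentalInv, hessInv,
    fundamental_slice hU hS hφ hx hy]

theorem meanCartan_slice (hU : IsOpen U) (hS : IsOpen S)
    (hφ : ContDiffOn ℝ ∞ (fun p => φ p ^ 2) (U ×ˢ S)) (hx : x ∈ U) (hy : y ∈ S) (i : ι) :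
    meanCartan b φ i (x, y) = meanTorsion b (fun y => φ (x, y) ^ 2) i y := by
  have h1 : ∀ j k, dy b k (fun q => fundamental b φ q i j) (x, y) =
      dd (b k) (fun q => hess b (fun y => φ (x, y) ^ 2) q i j) y := fun j k => by
    refine (dd_slice_eqOn hU hS (smooth_fundamental hU hS hφ i j) hx (b k) hy).trans
      (dd_congr _ hS (fun z hz => ?_) hy)
    simp only [fundamental_slice hU hS hφ hx hz]
  simp only [meanCartan, cartan, meanTorsion, h1, fundamentalInv, hessInv,
    fundamental_slice hU hS hφ hx hy]

theorem meanCartanUp_slice (hU : IsOpen U) (hS : IsOpen S)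
    (hφ : ContDiffOn ℝ ∞ (fun p => φ p ^ 2) (U ×ˢ S)) (hx : x ∈ U) (hy : y ∈ S) (i : ι) :
    meanCartanUp b φ i (x, y) = meanTorsionUp b (fun y => φ (x, y) ^ 2) i y := by
  simp only [meanCartanUp, meanTorsionUp, meanCartan_slice hU hS hφ hx hy, fundamentalInv, hessInv,
    fundamental_slice hU hS hφ hx hy]

theorem continuousOn_meanCartan (hU : IsOpen U) (hS : IsOpen S)
    (hφ : ContDiffOn ℝ ∞ (fun p => φ p ^ 2) (U ×ˢ S))
    (hdet : ∀ p ∈ U ×ˢ S, (fundamental b φ p).det ≠ 0) (i : ι) :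
    ContinuousOn (meanCartan b φ i) (U ×ˢ S) := by
  refine continuousOn_finsetSum _ fun j _ => continuousOn_finsetSum _ fun k _ => ?_
  exact (continuousOn_const.mul ((smooth_fundamental hU hS hφ i j).dd _
    (hU.prod hS)).continuousOn).mul (smooth_fundamentalInv hU hS hφ hdet j k).continuousOn

/-- `φ` is the expression of a Finsler function in the coordinates of a chart with image `U`. -/
structure IsLocalFinsler (b : Module.Basis ι ℝ E) (φ : E × E → ℝ) (U : Set E) : Prop where
  isOpen : IsOpen U
  smooth : ContDiffOn ℝ ∞ (fun p => φ p ^ 2) (U ×ˢ {0}ᶜ)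
  homog : ∀ x ∈ U, ∀ c : ℝ, 0 < c → ∀ y, φ (x, c • y) = c * φ (x, y)
  posDef : ∀ x ∈ U, ∀ y, y ≠ 0 → (fundamental b φ (x, y)).PosDef

namespace IsLocalFinsler

theorem det_ne_zero (h : IsLocalFinsler b φ U) :
    ∀ p ∈ U ×ˢ {0}ᶜ, (fundamental b φ p).det ≠ 0 := fun p hp =>
  (h.posDef p.1 hp.1 p.2 hp.2).det_pos.ne'

theorem isMinkowskiSq (h : IsLocalFinsler b φ U) (hx : x ∈ U) :
    IsMinkowskiSq b (fun y => φ (x, y) ^ 2) where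
  smooth := h.smooth.slice hx
  homog c hc y := by simp only [h.homog x hx c hc y]; ring
  posDef y hy := by
    rw [← fundamental_slice h.isOpen isOpen_compl_singleton h.smooth hx hy]
    exact h.posDef x hx y hy

theorem smooth_spray (h : IsLocalFinsler b φ U) (l : ι) :
    ContDiffOn ℝ ∞ (spray b φ l) (U ×ˢ {0}ᶜ) :=
  Finsler.smooth_spray h.isOpen isOpen_compl_singleton h.smooth h.det_ne_zero l

theorem meanLandsberg_eq (h : IsLocalFinsler b φ U) (hx : x ∈ U) (hy : y ≠ 0) (i : ι) :
    meanLandsberg b φ i (x, y) =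
      landsbergTrace b (fun y => φ (x, y) ^ 2) (fun l y => spray b φ l (x, y)) i y :=
  meanLandsberg_slice h.isOpen isOpen_compl_singleton h.smooth h.det_ne_zero hx hy i

theorem meanCartan_eq (h : IsLocalFinsler b φ U) (hx : x ∈ U) (hy : y ≠ 0) (i : ι) :
    meanCartan b φ i (x, y) = meanTorsion b (fun y => φ (x, y) ^ 2) i y :=
  meanCartan_slice h.isOpen isOpen_compl_singleton h.smooth hx hy i

theorem meanCartanUp_eq (h : IsLocalFinsler b φ U) (hx : x ∈ U) (hy : y ≠ 0) (i : ι) :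
    meanCartanUp b φ i (x, y) = meanTorsionUp b (fun y => φ (x, y) ^ 2) i y :=
  meanCartanUp_slice h.isOpen isOpen_compl_singleton h.smooth hx hy i

theorem fundamentalInv_eq (h : IsLocalFinsler b φ U) (hx : x ∈ U) (hy : y ≠ 0) :
    fundamentalInv b φ (x, y) = hessInv b (fun y => φ (x, y) ^ 2) y := by
  rw [fundamentalInv, fundamental_slice h.isOpen isOpen_compl_singleton h.smooth hx hy, hessInv]

end IsLocalFinsler

end Slices

/-! ### Spray coefficients of a twisted product -/

section TwistedSpray

variable {ι₁ ι₂ E₁ E₂ : Type*} [Fintype ι₁] [DecidableEq ι₁] [Fintype ι₂] [DecidableEq ι₂]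
  [NormedAddCommGroup E₁] [NormedSpace ℝ E₁] [NormedAddCommGroup E₂] [NormedSpace ℝ E₂]
  {b₁ : Module.Basis ι₁ ℝ E₁} {b₂ : Module.Basis ι₂ ℝ E₂}
  {φ₁ : E₁ × E₁ → ℝ} {φ₂ : E₂ × E₂ → ℝ} {U₁ : Set E₁} {U₂ : Set E₂} {h : E₁ × E₂ → ℝ}
  {φ : (E₁ × E₂) × (E₁ × E₂) → ℝ}

/-- `φ` is the expression in coordinates of a twisted product of `φ₁` and `φ₂`, with twisting
function `h`. -/
structure IsLocalTwist (b₁ : Module.Basis ι₁ ℝ E₁) (b₂ : Module.Basis ι₂ ℝ E₂) (φ₁ : E₁ × E₁ → ℝ)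
    (φ₂ : E₂ × E₂ → ℝ) (U₁ : Set E₁) (U₂ : Set E₂) (h : E₁ × E₂ → ℝ)
    (φ : (E₁ × E₂) × (E₁ × E₂) → ℝ) : Prop where
  left : IsLocalFinsler b₁ φ₁ U₁
  right : IsLocalFinsler b₂ φ₂ U₂
  smooth_twist : ContDiffOn ℝ ∞ h (U₁ ×ˢ U₂)
  pos : ∀ q ∈ U₁ ×ˢ U₂, 0 < h q
  sq_eq : ∀ q ∈ U₁ ×ˢ U₂, ∀ z : E₁ × E₂,
    φ (q, z) ^ 2 = φ₁ (q.1, z.1) ^ 2 + h q ^ 2 * φ₂ (q.2, z.2) ^ 2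

theorem dd_zero {V : Type*} [NormedAddCommGroup V] [NormedSpace ℝ V] (ψ : V → ℝ) :
    dd 0 ψ = fun _ => 0 := by
  ext; simp [dd]

/-- The derivative of `A(x, y) + a(x, u) B(u, v) + a'(x, u) B'(u, v)`. -/
theorem dd_mixed {A : E₁ × E₁ → ℝ} {a a' : E₁ × E₂ → ℝ} {B B' : E₂ × E₂ → ℝ}
    {q : (E₁ × E₂) × (E₁ × E₂)} (hA : DifferentiableAt ℝ A (q.1.1, q.2.1))
    (ha : DifferentiableAt ℝ a q.1) (hB : DifferentiableAt ℝ B (q.1.2, q.2.2))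
    (ha' : DifferentiableAt ℝ a' q.1) (hB' : DifferentiableAt ℝ B' (q.1.2, q.2.2))
    (w : (E₁ × E₂) × (E₁ × E₂)) :
    DifferentiableAt ℝ (fun q : (E₁ × E₂) × (E₁ × E₂) => A (q.1.1, q.2.1) +
      (a q.1 * B (q.1.2, q.2.2) + a' q.1 * B' (q.1.2, q.2.2))) q ∧
    dd w (fun q : (E₁ × E₂) × (E₁ × E₂) => A (q.1.1, q.2.1) +
      (a q.1 * B (q.1.2, q.2.2) + a' q.1 * B' (q.1.2, q.2.2))) q =
      dd (w.1.1, w.2.1) A (q.1.1, q.2.1) +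
        ((dd w.1 a q.1 * B (q.1.2, q.2.2) + a q.1 * dd (w.1.2, w.2.2) B (q.1.2, q.2.2)) +
        (dd w.1 a' q.1 * B' (q.1.2, q.2.2) + a' q.1 * dd (w.1.2, w.2.2) B' (q.1.2, q.2.2))) := by
  have f1 : HasFDerivAt (fun q : (E₁ × E₂) × (E₁ × E₂) => (q.1.1, q.2.1)) _ q :=
    (((ContinuousLinearMap.fst ℝ E₁ E₂).comp (.fst ℝ (E₁ × E₂) (E₁ × E₂))).prod
      ((ContinuousLinearMap.fst ℝ E₁ E₂).comp (.snd ℝ (E₁ × E₂) (E₁ × E₂)))).hasFDerivAt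
  have f2 : HasFDerivAt (fun q : (E₁ × E₂) × (E₁ × E₂) => (q.1.2, q.2.2)) _ q :=
    (((ContinuousLinearMap.snd ℝ E₁ E₂).comp (.fst ℝ (E₁ × E₂) (E₁ × E₂))).prod
      ((ContinuousLinearMap.snd ℝ E₁ E₂).comp (.snd ℝ (E₁ × E₂) (E₁ × E₂)))).hasFDerivAt
  have h1 : HasFDerivAt (fun q : (E₁ × E₂) × (E₁ × E₂) => A (q.1.1, q.2.1)) _ q :=
    HasFDerivAt.comp q (g := A) hA.hasFDerivAt f1
  have h2 : ∀ {B : E₂ × E₂ → ℝ}, DifferentiableAt ℝ B (q.1.2, q.2.2) →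
      DifferentiableAt ℝ (fun q : (E₁ × E₂) × (E₁ × E₂) => B (q.1.2, q.2.2)) q ∧
      dd w (fun q : (E₁ × E₂) × (E₁ × E₂) => B (q.1.2, q.2.2)) q =
        dd (w.1.2, w.2.2) B (q.1.2, q.2.2) := fun {B} hB => by
    have h2 : HasFDerivAt (fun q : (E₁ × E₂) × (E₁ × E₂) => B (q.1.2, q.2.2)) _ q :=
      HasFDerivAt.comp q (g := B) hB.hasFDerivAt f2
    exact ⟨h2.differentiableAt, by simp [dd, h2.fderiv]⟩
  have h3 : ∀ {a : E₁ × E₂ → ℝ}, DifferentiableAt ℝ a q.1 →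
      DifferentiableAt ℝ (fun q : (E₁ × E₂) × (E₁ × E₂) => a q.1) q ∧
      dd w (fun q : (E₁ × E₂) × (E₁ × E₂) => a q.1) q = dd w.1 a q.1 := fun {a} ha => by
    have h3 : HasFDerivAt (fun q : (E₁ × E₂) × (E₁ × E₂) => a q.1) _ q :=
      HasFDerivAt.comp q (g := a) ha.hasFDerivAt hasFDerivAt_fst
    exact ⟨h3.differentiableAt, by simp [dd, h3.fderiv]⟩
  have h4 := (h3 ha).1.fun_mul (h2 hB).1
  have h5 := (h3 ha').1.fun_mul (h2 hB').1
  refine ⟨h1.differentiableAt.fun_add (h4.fun_add h5), ?_⟩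
  rw [dd_add _ h1.differentiableAt (h4.fun_add h5), dd_add _ h4 h5, dd_mul _ (h3 ha).1 (h2 hB).1,
    dd_mul _ (h3 ha').1 (h2 hB').1, (h3 ha).2, (h3 ha').2, (h2 hB).2, (h2 hB').2]
  congr 1
  simp [dd, h1.fderiv]

namespace IsLocalTwist

theorem isOpen_base (H : IsLocalTwist b₁ b₂ φ₁ φ₂ U₁ U₂ h φ) : IsOpen (U₁ ×ˢ U₂) :=
  H.left.isOpen.prod H.right.isOpen

theorem smooth (H : IsLocalTwist b₁ b₂ φ₁ φ₂ U₁ U₂ h φ) :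
    ContDiffOn ℝ ∞ (fun p => φ p ^ 2) ((U₁ ×ˢ U₂) ×ˢ slit₂ E₁ E₂) := by
  have h1 : ContDiffOn ℝ ∞ (fun p : (E₁ × E₂) × (E₁ × E₂) =>
      φ₁ (p.1.1, p.2.1) ^ 2 + h p.1 ^ 2 * φ₂ (p.1.2, p.2.2) ^ 2)
      ((U₁ ×ˢ U₂) ×ˢ slit₂ E₁ E₂) := by
    refine ContDiffOn.add ?_ (ContDiffOn.mul ?_ ?_)
    · exact H.left.smooth.comp (g := fun p => φ₁ p ^ 2)
        (f := fun p : (E₁ × E₂) × (E₁ × E₂) => (p.1.1, p.2.1)) (by fun_prop)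
        fun p hp => ⟨hp.1.1, hp.2.1⟩
    · exact (H.smooth_twist.comp contDiff_fst.contDiffOn fun p hp => hp.1).pow 2
    · exact H.right.smooth.comp (g := fun p => φ₂ p ^ 2)
        (f := fun p : (E₁ × E₂) × (E₁ × E₂) => (p.1.2, p.2.2)) (by fun_prop)
        fun p hp => ⟨hp.1.2, hp.2.2⟩
  exact h1.congr fun p hp => H.sq_eq p.1 hp.1 p.2

theorem slice_eq (H : IsLocalTwist b₁ b₂ φ₁ φ₂ U₁ U₂ h φ) {q : E₁ × E₂} (hq : q ∈ U₁ ×ˢ U₂) :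
    (fun z => φ (q, z) ^ 2) =
      fun z => (fun y => φ₁ (q.1, y) ^ 2) z.1 + h q ^ 2 * (fun v => φ₂ (q.2, v) ^ 2) z.2 := by
  ext z; exact H.sq_eq q hq z

theorem fundamental_eq (H : IsLocalTwist b₁ b₂ φ₁ φ₂ U₁ U₂ h φ) {q z : E₁ × E₂}
    (hq : q ∈ U₁ ×ˢ U₂) (hz : z ∈ slit₂ E₁ E₂) :
    fundamental (b₁.prod b₂) φ (q, z) = hess (b₁.prod b₂)
      (fun z => (fun y => φ₁ (q.1, y) ^ 2) z.1 + h q ^ 2 * (fun v => φ₂ (q.2, v) ^ 2) z.2) z := by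
  rw [fundamental_slice H.isOpen_base isOpen_slit₂ H.smooth hq hz, H.slice_eq hq]

theorem det_ne_zero (H : IsLocalTwist b₁ b₂ φ₁ φ₂ U₁ U₂ h φ) :
    ∀ p ∈ (U₁ ×ˢ U₂) ×ˢ slit₂ E₁ E₂, (fundamental (b₁.prod b₂) φ p).det ≠ 0 := by
  rintro ⟨q, z⟩ ⟨hq, hz⟩
  rw [H.fundamental_eq hq hz, hess_prod (H.left.isMinkowskiSq hq.1) (H.right.isMinkowskiSq hq.2) hz,
    Matrix.det_fromBlocks_zero₂₁, Matrix.det_smul]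
  have h1 := (H.left.isMinkowskiSq hq.1).det_ne_zero hz.1
  have h2 := (H.right.isMinkowskiSq hq.2).det_ne_zero hz.2
  have h3 := (H.pos q hq).ne'
  positivity

theorem meanLandsberg_eq (H : IsLocalTwist b₁ b₂ φ₁ φ₂ U₁ U₂ h φ) {q z : E₁ × E₂}
    (hq : q ∈ U₁ ×ˢ U₂) (hz : z ∈ slit₂ E₁ E₂) (α : ι₁ ⊕ ι₂) :
    meanLandsberg (b₁.prod b₂) φ α (q, z) = landsbergTrace (b₁.prod b₂)
      (fun z => (fun y => φ₁ (q.1, y) ^ 2) z.1 + h q ^ 2 * (fun v => φ₂ (q.2, v) ^ 2) z.2)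
      (fun l z => spray (b₁.prod b₂) φ l (q, z)) α z := by
  rw [meanLandsberg_slice H.isOpen_base isOpen_slit₂ H.smooth H.det_ne_zero hq hz, H.slice_eq hq]

/-- The derivative has the mixed shape of `dd_mixed` again, now with two products, so the second
derivative follows from the same lemma. -/
theorem dd_sq (H : IsLocalTwist b₁ b₂ φ₁ φ₂ U₁ U₂ h φ) (w : (E₁ × E₂) × (E₁ × E₂)) :
    Set.EqOn (dd w (fun p => φ p ^ 2)) (fun p => dd (w.1.1, w.2.1) (fun p => φ₁ p ^ 2)
        (p.1.1, p.2.1) + ((2 * h p.1 * dd w.1 h p.1) * φ₂ (p.1.2, p.2.2) ^ 2 +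
          h p.1 ^ 2 * dd (w.1.2, w.2.2) (fun p => φ₂ p ^ 2) (p.1.2, p.2.2)))
      ((U₁ ×ˢ U₂) ×ˢ slit₂ E₁ E₂) := by
  intro p hp
  have h1 : Set.EqOn (fun p => φ p ^ 2) (fun p : (E₁ × E₂) × (E₁ × E₂) =>
      (fun p => φ₁ p ^ 2) (p.1.1, p.2.1) + ((fun q => h q ^ 2) p.1 *
        (fun p => φ₂ p ^ 2) (p.1.2, p.2.2) + (fun _ => 0) p.1 * (fun _ => 0) (p.1.2, p.2.2)))
      ((U₁ ×ˢ U₂) ×ˢ slit₂ E₁ E₂) := fun p hp => by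
    simp only [H.sq_eq p.1 hp.1 p.2, mul_zero, add_zero]
  have hh : DifferentiableAt ℝ h p.1 := H.smooth_twist.diffAt H.isOpen_base hp.1
  have h2 : dd w.1 (fun q => h q ^ 2) p.1 = 2 * h p.1 * dd w.1 h p.1 := by
    have : (fun q => h q ^ 2) = fun q => h q * h q := by ext; ring
    rw [this, dd_mul _ hh hh]; ring
  rw [dd_congr w (H.isOpen_base.prod isOpen_slit₂) h1 hp]
  rw [(dd_mixed (A := fun p => φ₁ p ^ 2) (a := fun q => h q ^ 2) (B := fun p => φ₂ p ^ 2)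
    (H.left.smooth.diffAt (H.left.isOpen.prod isOpen_compl_singleton) ⟨hp.1.1, hp.2.1⟩)
    (hh.pow 2) (H.right.smooth.diffAt (H.right.isOpen.prod isOpen_compl_singleton)
      ⟨hp.1.2, hp.2.2⟩) (differentiableAt_const _) (differentiableAt_const _) w).2]
  simp [h2]

theorem dd_dd_sq (H : IsLocalTwist b₁ b₂ φ₁ φ₂ U₁ U₂ h φ) (w : (E₁ × E₂) × (E₁ × E₂))
    (w' : E₁ × E₂) {p : (E₁ × E₂) × (E₁ × E₂)} (hp : p ∈ (U₁ ×ˢ U₂) ×ˢ slit₂ E₁ E₂) :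
    dd (0, w') (dd w (fun p => φ p ^ 2)) p =
      dd (0, w'.1) (dd (w.1.1, w.2.1) (fun p => φ₁ p ^ 2)) (p.1.1, p.2.1) +
        ((2 * h p.1 * dd w.1 h p.1) * dd (0, w'.2) (fun p => φ₂ p ^ 2) (p.1.2, p.2.2) +
          h p.1 ^ 2 * dd (0, w'.2) (dd (w.1.2, w.2.2) (fun p => φ₂ p ^ 2)) (p.1.2, p.2.2)) := by
  have o1 := H.left.isOpen.prod (isOpen_compl_singleton (x := (0 : E₁)))
  have o2 := H.right.isOpen.prod (isOpen_compl_singleton (x := (0 : E₂)))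
  have hh : DifferentiableAt ℝ h p.1 := H.smooth_twist.diffAt H.isOpen_base hp.1
  have hh' : DifferentiableAt ℝ (dd w.1 h) p.1 :=
    (H.smooth_twist.dd _ H.isOpen_base).diffAt H.isOpen_base hp.1
  rw [dd_congr _ (H.isOpen_base.prod isOpen_slit₂) (H.dd_sq w) hp]
  rw [(dd_mixed (A := dd (w.1.1, w.2.1) (fun p => φ₁ p ^ 2))
    (a := fun q => 2 * h q * dd w.1 h q) (B := fun p => φ₂ p ^ 2)
    (a' := fun q => h q ^ 2) (B' := dd (w.1.2, w.2.2) (fun p => φ₂ p ^ 2))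
    ((H.left.smooth.dd _ o1).diffAt o1 ⟨hp.1.1, hp.2.1⟩)
    ((hh.const_mul 2).mul hh') (H.right.smooth.diffAt o2 ⟨hp.1.2, hp.2.2⟩)
    (hh.pow 2) ((H.right.smooth.dd _ o2).diffAt o2 ⟨hp.1.2, hp.2.2⟩) (0, w')).2]
  simp [dd_zero]

theorem fundamentalInv_eq (H : IsLocalTwist b₁ b₂ φ₁ φ₂ U₁ U₂ h φ) {q z : E₁ × E₂}
    (hq : q ∈ U₁ ×ˢ U₂) (hz : z ∈ slit₂ E₁ E₂) :
    fundamentalInv (b₁.prod b₂) φ (q, z) =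
      Matrix.fromBlocks (fundamentalInv b₁ φ₁ (q.1, z.1)) 0 0
        ((h q ^ 2)⁻¹ • fundamentalInv b₂ φ₂ (q.2, z.2)) := by
  rw [fundamentalInv, H.fundamental_eq hq hz, H.left.fundamentalInv_eq hq.1 hz.1,
    H.right.fundamentalInv_eq hq.2 hz.2]
  exact hessInv_prod (H.left.isMinkowskiSq hq.1) (H.right.isMinkowskiSq hq.2) (H.pos q hq).ne' hz

/-- A vertical derivative in the first factor kills h² φ₂², so the twist enters only through
-[φ²]_{x^j}, which contributes -2 h h_j φ₂²; with the prefactor 1/4 this gives -(1/2) h. -/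
theorem spray_inl (H : IsLocalTwist b₁ b₂ φ₁ φ₂ U₁ U₂ h φ) {q : E₁ × E₂}
    (hq : q ∈ U₁ ×ˢ U₂) (l : ι₁) :
    Set.EqOn (fun z => spray (b₁.prod b₂) φ (Sum.inl l) (q, z))
      (twistSpray₁ b₁ (fun y => φ₁ (q.1, y) ^ 2) (fun v => φ₂ (q.2, v) ^ 2) (h q)
        (fun m => dd (b₁ m, 0) h q) (fun l y => spray b₁ φ₁ l (q.1, y)) l) (slit₂ E₁ E₂) := by
  intro z hz
  have hp : (q, z) ∈ (U₁ ×ˢ U₂) ×ˢ slit₂ E₁ E₂ := ⟨hq, hz⟩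
  simp only [spray, twistSpray₁, H.fundamentalInv_eq hq hz, Fintype.sum_sum_type, dx_eq_dd,
    dy_eq_dd, prod_inl, prod_inr, H.dd_dd_sq _ _ hp, H.dd_sq _ hp]
  simp only [Matrix.fromBlocks_apply₁₁, Matrix.fromBlocks_apply₁₂, Matrix.zero_apply, zero_mul,
    Finset.sum_const_zero, add_zero, dd_zero, mul_zero, Prod.mk_zero_zero, Prod.fst_zero,
    Prod.snd_zero, zero_add, dd_const', Module.Basis.prod_repr_inl]
  rw [← H.left.fundamentalInv_eq hq.1 hz.1, mul_one, Finset.sum_mul, Finset.mul_sum, Finset.mul_sum,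
    ← Finset.sum_add_distrib]
  exact Finset.sum_congr rfl fun m _ => by ring

/-- The h² in the fundamental tensor cancels against that of φ², leaving the spray of φ₂. The
derivative of h² along (y, v) gives the terms proportional to v^d through g^{dx} ∂_x φ₂² = 2 v^d,
and -[φ²]_{x} gives the remaining one. -/
theorem spray_inr (H : IsLocalTwist b₁ b₂ φ₁ φ₂ U₁ U₂ h φ) {q : E₁ × E₂}
    (hq : q ∈ U₁ ×ˢ U₂) (d : ι₂) :
    Set.EqOn (fun z => spray (b₁.prod b₂) φ (Sum.inr d) (q, z))
      (twistSpray₂ b₁ b₂ (fun v => φ₂ (q.2, v) ^ 2) (h q) (fun m => dd (b₁ m, 0) h q)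
        (fun c => dd (0, b₂ c) h q) (fun d v => spray b₂ φ₂ d (q.2, v)) d) (slit₂ E₁ E₂) := by
  intro z hz
  have hp : (q, z) ∈ (U₁ ×ˢ U₂) ×ˢ slit₂ E₁ E₂ := ⟨hq, hz⟩
  simp only [spray, twistSpray₂, twistSprayVert, H.fundamentalInv_eq hq hz, Fintype.sum_sum_type,
    dx_eq_dd, dy_eq_dd, prod_inl, prod_inr, H.dd_dd_sq _ _ hp, H.dd_sq _ hp]
  simp only [Matrix.fromBlocks_apply₂₁, Matrix.fromBlocks_apply₂₂, Matrix.zero_apply, zero_mul,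
    Finset.sum_const_zero, add_zero, dd_zero, mul_zero, Prod.mk_zero_zero, Prod.fst_zero,
    Prod.snd_zero, zero_add, dd_const', Module.Basis.prod_repr_inl, Module.Basis.prod_repr_inr,
    Matrix.smul_apply, smul_eq_mul]
  have h0 := (H.pos q hq).ne'
  have e1 : ∑ x, fundamentalInv b₂ φ₂ (q.2, z.2) d x * dd (0, b₂ x) (fun p => φ₂ p ^ 2) (q.2, z.2) =
      2 * b₂.repr z.2 d := by
    have hM := H.right.isMinkowskiSq hq.2
    rw [← hM.sum_lower_inv hz.2, H.right.fundamentalInv_eq hq.2 hz.2, Finset.mul_sum]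
    refine Finset.sum_congr rfl fun x _ => ?_
    rw [dd_const_mul, hM.inv_symm hz.2 d x, dd_slice (H.right.smooth.diffAt
      (H.right.isOpen.prod isOpen_compl_singleton) ⟨hq.2, hz.2⟩)]
    ring
  rw [← H.right.fundamentalInv_eq hq.2 hz.2]
  -- The vertical derivatives and the row of the inverse metric become opaque; from here only e1 and
  -- linear algebra of sums are used.
  generalize hD : (fun x => dd (0, b₂ x) (fun p => φ₂ p ^ 2) (q.2, z.2)) = D at e1
  generalize hK : (fun x => fundamentalInv b₂ φ₂ (q.2, z.2) d x) = K at e1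
  replace hD : ∀ x, dd (0, b₂ x) (fun p => φ₂ p ^ 2) (q.2, z.2) = D x := congrFun hD
  replace hK : ∀ x, fundamentalInv b₂ φ₂ (q.2, z.2) d x = K x := congrFun hK
  simp only [hD, hK] at e1 ⊢
  have e2 : ∀ x, ∑ k, 2 * h q * dd (b₁ k, 0) h q * D x * b₁.repr z.1 k =
      2 * h q * D x * ∑ k, dd (b₁ k, 0) h q * b₁.repr z.1 k := fun x => by
    rw [Finset.mul_sum]
    exact Finset.sum_congr rfl fun k _ => by ring
  have e3 : ∀ x, ∑ c, (2 * h q * dd (0, b₂ c) h q * D x +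
      h q ^ 2 * dd (0, b₂ x) (dd (b₂ c, 0) fun p => φ₂ p ^ 2) (q.2, z.2)) * b₂.repr z.2 c =
      2 * h q * D x * (∑ c, dd (0, b₂ c) h q * b₂.repr z.2 c) + h q ^ 2 *
        ∑ c, dd (0, b₂ x) (dd (b₂ c, 0) fun p => φ₂ p ^ 2) (q.2, z.2) * b₂.repr z.2 c :=
    fun x => by
      rw [Finset.mul_sum, Finset.mul_sum, ← Finset.sum_add_distrib]
      exact Finset.sum_congr rfl fun k _ => by ring
  simp only [e2, e3, mul_assoc (h q)⁻¹, ← Finset.mul_sum]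
  generalize ∑ k, dd (b₁ k, 0) h q * b₁.repr z.1 k = s₁
  generalize ∑ c, dd (0, b₂ c) h q * b₂.repr z.2 c = s₂
  have e4 : (h q)⁻¹ * (s₂ * b₂.repr z.2 d) + (h q)⁻¹ * (s₁ * b₂.repr z.2 d) =
      ∑ x, (1 / 2) * (h q)⁻¹ * (s₁ + s₂) * (K x * D x) := by
    rw [← Finset.mul_sum, e1]; ring
  have e5 : ∀ A B C E : ℝ, 1 * (A + (B - C)) + E = A + (B + E) - C := fun A B C E => by ring
  rw [e5, e4, Finset.mul_sum, Finset.mul_sum, Finset.sum_mul, ← Finset.sum_add_distrib,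
    ← Finset.sum_sub_distrib]
  refine Finset.sum_congr rfl fun x _ => ?_
  field_simp
  ring

end IsLocalTwist

end TwistedSpray

/-! ### Functions with vanishing third derivatives, and Riemannian sprays -/

section Quadratic

variable {ι E : Type*} [Fintype ι] [DecidableEq ι] [NormedAddCommGroup E] [NormedSpace ℝ E]
  {b : Module.Basis ι ℝ E} {φ : E × E → ℝ} {ψ χ : E → ℝ} {U : Set E} {x y : E}

/-- The third derivatives of `ψ` vanish away from the origin. -/
def IsQuadratic (ψ : E → ℝ) : Prop :=
  ContDiffOn ℝ ∞ ψ {0}ᶜ ∧ ∀ w w' w'' v : E, v ≠ 0 → dd w'' (dd w' (dd w ψ)) v = 0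

namespace IsQuadratic

theorem congr (h : IsQuadratic ψ) (e : Set.EqOn χ ψ {0}ᶜ) : IsQuadratic χ :=
  ⟨h.1.congr e, fun w w' w'' v hv => by
    rw [dd_congr _ isOpen_compl_singleton (dd_congr _ isOpen_compl_singleton
      (dd_congr _ isOpen_compl_singleton e)) hv, h.2 w w' w'' v hv]⟩

/-- Only local constancy of χ is assumed: in dimension one the complement of the origin is
disconnected. In use, χ is an entry of the inverse metric or a combination of such entries. -/
theorem mul_of_dd_eq_zero (h : IsQuadratic ψ) (hχ : ContDiffOn ℝ ∞ χ {0}ᶜ)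
    (h0 : ∀ w v : E, v ≠ 0 → dd w χ v = 0) : IsQuadratic fun v => χ v * ψ v := by
  have key : ∀ {ψ : E → ℝ}, ContDiffOn ℝ ∞ ψ {0}ᶜ → ∀ w,
      Set.EqOn (dd w fun v => χ v * ψ v) (fun v => χ v * dd w ψ v) {0}ᶜ := fun hψ w v hv => by
    rw [dd_mul w (hχ.diffAt isOpen_compl_singleton hv) (hψ.diffAt isOpen_compl_singleton hv),
      h0 w v hv, zero_mul, zero_add]
  refine ⟨hχ.mul h.1, fun w w' w'' v hv => ?_⟩
  have h1 := h.1.dd w isOpen_compl_singleton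
  have h2 := h1.dd w' isOpen_compl_singleton
  rw [dd_congr _ isOpen_compl_singleton ((dd_congr _ isOpen_compl_singleton (key h.1 w)).trans
    (key h1 w')) hv, key h2 w'' hv]
  simp only [h.2 w w' w'' v hv, mul_zero]

theorem const_mul (h : IsQuadratic ψ) (c : ℝ) : IsQuadratic fun v => c * ψ v :=
  h.mul_of_dd_eq_zero (χ := fun _ => c) contDiffOn_const fun w _ _ => by simp

theorem zero : IsQuadratic fun _ : E => (0 : ℝ) := ⟨contDiffOn_const, fun _ _ _ _ _ => by simp⟩

theorem add (h : IsQuadratic ψ) (h' : IsQuadratic χ) : IsQuadratic fun v => ψ v + χ v := by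
  have key : ∀ {ψ χ : E → ℝ}, ContDiffOn ℝ ∞ ψ {0}ᶜ → ContDiffOn ℝ ∞ χ {0}ᶜ → ∀ w,
      Set.EqOn (dd w fun v => ψ v + χ v) (fun v => dd w ψ v + dd w χ v) {0}ᶜ :=
    fun hψ hχ w v hv => dd_add w (hψ.diffAt isOpen_compl_singleton hv)
      (hχ.diffAt isOpen_compl_singleton hv)
  refine ⟨h.1.add h'.1, fun w w' w'' v hv => ?_⟩
  have h1 := h.1.dd w isOpen_compl_singleton
  have h2 := h1.dd w' isOpen_compl_singleton
  have h1' := h'.1.dd w isOpen_compl_singleton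
  have h2' := h1'.dd w' isOpen_compl_singleton
  rw [dd_congr _ isOpen_compl_singleton ((dd_congr _ isOpen_compl_singleton (key h.1 h'.1 w)).trans
    (key h1 h1' w')) hv, key h2 h2' w'' hv]
  simp only [h.2 w w' w'' v hv, h'.2 w w' w'' v hv, add_zero]

theorem sub (h : IsQuadratic ψ) (h' : IsQuadratic χ) : IsQuadratic fun v => ψ v - χ v :=
  (h.add (h'.const_mul (-1))).congr fun v _ => by ring

theorem sum {κ : Type*} (s : Finset κ) {ψ : κ → E → ℝ} (h : ∀ i, IsQuadratic (ψ i)) :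
    IsQuadratic fun v => ∑ i ∈ s, ψ i v := by
  classical
  induction s using Finset.induction_on with
  | empty => simpa using zero
  | insert i s hi ih => simpa only [Finset.sum_insert hi] using (h i).add ih

/-- The product of a linear function and a function with vanishing second derivatives. -/
theorem mul_linear (hψ : ContDiffOn ℝ ∞ ψ {0}ᶜ)
    (h0 : ∀ w w' v : E, v ≠ 0 → dd w' (dd w ψ) v = 0) (L : E →L[ℝ] ℝ) :
    IsQuadratic fun v => ψ v * L v := by
  have hL : ContDiffOn ℝ ∞ (fun v => L v) {0}ᶜ := L.contDiff.contDiffOn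
  have hdL : ∀ w v, dd w (fun v => L v) v = L w := fun w v => by simp [dd]
  refine ⟨hψ.mul hL, fun w w' w'' v hv => ?_⟩
  have hψ1 := fun w => hψ.dd w isOpen_compl_singleton
  have e1 : Set.EqOn (dd w fun v => ψ v * L v) (fun v => dd w ψ v * L v + ψ v * L w) {0}ᶜ :=
    fun v hv => by
      rw [dd_mul w (hψ.diffAt isOpen_compl_singleton hv) (hL.diffAt isOpen_compl_singleton hv), hdL]
  have e2 : Set.EqOn (dd w' fun v => dd w ψ v * L v + ψ v * L w)
      (fun v => dd w ψ v * L w' + dd w' ψ v * L w) {0}ᶜ := fun v hv => by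
    have d1 := (hψ1 w).diffAt isOpen_compl_singleton hv
    have d2 := hψ.diffAt isOpen_compl_singleton hv
    have d3 := hL.diffAt isOpen_compl_singleton hv
    rw [dd_add w' (d1.fun_mul d3) (d2.mul_const (L w)), dd_mul w' d1 d3, hdL, h0 w w' v hv,
      dd_mul w' d2 (differentiableAt_const (L w)), dd_const]
    ring
  have d1 := (hψ1 w).diffAt isOpen_compl_singleton hv
  have d2 := (hψ1 w').diffAt isOpen_compl_singleton hv
  rw [dd_congr _ isOpen_compl_singleton ((dd_congr _ isOpen_compl_singleton e1).trans e2) hv,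
    dd_add w'' (d1.mul_const (L w')) (d2.mul_const (L w)),
    dd_mul w'' d1 (differentiableAt_const (L w')), dd_mul w'' d2 (differentiableAt_const (L w)),
    h0 w w'' v hv, h0 w' w'' v hv, dd_const, dd_const]
  ring

theorem mul_repr (b : Module.Basis ι ℝ E) (hψ : ContDiffOn ℝ ∞ ψ {0}ᶜ)
    (h0 : ∀ w w' v : E, v ≠ 0 → dd w' (dd w ψ) v = 0) (i : ι) :
    IsQuadratic fun v => ψ v * b.repr v i := by
  have := b.finiteDimensional_of_finite
  exact mul_linear hψ h0 (b.coord i).toContinuousLinearMap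

theorem repr_mul_repr (b : Module.Basis ι ℝ E) (i j : ι) :
    IsQuadratic fun v => b.repr v i * b.repr v j := by
  refine mul_repr b (smooth_repr b i).contDiffOn (fun w w' v _ => ?_) j
  have := b.finiteDimensional_of_finite
  have h1 : dd w (fun v => b.repr v i) = fun _ => b.repr w i := by
    ext v
    have : (fun z => b.repr z i) = (b.coord i).toContinuousLinearMap := rfl
    simp only [dd, this, ContinuousLinearMap.fderiv]
    rfl
  rw [h1, dd_const]

/-- The quadratic form of a bilinear form is quadratic. -/
theorem of_bilin (b : Module.Basis ι ℝ E) (B : E →ₗ[ℝ] E →ₗ[ℝ] ℝ) : IsQuadratic fun v => B v v := by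
  refine (sum Finset.univ fun i => sum Finset.univ fun j =>
    (repr_mul_repr b i j).const_mul (B (b i) (b j))).congr fun v _ => ?_
  conv_lhs => rw [← b.sum_repr v]
  simp only [map_sum, map_smul, LinearMap.sum_apply, LinearMap.smul_apply, smul_eq_mul,
    Finset.mul_sum]
  rw [Finset.sum_comm]
  exact Finset.sum_congr rfl fun i _ => Finset.sum_congr rfl fun j _ => by ring

variable {N : E → ℝ}

theorem dd_hess (h : IsQuadratic N) (hy : y ≠ 0) (w : E) (i j : ι) :
    dd w (fun q => hess b N q i j) y = 0 :=
  (h.const_mul (1 / 2)).2 (b i) (b j) w y hy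

theorem meanTorsion_eq_zero (h : IsQuadratic N) (hy : y ≠ 0) (i : ι) :
    meanTorsion b N i y = 0 := by
  simp [meanTorsion, h.dd_hess hy]

theorem dd_hessInv (h : IsQuadratic N) (hM : IsMinkowskiSq b N) (hy : y ≠ 0) (w : E) (i j : ι) :
    dd w (fun q => hessInv b N q i j) y = 0 := by
  have h1 := congrFun (congrFun (dd_inv isOpen_compl_singleton hM.smooth_hess
    (fun _ hz => hM.det_ne_zero hz) hy w) i) j
  have h2 : (Matrix.of fun i j => dd w (fun y => hess b N y i j) y) = 0 := by
    ext i j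
    exact h.dd_hess hy w i j
  rw [h2] at h1
  simpa using! h1

/-- For quadratic N the inverse metric is locally constant, so every term added by the twist is a
quadratic polynomial up to locally constant factors. -/
theorem twistSprayVert (h : IsQuadratic N) (hM : IsMinkowskiSq b N) {c : ℝ} {q : ι → ℝ}
    {G : ι → E → ℝ} (hG : ∀ d, IsQuadratic (G d)) (d : ι) :
    IsQuadratic (twistSprayVert b N c q G d) := by
  refine (hG d).add (IsQuadratic.sub ?_ ?_)
  · simp only [Finset.sum_mul, mul_assoc]
    exact sum _ fun k => (((repr_mul_repr b k d).const_mul (q k)).const_mul c⁻¹)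
  · refine h.mul_of_dd_eq_zero (ContDiffOn.sum fun e _ => contDiffOn_const.mul (hM.smooth_inv d e))
      fun w v hv => ?_
    rw [dd_sum_const_mul isOpen_compl_singleton (hM.smooth_inv d)
      (fun e => 1 / 2 * c⁻¹ * q e) w hv]
    simp [h.dd_hessInv hM hv]

theorem landsbergTrace_eq_zero {G : ι → E → ℝ} (hG : ∀ d, IsQuadratic (G d)) (hy : y ≠ 0) (i : ι) :
    landsbergTrace b N G i y = 0 := by
  have h1 : ∀ d j k, dd (b k) (dd (b j) (dd (b i) (G d))) y = 0 := fun d j k =>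
    (hG d).2 (b i) (b j) (b k) y hy
  simp only [landsbergTrace, h1, mul_zero, Finset.sum_const_zero, zero_mul]

end IsQuadratic

/-- The spray coefficients of a Riemannian metric are quadratic. -/
theorem IsLocalFinsler.isQuadratic_spray (h : IsLocalFinsler b φ U)
    (hq : ∀ x ∈ U, IsQuadratic fun y => φ (x, y) ^ 2) (hx : x ∈ U) (l : ι) :
    IsQuadratic fun y => spray b φ l (x, y) := by
  have o := h.isOpen.prod (isOpen_compl_singleton (x := (0 : E)))
  set N : E × E → ℝ := fun p => φ p ^ 2 with hN
  have hs : ContDiffOn ℝ ∞ N (U ×ˢ {0}ᶜ) := h.smooth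
  have t0 : ∀ w w' w'', Set.EqOn (dd (0, w'') (dd (0, w') (dd (0, w) N))) (fun _ => 0)
      (U ×ˢ {0}ᶜ) := by
    rintro w w' w'' ⟨x, y⟩ ⟨hx, hy⟩
    rw [show (fun _ : E × E => (0 : ℝ)) (x, y) = 0 from rfl, ← (hq x hx).2 w w' w'' y hy]
    exact dd_three_slice_eqOn h.isOpen isOpen_compl_singleton hs hx w w' w'' hy
  -- The horizontal derivative commutes past the three vertical ones, which annihilate N over all of
  -- U. This is why quadraticity is required over a whole chart and not at one point.
  have t1 : ∀ k w w' w'', Set.EqOn (dd (0, w'') (dd (0, w') (dd (0, w) (dd (b k, 0) N))))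
      (fun _ => 0) (U ×ˢ {0}ᶜ) := by
    intro k w w' w'' p hp
    rw [dd_congr _ o (dd_congr _ o (dd_comm _ _ o hs)) hp,
      dd_congr _ o (dd_comm _ _ o (hs.dd _ o)) hp, dd_comm _ _ o ((hs.dd _ o).dd _ o) hp,
      dd_congr _ o (t0 w w' w'') hp, dd_const]
  have hM := h.isMinkowskiSq hx
  have hinv : Set.EqOn (fun y => spray b φ l (x, y)) (fun y => (1 / 4) * ∑ j,
      hessInv b (fun y => φ (x, y) ^ 2) y l j * ((∑ k, dd (0, b j) (dd (b k, 0) N) (x, y) *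
        b.repr y k) - dd (b j, 0) N (x, y))) {0}ᶜ := fun y hy => by
    simp only [spray, h.fundamentalInv_eq hx hy, dx_eq_dd, dy_eq_dd]
    rfl
  refine IsQuadratic.congr (IsQuadratic.const_mul (IsQuadratic.sum _ fun j =>
    IsQuadratic.mul_of_dd_eq_zero ?_ (hM.smooth_inv l j) fun w v hv =>
      (hq x hx).dd_hessInv hM hv w l j) _) hinv
  refine IsQuadratic.sub (IsQuadratic.sum _ fun k => IsQuadratic.mul_repr b
    (((hs.dd _ o).dd _ o).slice hx) (fun w w' v hv => ?_) k)
    ⟨(hs.dd _ o).slice hx, fun w w' w'' v hv => ?_⟩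
  · rw [← dd_two_slice_eqOn h.isOpen isOpen_compl_singleton ((hs.dd _ o).dd _ o) hx w w' hv]
    exact t1 k _ w w' ⟨hx, hv⟩
  · rw [← dd_three_slice_eqOn h.isOpen isOpen_compl_singleton (hs.dd _ o) hx w w' w'' hv]
    exact t1 j w w' w'' ⟨hx, hv⟩

end Quadratic

/-! ### The equivalence in local coordinates -/

section LocalTheorem

variable {ι₁ ι₂ E₁ E₂ : Type*} [Fintype ι₁] [DecidableEq ι₁] [Fintype ι₂] [DecidableEq ι₂]
  [NormedAddCommGroup E₁] [NormedSpace ℝ E₁] [NormedAddCommGroup E₂] [NormedSpace ℝ E₂]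
  {b₁ : Module.Basis ι₁ ℝ E₁} {b₂ : Module.Basis ι₂ ℝ E₂}
  {φ₁ : E₁ × E₁ → ℝ} {φ₂ : E₂ × E₂ → ℝ} {U₁ : Set E₁} {U₂ : Set E₂} {h : E₁ × E₂ → ℝ}
  {φ : (E₁ × E₂) × (E₁ × E₂) → ℝ} {q : E₁ × E₂} {y : E₁} {v : E₂}

/-- By Euler's identity the radial derivative of N is 2N > 0. -/
theorem IsMinkowskiSq.exists_dd_ne_zero {ι E : Type*} [Fintype ι] [DecidableEq ι]
    [NormedAddCommGroup E] [NormedSpace ℝ E] {b : Module.Basis ι ℝ E} {N : E → ℝ}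
    (h : IsMinkowskiSq b N) {y : E} (hy : y ≠ 0) : ∃ i, dd (b i) N y ≠ 0 := by
  by_contra! h0
  have h1 := h.sum_lower_repr hy
  have h2 := h.pos hy
  simp only [dd_const_mul, h0, mul_zero, zero_mul, Finset.sum_const_zero] at h1
  linarith

/-- I^m = -(1/2) ∂_k g^{km} is a first derivative of 0-homogeneous functions. -/
theorem IsMinkowskiSq.meanTorsionUp_homog {ι E : Type*} [Fintype ι] [DecidableEq ι]
    [NormedAddCommGroup E] [NormedSpace ℝ E] {b : Module.Basis ι ℝ E} {N : E → ℝ}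
    (h : IsMinkowskiSq b N) {y : E} (hy : y ≠ 0) {c : ℝ} (hc : 0 < c) (m : ι) :
    meanTorsionUp b N m (c • y) = c⁻¹ * meanTorsionUp b N m y := by
  have h1 := h.sum_dd_inv hy m
  have h2 := h.sum_dd_inv (smul_ne_zero hc.ne' hy) m
  simp only [h.dd_inv_homog hy hc, ← Finset.mul_sum, h1] at h2
  linarith

namespace IsLocalTwist

theorem meanLandsberg_inl (H : IsLocalTwist b₁ b₂ φ₁ φ₂ U₁ U₂ h φ) (hq : q ∈ U₁ ×ˢ U₂)
    (hy : y ≠ 0) (hv : v ≠ 0) (i : ι₁) :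
    meanLandsberg (b₁.prod b₂) φ (Sum.inl i) (q, (y, v)) = meanLandsberg b₁ φ₁ i (q.1, y) +
      (1 / 4) * h q * φ₂ (q.2, v) ^ 2 * ∑ m, dd (b₁ m, 0) h q *
        (4 * dd (b₁ i) (meanTorsionUp b₁ (fun y => φ₁ (q.1, y) ^ 2) m) y -
          2 * ∑ l, meanTorsion b₁ (fun y => φ₁ (q.1, y) ^ 2) l y *
            dd (b₁ i) (fun z => hessInv b₁ (fun y => φ₁ (q.1, y) ^ 2) z l m) y) := by
  rw [H.meanLandsberg_eq hq (z := (y, v)) ⟨hy, hv⟩, H.left.meanLandsberg_eq hq.1 hy]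
  exact landsbergTrace_twist_inl (H.left.isMinkowskiSq hq.1) (H.right.isMinkowskiSq hq.2)
    (H.pos q hq).ne' (fun l => (H.left.smooth_spray l).slice hq.1)
    (fun l => (H.right.smooth_spray l).slice hq.2) (H.spray_inl hq) (H.spray_inr hq) hy hv i

theorem meanLandsberg_inr (H : IsLocalTwist b₁ b₂ φ₁ φ₂ U₁ U₂ h φ) (hq : q ∈ U₁ ×ˢ U₂)
    (hy : y ≠ 0) (hv : v ≠ 0) (i : ι₂) :
    meanLandsberg (b₁.prod b₂) φ (Sum.inr i) (q, (y, v)) =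
      (1 / 2) * h q * dd (b₂ i) (fun v => φ₂ (q.2, v) ^ 2) v *
        (∑ m, meanTorsionUp b₁ (fun y => φ₁ (q.1, y) ^ 2) m y * dd (b₁ m, 0) h q) +
        (h q)⁻¹ * (∑ m, dd (b₁ m, 0) h q * b₁.repr y m) *
          meanTorsion b₂ (fun v => φ₂ (q.2, v) ^ 2) i v +
          landsbergTrace b₂ (fun v => φ₂ (q.2, v) ^ 2) (twistSprayVert b₂
            (fun v => φ₂ (q.2, v) ^ 2) (h q) (fun c => dd (0, b₂ c) h q)
            (fun d v => spray b₂ φ₂ d (q.2, v))) i v := by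
  rw [H.meanLandsberg_eq hq (z := (y, v)) ⟨hy, hv⟩]
  exact landsbergTrace_twist_inr (H.left.isMinkowskiSq hq.1) (H.right.isMinkowskiSq hq.2)
    (H.pos q hq).ne' (fun l => (H.left.smooth_spray l).slice hq.1)
    (fun l => (H.right.smooth_spray l).slice hq.2) (H.spray_inl hq) (H.spray_inr hq) hy hv i

/-- If the twisted product is weakly Landsberg, then so is the first factor. -/
theorem meanLandsberg_left [Nontrivial E₂] (H : IsLocalTwist b₁ b₂ φ₁ φ₂ U₁ U₂ h φ)
    (hq : q ∈ U₁ ×ˢ U₂) (hJ : ∀ z ∈ slit₂ E₁ E₂, ∀ α, meanLandsberg (b₁.prod b₂) φ α (q, z) = 0)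
    (hy : y ≠ 0) (i : ι₁) : meanLandsberg b₁ φ₁ i (q.1, y) = 0 := by
  obtain ⟨v, hv⟩ := exists_ne (0 : E₂)
  have hv2 : (2 : ℝ) • v ≠ 0 := smul_ne_zero two_ne_zero hv
  -- Between v and 2v the twist term is multiplied by 4 and the curvature of the first factor is
  -- unchanged, so both vanish.
  have h1 := H.meanLandsberg_inl hq hy hv i
  have h2 := H.meanLandsberg_inl hq hy hv2 i
  rw [hJ (y, v) ⟨hy, hv⟩] at h1
  rw [hJ (y, _) ⟨hy, hv2⟩, H.right.homog q.2 hq.2 2 two_pos] at h2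
  linarith

/-- Comparison of the components of the mean Landsberg curvature at `y`, `2 y` and `y / 2`. -/
theorem twist_mean_eq_zero (H : IsLocalTwist b₁ b₂ φ₁ φ₂ U₁ U₂ h φ)
    (hq : q ∈ U₁ ×ˢ U₂) (hJ : ∀ z ∈ slit₂ E₁ E₂, ∀ α, meanLandsberg (b₁.prod b₂) φ α (q, z) = 0)
    (hy : y ≠ 0) (hv : v ≠ 0) (i : ι₂) :
    dd (b₂ i) (fun v => φ₂ (q.2, v) ^ 2) v *
        (∑ m, meanTorsionUp b₁ (fun y => φ₁ (q.1, y) ^ 2) m y * dd (b₁ m, 0) h q) = 0 ∧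
      (∑ m, dd (b₁ m, 0) h q * b₁.repr y m) *
        meanTorsion b₂ (fun v => φ₂ (q.2, v) ^ 2) i v = 0 := by
  have hM := H.left.isMinkowskiSq hq.1
  have hh := H.pos q hq
  have key : ∀ c : ℝ, 0 < c → (1 / 2) * h q * (dd (b₂ i) (fun v => φ₂ (q.2, v) ^ 2) v *
        (∑ m, meanTorsionUp b₁ (fun y => φ₁ (q.1, y) ^ 2) m y * dd (b₁ m, 0) h q)) * c⁻¹ +
        (h q)⁻¹ * ((∑ m, dd (b₁ m, 0) h q * b₁.repr y m) *
          meanTorsion b₂ (fun v => φ₂ (q.2, v) ^ 2) i v) * c +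
          landsbergTrace b₂ (fun v => φ₂ (q.2, v) ^ 2) (twistSprayVert b₂
            (fun v => φ₂ (q.2, v) ^ 2) (h q) (fun c => dd (0, b₂ c) h q)
            (fun d v => spray b₂ φ₂ d (q.2, v))) i v = 0 := by
    intro c hc
    have hcy : c • y ≠ 0 := smul_ne_zero hc.ne' hy
    rw [← hJ (c • y, v) ⟨hcy, hv⟩ (Sum.inr i), H.meanLandsberg_inr hq hcy hv i]
    have e1 : ∑ m, meanTorsionUp b₁ (fun y => φ₁ (q.1, y) ^ 2) m (c • y) * dd (b₁ m, 0) h q =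
        c⁻¹ * ∑ m, meanTorsionUp b₁ (fun y => φ₁ (q.1, y) ^ 2) m y * dd (b₁ m, 0) h q := by
      rw [Finset.mul_sum]
      exact Finset.sum_congr rfl fun m _ => by rw [hM.meanTorsionUp_homog hy hc]; ring
    have e2 : ∑ m, dd (b₁ m, 0) h q * b₁.repr (c • y) m =
        c * ∑ m, dd (b₁ m, 0) h q * b₁.repr y m := by
      rw [Finset.mul_sum]
      exact Finset.sum_congr rfl fun m _ => by simp; ring
    rw [e1, e2]
    ring
  -- The functions c⁻¹, c and 1 are independent, and the three values 1, 2 and 1/2 separate them.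
  have k1 := key 1 one_pos
  have k2 := key 2 two_pos
  have k3 := key 2⁻¹ (by norm_num)
  norm_num at k1 k2 k3
  generalize dd (b₂ i) (fun v => φ₂ (q.2, v) ^ 2) v *
    (∑ m, meanTorsionUp b₁ (fun y => φ₁ (q.1, y) ^ 2) m y * dd (b₁ m, 0) h q) = A at *
  generalize (∑ m, dd (b₁ m, 0) h q * b₁.repr y m) *
    meanTorsion b₂ (fun v => φ₂ (q.2, v) ^ 2) i v = B at *
  have hA : h q * A = 0 := by linarith
  have hB : (h q)⁻¹ * B = 0 := by linarith
  exact ⟨(mul_eq_zero.1 hA).resolve_left hh.ne', (mul_eq_zero.1 hB).resolve_left (inv_pos.2 hh).ne'⟩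

theorem twist_equation [Nontrivial E₂] (H : IsLocalTwist b₁ b₂ φ₁ φ₂ U₁ U₂ h φ)
    (hq : q ∈ U₁ ×ˢ U₂) (hJ : ∀ z ∈ slit₂ E₁ E₂, ∀ α, meanLandsberg (b₁.prod b₂) φ α (q, z) = 0)
    (hy : y ≠ 0) : ∑ m, meanCartanUp b₁ φ₁ m (q.1, y) * dd (b₁ m, 0) h q = 0 := by
  obtain ⟨v, hv⟩ := exists_ne (0 : E₂)
  obtain ⟨i, hi⟩ := (H.right.isMinkowskiSq hq.2).exists_dd_ne_zero hv
  simp only [H.left.meanCartanUp_eq hq.1 hy]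
  exact (mul_eq_zero.1 (H.twist_mean_eq_zero hq hJ hy hv i).1).resolve_left hi

theorem meanCartan_right (H : IsLocalTwist b₁ b₂ φ₁ φ₂ U₁ U₂ h φ)
    (hq : q ∈ U₁ ×ˢ U₂) (hJ : ∀ z ∈ slit₂ E₁ E₂, ∀ α, meanLandsberg (b₁.prod b₂) φ α (q, z) = 0)
    {m : ι₁} (hm : dd (b₁ m, 0) h q ≠ 0) (hv : v ≠ 0) (i : ι₂) :
    meanCartan b₂ φ₂ i (q.2, v) = 0 := by
  rw [H.right.meanCartan_eq hq.2 hv]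
  -- For y equal to the m-th basis vector the factor p·y is p_m, nonzero by assumption.
  have h1 := (H.twist_mean_eq_zero hq hJ (b₁.ne_zero m) hv i).2
  refine (mul_eq_zero.1 h1).resolve_left ?_
  simpa [Finsupp.single_apply] using hm

/-- The sufficient conditions for a twisted product to be weakly Landsberg. -/
theorem meanLandsberg_eq_zero (H : IsLocalTwist b₁ b₂ φ₁ φ₂ U₁ U₂ h φ) (hq : q ∈ U₁ ×ˢ U₂)
    (hL : ∀ y, y ≠ 0 → ∀ i, meanLandsberg b₁ φ₁ i (q.1, y) = 0)
    (hR : ∀ u ∈ U₂, IsQuadratic fun v => φ₂ (u, v) ^ 2)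
    (hI : ∀ y, y ≠ 0 → ∑ m, meanCartanUp b₁ φ₁ m (q.1, y) * dd (b₁ m, 0) h q = 0)
    (hy : y ≠ 0) (hv : v ≠ 0) (α : ι₁ ⊕ ι₂) :
    meanLandsberg (b₁.prod b₂) φ α (q, (y, v)) = 0 := by
  have hM := H.left.isMinkowskiSq hq.1
  have hI' : ∀ y, y ≠ 0 → ∑ m, meanTorsionUp b₁ (fun y => φ₁ (q.1, y) ^ 2) m y *
      dd (b₁ m, 0) h q = 0 := fun y hy => by
    have := hI y hy
    simpa only [H.left.meanCartanUp_eq hq.1 hy] using this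
  cases α with
  | inl i =>
    rw [H.meanLandsberg_inl hq hy hv, hL y hy i, zero_add]
    -- Where p = 0 the twist term is absent. Where p ≠ 0 the twist equation by itself controls only
    -- ∂_i(I^m p_m); rigidity gives I = 0 on the whole fibre and removes the remaining term as well.
    by_cases hp : (fun m => dd (b₁ m, 0) h q) = 0
    · have hp' : ∀ m, dd (b₁ m, 0) h q = 0 := congrFun hp
      simp [hp']
    · have hI0 : ∀ y, y ≠ 0 → ∀ l, meanTorsion b₁ (fun y => φ₁ (q.1, y) ^ 2) l y = 0 :=
        fun y hy l => hM.meanTorsion_eq_zero_of_annihilates hp hI' hy l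
      have hU : ∀ m, dd (b₁ i) (meanTorsionUp b₁ (fun y => φ₁ (q.1, y) ^ 2) m) y = 0 := fun m => by
        have : Set.EqOn (meanTorsionUp b₁ (fun y => φ₁ (q.1, y) ^ 2) m) (fun _ => 0) {0}ᶜ :=
          fun z hz => by simp [meanTorsionUp, hI0 z hz]
        rw [dd_congr _ isOpen_compl_singleton this hy, dd_const]
      simp [hU, hI0 y hy]
  | inr i =>
    rw [H.meanLandsberg_inr hq hy hv, hI' y hy, (hR q.2 hq.2).meanTorsion_eq_zero hv,
      IsQuadratic.landsbergTrace_eq_zero (fun d => (hR q.2 hq.2).twistSprayVert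
        (H.right.isMinkowskiSq hq.2) (fun d => H.right.isQuadratic_spray hR hq.2 d) d) hv]
    ring

end IsLocalTwist

end LocalTheorem

/-! ### Induced coordinates on the tangent bundle -/

section Charts

variable {E H M : Type*} [NormedAddCommGroup E] [NormedSpace ℝ E] [TopologicalSpace H]
  [TopologicalSpace M] [ChartedSpace H M] {I : ModelWithCorners ℝ E H} [I.Boundaryless]
  [IsManifold I ∞ M] {e : OpenPartialHomeomorph M H} {x : E} {z : M} {F : TangentBundle I M → ℝ}

theorem mem_maximalAtlas_of_mem_atlas (he : e ∈ atlas H M) :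
    e ∈ IsManifold.maximalAtlas I ∞ M :=
  IsManifold.subset_maximalAtlas he

theorem contMDiffOn_extend_symm_target (he : e ∈ atlas H M) :
    ContMDiffOn 𝓘(ℝ, E) I ∞ (e.extend I).symm (e.extend I).target := by
  rw [e.extend_target']
  exact contMDiffOn_extend_symm (mem_maximalAtlas_of_mem_atlas he)

theorem mdifferentiableAt_extend_symm (he : e ∈ atlas H M) (hx : x ∈ (e.extend I).target) :
    MDifferentiableAt 𝓘(ℝ, E) I (e.extend I).symm x :=
  ((contMDiffOn_extend_symm_target he).contMDiffAt
    (e.isOpen_extend_target.mem_nhds hx)).mdifferentiableAt (by simp)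

theorem mdifferentiableAt_extend (he : e ∈ atlas H M) (hz : z ∈ e.source) :
    MDifferentiableAt I 𝓘(ℝ, E) (e.extend I) z :=
  (e.contMDiffAt_extend (mem_maximalAtlas_of_mem_atlas he) hz).mdifferentiableAt
    (n := ∞) (by simp)

theorem extend_symm_mem_source (hx : x ∈ (e.extend I).target) :
    (e.extend I).symm x ∈ e.source := by
  have := (e.extend I).map_target hx
  rwa [e.extend_source] at this

theorem tangentMap_eq_self {g : M → M} {p : TangentBundle I M} (h : g =ᶠ[nhds p.1] id) :
    tangentMap I I g p = p := by
  refine Bundle.TotalSpace.ext h.eq_of_nhds (heq_of_eq (a := (_ : E)) ?_)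
  have h1 : mfderiv I I g p.1 = mfderiv I I id p.1 := h.mfderiv_eq
  have h2 : (tangentMap I I g p).2 = mfderiv I I id p.1 p.2 := by
    rw [← h1]
    rfl
  rw [h2, mfderiv_id]
  rfl

theorem tangentMap_extend_ofCoord (he : e ∈ atlas H M) (hx : x ∈ (e.extend I).target) (y : E) :
    tangentMap I 𝓘(ℝ, E) (e.extend I) (ofCoord I e (x, y)) = ⟨x, y⟩ := by
  rw [ofCoord, ← tangentMap_comp_at _ (mdifferentiableAt_extend he (extend_symm_mem_source hx))
    (mdifferentiableAt_extend_symm he hx)]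
  exact tangentMap_eq_self (Filter.eventuallyEq_of_mem (e.isOpen_extend_target.mem_nhds hx)
    fun z hz => (e.extend I).right_inv hz)

theorem ofCoord_tangentMap_extend (he : e ∈ atlas H M) (p : TangentBundle I M)
    (hp : p.1 ∈ e.source) :
    ofCoord I e ((tangentMap I 𝓘(ℝ, E) (e.extend I) p).1,
      (tangentMap I 𝓘(ℝ, E) (e.extend I) p).2) = p := by
  have hp' : p.1 ∈ (e.extend I).source := by rwa [e.extend_source]
  have h0 : ofCoord I e ((tangentMap I 𝓘(ℝ, E) (e.extend I) p).1,
      (tangentMap I 𝓘(ℝ, E) (e.extend I) p).2) =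
      tangentMap 𝓘(ℝ, E) I (e.extend I).symm (tangentMap I 𝓘(ℝ, E) (e.extend I) p) := rfl
  rw [h0, ← tangentMap_comp_at _ (mdifferentiableAt_extend_symm he ((e.extend I).map_source hp'))
    (mdifferentiableAt_extend he hp)]
  exact tangentMap_eq_self (Filter.eventuallyEq_of_mem (e.open_source.mem_nhds hp)
    fun z hz => (e.extend I).left_inv (by rwa [e.extend_source]))

theorem ofCoord_mem_slit (he : e ∈ atlas H M) (hx : x ∈ (e.extend I).target) {y : E} :
    ofCoord I e (x, y) ∈ slit I M ↔ y ≠ 0 := by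
  refine not_congr ⟨fun h => ?_, fun h => ?_⟩
  · have h1 := tangentMap_extend_ofCoord he hx y
    have h2 : (tangentMap I 𝓘(ℝ, E) (e.extend I) (ofCoord I e (x, y))).2 = 0 := by
      rw [tangentMap_snd, h]
      exact map_zero (mfderiv I 𝓘(ℝ, E) (e.extend I) _)
    rw [h1] at h2
    exact h2
  · subst h
    exact map_zero (mfderiv 𝓘(ℝ, E) I (e.extend I).symm x)

theorem ofCoord_smul (c : ℝ) (y : E) :
    ofCoord I e (x, c • y) = ⟨(ofCoord I e (x, y)).1, c • (ofCoord I e (x, y)).2⟩ := by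
  have : ofCoord I e (x, c • y) = ⟨(e.extend I).symm x, mfderiv 𝓘(ℝ, E) I (e.extend I).symm x
    (c • (show TangentSpace 𝓘(ℝ, E) x from y))⟩ := rfl
  rw [this, map_smul]
  rfl

/-- The parametrization is the tangent map of the inverse chart, precomposed with the identification
of E × E with the tangent bundle of E. -/
theorem contMDiffOn_ofCoord (he : e ∈ atlas H M) :
    ContMDiffOn 𝓘(ℝ, E × E) I.tangent ∞ (ofCoord I e) {p | p.1 ∈ (e.extend I).target} := by
  have := IsManifold.of_le (I := I) (M := M) (n := ∞) (m := 1) (by simp)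
  have hU := e.isOpen_extend_target (I := I)
  have h1 := (contMDiffOn_extend_symm_target he).contMDiffOn_tangentMapWithin (m := ∞) (by simp)
    hU.uniqueMDiffOn
  have h2 : ContMDiff 𝓘(ℝ, E × E) 𝓘(ℝ, E).tangent ∞
      (fun p : E × E => (⟨p.1, p.2⟩ : TangentBundle 𝓘(ℝ, E) E)) := by
    rw [modelWithCornersSelf_prod]
    exact contMDiff_tangentBundleModelSpaceHomeomorph_symm
  have h3 := h1.comp (h2.contMDiffOn (s := {p : E × E | p.1 ∈ (e.extend I).target})) fun p hp => hp
  refine h3.congr fun p hp => ?_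
  exact (tangentMapWithin_eq_tangentMap (p := (⟨p.1, p.2⟩ : TangentBundle 𝓘(ℝ, E) E))
    (hU.uniqueMDiffOn p.1 hp) (mdifferentiableAt_extend_symm he hp)).symm

theorem contDiffOn_coordRep (he : e ∈ atlas H M)
    (hF : ContMDiffOn I.tangent 𝓘(ℝ, ℝ) ∞ F (slit I M)) :
    ContDiffOn ℝ ∞ (coordRep I e F) ((e.extend I).target ×ˢ {0}ᶜ) := by
  rw [← contMDiffOn_iff_contDiffOn]
  have h1 : ContMDiffOn 𝓘(ℝ, E × E) I.tangent ∞ (ofCoord I e) ((e.extend I).target ×ˢ {0}ᶜ) :=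
    (contMDiffOn_ofCoord he).mono fun p hp => hp.1
  exact hF.comp h1 fun p hp => (ofCoord_mem_slit he hp.1).2 hp.2

end Charts

/-! ### Product charts -/

section ProductCharts

variable {E₁ H₁ M₁ E₂ H₂ M₂ : Type*} [NormedAddCommGroup E₁] [NormedSpace ℝ E₁]
  [TopologicalSpace H₁] [TopologicalSpace M₁] [ChartedSpace H₁ M₁] {I₁ : ModelWithCorners ℝ E₁ H₁}
  [I₁.Boundaryless] [IsManifold I₁ ∞ M₁] [NormedAddCommGroup E₂] [NormedSpace ℝ E₂]
  [TopologicalSpace H₂] [TopologicalSpace M₂] [ChartedSpace H₂ M₂] {I₂ : ModelWithCorners ℝ E₂ H₂}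
  [I₂.Boundaryless] [IsManifold I₂ ∞ M₂] {e₁ : OpenPartialHomeomorph M₁ H₁}
  {e₂ : OpenPartialHomeomorph M₂ H₂} {q : E₁ × E₂} {f : M₁ × M₂ → ℝ}

theorem prod_mem_atlas (he₁ : e₁ ∈ atlas H₁ M₁) (he₂ : e₂ ∈ atlas H₂ M₂) :
    e₁.prod e₂ ∈ atlas (ModelProd H₁ H₂) (M₁ × M₂) :=
  Set.mem_image2_of_mem he₁ he₂

theorem extend_prod_target :
    ((e₁.prod e₂).extend (I₁.prod I₂)).target = (e₁.extend I₁).target ×ˢ (e₂.extend I₂).target := by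
  rw [e₁.extend_prod e₂, PartialEquiv.prod_target]

theorem tangentMap_fst_ofCoord (he₁ : e₁ ∈ atlas H₁ M₁) (he₂ : e₂ ∈ atlas H₂ M₂)
    (hq : q ∈ (e₁.extend I₁).target ×ˢ (e₂.extend I₂).target) (z : E₁ × E₂) :
    tangentMap (I₁.prod I₂) I₁ Prod.fst (ofCoord (I₁.prod I₂) (e₁.prod e₂) (q, z)) =
      ofCoord I₁ e₁ (q.1, z.1) := by
  have hd := mdifferentiableAt_extend_symm (I := I₁.prod I₂) (prod_mem_atlas he₁ he₂)
    (by rwa [extend_prod_target])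
  rw [ofCoord, ← tangentMap_comp_at _ mdifferentiableAt_fst hd]
  -- Projection after the inverse product chart is the inverse chart of the factor after the linear
  -- projection; the chain rule on both sides gives the claim.
  have h1 : Prod.fst ∘ ((e₁.prod e₂).extend (I₁.prod I₂)).symm =
      (e₁.extend I₁).symm ∘ (ContinuousLinearMap.fst ℝ E₁ E₂) := by
    rw [e₁.extend_prod e₂]
    rfl
  rw [h1, tangentMap_comp_at _ (mdifferentiableAt_extend_symm he₁ hq.1)
    (ContinuousLinearMap.mdifferentiableAt _), ofCoord]
  congr 1
  simp only [tangentMap, ContinuousLinearMap.mfderiv_eq]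
  rfl

theorem tangentMap_snd_ofCoord (he₁ : e₁ ∈ atlas H₁ M₁) (he₂ : e₂ ∈ atlas H₂ M₂)
    (hq : q ∈ (e₁.extend I₁).target ×ˢ (e₂.extend I₂).target) (z : E₁ × E₂) :
    tangentMap (I₁.prod I₂) I₂ Prod.snd (ofCoord (I₁.prod I₂) (e₁.prod e₂) (q, z)) =
      ofCoord I₂ e₂ (q.2, z.2) := by
  have hd := mdifferentiableAt_extend_symm (I := I₁.prod I₂) (prod_mem_atlas he₁ he₂)
    (by rwa [extend_prod_target])
  rw [ofCoord, ← tangentMap_comp_at _ mdifferentiableAt_snd hd]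
  have h1 : Prod.snd ∘ ((e₁.prod e₂).extend (I₁.prod I₂)).symm =
      (e₂.extend I₂).symm ∘ (ContinuousLinearMap.snd ℝ E₁ E₂) := by
    rw [e₁.extend_prod e₂]
    rfl
  rw [h1, tangentMap_comp_at _ (mdifferentiableAt_extend_symm he₂ hq.2)
    (ContinuousLinearMap.mdifferentiableAt _), ofCoord]
  congr 1
  simp only [tangentMap, ContinuousLinearMap.mfderiv_eq]
  rfl

/-- The expression of a function on a product manifold in the coordinates of a product chart. -/
def prodRep (I₁ : ModelWithCorners ℝ E₁ H₁) (I₂ : ModelWithCorners ℝ E₂ H₂)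
    (e₁ : OpenPartialHomeomorph M₁ H₁) (e₂ : OpenPartialHomeomorph M₂ H₂) (f : M₁ × M₂ → ℝ)
    (q : E₁ × E₂) : ℝ :=
  f ((e₁.extend I₁).symm q.1, (e₂.extend I₂).symm q.2)

theorem contDiffOn_prodRep (he₁ : e₁ ∈ atlas H₁ M₁) (he₂ : e₂ ∈ atlas H₂ M₂)
    (hf : ContMDiff (I₁.prod I₂) 𝓘(ℝ, ℝ) ∞ f) :
    ContDiffOn ℝ ∞ (prodRep I₁ I₂ e₁ e₂ f) ((e₁.extend I₁).target ×ˢ (e₂.extend I₂).target) := by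
  have h1 := contMDiffOn_extend_symm_target (I := I₁.prod I₂) (prod_mem_atlas he₁ he₂)
  rw [extend_prod_target] at h1
  rw [← contMDiffOn_iff_contDiffOn]
  refine (hf.comp_contMDiffOn h1).congr fun q _ => ?_
  rw [e₁.extend_prod e₂]
  rfl

theorem dd_prodRep (he₁ : e₁ ∈ atlas H₁ M₁) (he₂ : e₂ ∈ atlas H₂ M₂)
    (hf : ContMDiff (I₁.prod I₂) 𝓘(ℝ, ℝ) ∞ f)
    (hq : q ∈ (e₁.extend I₁).target ×ˢ (e₂.extend I₂).target) (w : E₁) :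
    dd (w, 0) (prodRep I₁ I₂ e₁ e₂ f) q =
      fderiv ℝ (fun u => f ((e₁.extend I₁).symm u, (e₂.extend I₂).symm q.2)) q.1 w := by
  have h1 := (contDiffOn_prodRep he₁ he₂ hf).diffAt
    (e₁.isOpen_extend_target.prod e₂.isOpen_extend_target) hq
  have h2 : HasFDerivAt (fun u : E₁ => (u, q.2)) (ContinuousLinearMap.inl ℝ E₁ E₂) q.1 :=
    (hasFDerivAt_id q.1).prodMk (hasFDerivAt_const q.2 q.1)
  have h3 := HasFDerivAt.comp (g := prodRep I₁ I₂ e₁ e₂ f) q.1 h1.hasFDerivAt h2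
  have h4 : (fun u => f ((e₁.extend I₁).symm u, (e₂.extend I₂).symm q.2)) =
    prodRep I₁ I₂ e₁ e₂ f ∘ fun u => (u, q.2) := rfl
  rw [h4, h3.fderiv]
  simp [dd]

/-- A nonvanishing differential has a nonvanishing partial derivative. -/
theorem exists_fderiv_chartAt_ne_zero {ι : Type*} (b : Module.Basis ι ℝ E₁) {g : M₁ → ℝ} {x : M₁}
    (hg : mfderiv I₁ 𝓘(ℝ, ℝ) g x ≠ 0) :
    ∃ i, fderiv ℝ (fun u => g (((chartAt H₁ x).extend I₁).symm u))
      ((chartAt H₁ x).extend I₁ x) (b i) ≠ 0 := by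
  by_contra! h0
  refine hg ?_
  -- Differentiability is automatic, since `mfderiv` takes the value 0 where it fails.
  have h1 : MDifferentiableAt I₁ 𝓘(ℝ, ℝ) g x := by
    by_contra h
    exact hg (mfderiv_zero_of_not_mdifferentiableAt h)
  have h2 : fderiv ℝ (fun u => g (((chartAt H₁ x).extend I₁).symm u))
      ((chartAt H₁ x).extend I₁ x) = 0 :=
    ContinuousLinearMap.coe_injective (b.ext fun i => h0 i)
  refine h1.mfderiv.trans ?_
  rw [I₁.range_eq_univ, fderivWithin_univ]
  exact h2

end ProductCharts

/-! ### Passage between global metrics and local expressions -/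

section Metric

variable {m n : ℕ} {M₁ M₂ : Type*}
  [TopologicalSpace M₁] [ChartedSpace (EuclideanSpace ℝ (Fin m)) M₁] [IsManifold (𝓡 m) ∞ M₁]
  [TopologicalSpace M₂] [ChartedSpace (EuclideanSpace ℝ (Fin n)) M₂] [IsManifold (𝓡 n) ∞ M₂]
  {F₁ : FinslerMetric m M₁} {F₂ : FinslerMetric n M₂} {f : M₁ × M₂ → ℝ}
  {e₁ : OpenPartialHomeomorph M₁ (EuclideanSpace ℝ (Fin m))}
  {e₂ : OpenPartialHomeomorph M₂ (EuclideanSpace ℝ (Fin n))}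

theorem isLocalFinsler (F₁ : FinslerMetric m M₁) (he₁ : e₁ ∈ atlas (EuclideanSpace ℝ (Fin m)) M₁) :
    IsLocalFinsler (stdBasis m) (coordRep (𝓡 m) e₁ F₁.toFun) (e₁.extend (𝓡 m)).target where
  isOpen := e₁.isOpen_extend_target
  smooth := (contDiffOn_coordRep he₁ F₁.smooth).pow 2
  homog x _ c hc y := by
    simp only [coordRep, ofCoord_smul]
    exact F₁.homogeneous _ _ c hc
  posDef x hx y hy := F₁.posDef e₁ he₁ (x, y) hx hy

theorem isLocalTwist (F₁ : FinslerMetric m M₁) (F₂ : FinslerMetric n M₂)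
    (he₁ : e₁ ∈ atlas (EuclideanSpace ℝ (Fin m)) M₁)
    (he₂ : e₂ ∈ atlas (EuclideanSpace ℝ (Fin n)) M₂)
    (hf : ContMDiff ((𝓡 m).prod (𝓡 n)) 𝓘(ℝ, ℝ) ∞ f) (hpos : ∀ q, 0 < f q) :
    IsLocalTwist (stdBasis m) (stdBasis n) (coordRep (𝓡 m) e₁ F₁.toFun)
      (coordRep (𝓡 n) e₂ F₂.toFun) (e₁.extend (𝓡 m)).target (e₂.extend (𝓡 n)).target
      (prodRep (𝓡 m) (𝓡 n) e₁ e₂ f)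
      (coordRep ((𝓡 m).prod (𝓡 n)) (e₁.prod e₂) (twistedProduct F₁ F₂ f)) where
  left := isLocalFinsler F₁ he₁
  right := isLocalFinsler F₂ he₂
  smooth_twist := contDiffOn_prodRep he₁ he₂ hf
  pos _ _ := hpos _
  sq_eq q hq z := by
    simp only [coordRep, twistedProduct]
    rw [Real.sq_sqrt (by positivity), tangentMap_fst_ofCoord he₁ he₂ hq,
      tangentMap_snd_ofCoord he₁ he₂ hq]
    have : (ofCoord ((𝓡 m).prod (𝓡 n)) (e₁.prod e₂) (q, z)).1 =
        ((e₁.extend (𝓡 m)).symm q.1, (e₂.extend (𝓡 n)).symm q.2) := by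
      change ((e₁.prod e₂).extend ((𝓡 m).prod (𝓡 n))).symm q = _
      rw [e₁.extend_prod e₂]
      rfl
    rw [this, prodRep]

theorem ofCoord_mem_twistedDomain (he₁ : e₁ ∈ atlas (EuclideanSpace ℝ (Fin m)) M₁)
    (he₂ : e₂ ∈ atlas (EuclideanSpace ℝ (Fin n)) M₂)
    {q : EuclideanSpace ℝ (Fin m) × EuclideanSpace ℝ (Fin n)}
    (hq : q ∈ (e₁.extend (𝓡 m)).target ×ˢ (e₂.extend (𝓡 n)).target)
    (z : EuclideanSpace ℝ (Fin m) × EuclideanSpace ℝ (Fin n)) :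
    ofCoord ((𝓡 m).prod (𝓡 n)) (e₁.prod e₂) (q, z) ∈ twistedDomain m n M₁ M₂ ↔
      z ∈ slit₂ (EuclideanSpace ℝ (Fin m)) (EuclideanSpace ℝ (Fin n)) := by
  simp only [twistedDomain, Set.mem_ofPred_eq, tangentMap_fst_ofCoord he₁ he₂ hq,
    tangentMap_snd_ofCoord he₁ he₂ hq, ofCoord_mem_slit he₁ hq.1, ofCoord_mem_slit he₂ hq.2]
  rfl

/-- The atlas of the product consists exactly of products of charts, so the global condition unfolds
to a condition on pairs of charts. -/
theorem twistedWeaklyLandsberg_iff : TwistedWeaklyLandsberg F₁ F₂ f ↔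
    ∀ e₁ ∈ atlas (EuclideanSpace ℝ (Fin m)) M₁, ∀ e₂ ∈ atlas (EuclideanSpace ℝ (Fin n)) M₂,
      ∀ q ∈ (e₁.extend (𝓡 m)).target ×ˢ (e₂.extend (𝓡 n)).target,
        ∀ z ∈ slit₂ (EuclideanSpace ℝ (Fin m)) (EuclideanSpace ℝ (Fin n)), ∀ α,
          meanLandsberg ((stdBasis m).prod (stdBasis n))
            (coordRep ((𝓡 m).prod (𝓡 n)) (e₁.prod e₂) (twistedProduct F₁ F₂ f)) α (q, z) = 0 := by
  constructor
  · intro h e₁ he₁ e₂ he₂ q hq z hz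
    exact h _ (prod_mem_atlas he₁ he₂) (q, z) (by rwa [extend_prod_target])
      ((ofCoord_mem_twistedDomain he₁ he₂ hq z).2 hz)
  · rintro h e ⟨e₁, he₁, e₂, he₂, rfl⟩ p hp hD
    rw [extend_prod_target] at hp
    exact h e₁ he₁ e₂ he₂ p.1 hp p.2 ((ofCoord_mem_twistedDomain he₁ he₂ hp p.2).1 hD)

theorem isWeaklyLandsberg_iff : F₁.IsWeaklyLandsberg ↔
    ∀ e₁ ∈ atlas (EuclideanSpace ℝ (Fin m)) M₁, ∀ x ∈ (e₁.extend (𝓡 m)).target, ∀ y, y ≠ 0 →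
      ∀ i, meanLandsberg (stdBasis m) (coordRep (𝓡 m) e₁ F₁.toFun) i (x, y) = 0 :=
  ⟨fun h e he _ hx _ hy => h e he _ hx ((ofCoord_mem_slit he hx).2 hy),
    fun h e he p hp hD => h e he p.1 hp p.2 ((ofCoord_mem_slit he hp).1 hD)⟩

end Metric

/-! ### Riemannian metrics and vanishing mean Cartan torsion -/

section Riemannian

variable {n : ℕ} {M : Type*} [TopologicalSpace M] [ChartedSpace (EuclideanSpace ℝ (Fin n)) M]
  [IsManifold (𝓡 n) ∞ M] {F : FinslerMetric n M}
  {e : OpenPartialHomeomorph M (EuclideanSpace ℝ (Fin n))} {u : EuclideanSpace ℝ (Fin n)}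

/-- A Minkowski norm with vanishing mean Cartan torsion is Euclidean, provided that it is reversible
if the dimension is one. -/
theorem IsMinkowskiSq.exists_matrix {ι E : Type*} [Fintype ι] [DecidableEq ι] [Nonempty ι]
    [NormedAddCommGroup E] [NormedSpace ℝ E] {b : Module.Basis ι ℝ E} {N : E → ℝ}
    (h : IsMinkowskiSq b N) (h0 : N 0 = 0) (hI : ∀ y, y ≠ 0 → ∀ l, meanTorsion b N l y = 0)
    (hrev : Subsingleton ι → ∀ y, N (-y) = N y) :
    ∃ g : Matrix ι ι ℝ, (∀ i j, g i j = g j i) ∧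
      ∀ y, N y = ∑ i, ∑ j, b.repr y i • b.repr y j • g i j := by
  obtain ⟨k⟩ := ‹Nonempty ι›
  rcases subsingleton_or_nontrivial ι with hs | hs
  · refine ⟨fun _ _ => N (b k), fun _ _ => rfl, fun y => ?_⟩
    have : Unique ι := ⟨⟨k⟩, fun i => Subsingleton.elim i k⟩
    have e1 : y = b.repr y k • b k := by
      conv_lhs => rw [← b.sum_repr y]
      exact Fintype.sum_subsingleton _ k
    have e2 : ∀ c : ℝ, N (c • b k) = c ^ 2 * N (b k) := by
      intro c
      rcases lt_trichotomy c 0 with hc | rfl | hc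
      -- Homogeneity reaches positive multiples only; reversibility identifies the two half-lines.
      · rw [← hrev hs, ← neg_smul, h.homog (-c) (by linarith)]
        ring
      · simp [h0]
      · rw [h.homog c hc]
    rw [Fintype.sum_subsingleton _ k, Fintype.sum_subsingleton _ k]
    conv_lhs => rw [e1, e2]
    simp only [smul_eq_mul]
    ring
  · refine ⟨hess b N (b k), fun i j => ?_, fun y => ?_⟩
    · exact h.hess_symm (b.ne_zero k) i j
    · by_cases hy : y = 0
      · simp [hy, h0]
      · rw [h.half_eq hy, h.hess_eq_of_meanTorsion_eq_zero hI hy (b.ne_zero k)]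
        simp only [smul_eq_mul, Finset.mul_sum]
        exact Finset.sum_congr rfl fun i _ => Finset.sum_congr rfl fun j _ => by ring

theorem isQuadratic_of_isRiemannian (hF : F.IsRiemannian) :
    IsQuadratic fun v => coordRep (𝓡 n) e F.toFun (u, v) ^ 2 := by
  obtain ⟨B, -, hB, hFB⟩ := hF ((e.extend (𝓡 n)).symm u)
  let L : EuclideanSpace ℝ (Fin n) →ₗ[ℝ] TangentSpace (𝓡 n) ((e.extend (𝓡 n)).symm u) :=
    (mfderiv 𝓘(ℝ, EuclideanSpace ℝ (Fin n)) (𝓡 n) (e.extend (𝓡 n)).symm u).toLinearMap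
  refine (IsQuadratic.of_bilin (stdBasis n) (B.compl₁₂ L L)).congr fun v _ => ?_
  have h1 : coordRep (𝓡 n) e F.toFun (u, v) = Real.sqrt (B (L v) (L v)) := hFB (L v)
  have h2 : ∀ w, 0 ≤ B w w := fun w => by
    rcases eq_or_ne w 0 with rfl | hw
    · exact (map_zero (B 0)).ge
    · exact (hB w hw).le
  simp only [h1, Real.sq_sqrt (h2 _)]
  rfl

theorem isRiemannian_of_meanCartan_eq_zero (hn : 1 ≤ n) (hrev : n = 1 → F.IsReversible)
    (hI : ∀ e ∈ atlas (EuclideanSpace ℝ (Fin n)) M, ∀ u ∈ (e.extend (𝓡 n)).target, ∀ v, v ≠ 0 →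
      ∀ i, meanCartan (stdBasis n) (coordRep (𝓡 n) e F.toFun) i (u, v) = 0) :
    F.IsRiemannian := by
  intro z
  set e := chartAt (EuclideanSpace ℝ (Fin n)) z
  have he : e ∈ atlas (EuclideanSpace ℝ (Fin n)) M := chart_mem_atlas _ z
  have hz : z ∈ e.source := mem_chart_source _ z
  set u := e.extend (𝓡 n) z with hu'
  have hu : u ∈ (e.extend (𝓡 n)).target := (e.extend (𝓡 n)).map_source (by rwa [e.extend_source])
  have hL := isLocalFinsler F he
  have hM := hL.isMinkowskiSq hu
  have : Nonempty (Fin n) := ⟨⟨0, hn⟩⟩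
  -- Vanishing on the zero section is not an axiom; it follows from F(0) = 2 F(0).
  have h0 : coordRep (𝓡 n) e F.toFun (u, 0) = 0 := by
    have := hL.homog u hu 2 two_pos 0
    rw [smul_zero] at this
    linarith
  obtain ⟨g, hg, hN⟩ := hM.exists_matrix (by simp [h0])
    (fun y hy l => by rw [← hL.meanCartan_eq hu hy, hI e he u hu y hy])
    (fun hs y => by
      have h1 : n = 1 := by
        have := Fintype.card_le_one_iff_subsingleton.2 hs
        rw [Fintype.card_fin] at this
        omega
      have h2 : coordRep (𝓡 n) e F.toFun (u, -y) = coordRep (𝓡 n) e F.toFun (u, y) := by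
        rw [← neg_one_smul ℝ y, coordRep, ofCoord_smul, neg_one_smul]
        exact hrev h1 _ _
      simp only [h2])
  let D : TangentSpace (𝓡 n) z →ₗ[ℝ] EuclideanSpace ℝ (Fin n) :=
    (mfderiv (𝓡 n) 𝓘(ℝ, EuclideanSpace ℝ (Fin n)) (e.extend (𝓡 n)) z).toLinearMap
  let B := Matrix.toLinearMap₂ (stdBasis n) (stdBasis n) g
  have hB : ∀ v, B v v = coordRep (𝓡 n) e F.toFun (u, v) ^ 2 := fun v => by
    rw [hN v, Matrix.toLinearMap₂_apply]
  have hD : ∀ v, ofCoord (𝓡 n) e (u, D v) = ⟨z, v⟩ := fun v =>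
    ofCoord_tangentMap_extend he ⟨z, v⟩ hz
  refine ⟨B.compl₁₂ D D, fun v w => ?_, fun v hv => ?_, fun v => ?_⟩
  · simp only [LinearMap.compl₁₂_apply, B, Matrix.toLinearMap₂_apply]
    rw [Finset.sum_comm]
    refine Finset.sum_congr rfl fun i _ => Finset.sum_congr rfl fun j _ => ?_
    rw [hg, smul_comm]
  · rw [LinearMap.compl₁₂_apply, hB]
    refine hM.pos ((ofCoord_mem_slit he hu).1 ?_)
    rw [hD]
    exact hv
  · rw [LinearMap.compl₁₂_apply, hB, coordRep, hD, Real.sqrt_sq (F.nonneg _)]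

end Riemannian

/-! ### Density argument for the second factor -/

section Twisted

variable {m n : ℕ} {M₁ M₂ : Type*}
  [TopologicalSpace M₁] [ChartedSpace (EuclideanSpace ℝ (Fin m)) M₁] [IsManifold (𝓡 m) ∞ M₁]
  [TopologicalSpace M₂] [ChartedSpace (EuclideanSpace ℝ (Fin n)) M₂] [IsManifold (𝓡 n) ∞ M₂]
  {F₁ : FinslerMetric m M₁} {F₂ : FinslerMetric n M₂} {f : M₁ × M₂ → ℝ}

/-- If the twisted product is weakly Landsberg and the twisting function depends on the first factor
over every open set, then the second factor has no mean Cartan torsion. -/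
theorem meanCartan_eq_zero_of_twistedWeaklyLandsberg
    (hf : ContMDiff ((𝓡 m).prod (𝓡 n)) 𝓘(ℝ, ℝ) ∞ f) (hpos : ∀ q, 0 < f q)
    (hdep : ∀ V : Set M₂, IsOpen V → V.Nonempty →
      ∃ z ∈ V, ∃ x : M₁, mfderiv (𝓡 m) 𝓘(ℝ, ℝ) (fun x' : M₁ => f (x', z)) x ≠ 0)
    (h : TwistedWeaklyLandsberg F₁ F₂ f)
    {e : OpenPartialHomeomorph M₂ (EuclideanSpace ℝ (Fin n))}
    (he : e ∈ atlas (EuclideanSpace ℝ (Fin n)) M₂) {u v : EuclideanSpace ℝ (Fin n)}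
    (hu : u ∈ (e.extend (𝓡 n)).target) (hv : v ≠ 0) (i : Fin n) :
    meanCartan (stdBasis n) (coordRep (𝓡 n) e F₂.toFun) i (u, v) = 0 := by
  by_contra hne
  have hL := isLocalFinsler F₂ he
  have hc : ContinuousOn
      (fun u => meanCartan (stdBasis n) (coordRep (𝓡 n) e F₂.toFun) i (u, v))
      (e.extend (𝓡 n)).target :=
    (continuousOn_meanCartan hL.isOpen isOpen_compl_singleton hL.smooth hL.det_ne_zero i).comp
      (by fun_prop) fun u hu => ⟨hu, hv⟩
  have hS := hc.isOpen_inter_preimage hL.isOpen (isOpen_compl_singleton (x := (0 : ℝ)))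
  -- With v fixed in coordinates, a nonzero torsion component stays nonzero over an open set of base
  -- points. The dependence of f on the first factor supplies a point of that set where the torsion
  -- must vanish.
  have hV := (e.continuousOn_extend (I := 𝓡 n)).isOpen_inter_preimage e.isOpen_extend_source hS
  obtain ⟨z, ⟨hz, hz'⟩, x, hx⟩ := hdep _ hV ⟨(e.extend (𝓡 n)).symm u,
    (e.extend (𝓡 n)).map_target hu, by
      rw [Set.mem_preimage, (e.extend (𝓡 n)).right_inv hu]
      exact ⟨hu, hne⟩⟩
  obtain ⟨k, hk⟩ := exists_fderiv_chartAt_ne_zero (stdBasis m) hx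
  set e₁ := chartAt (EuclideanSpace ℝ (Fin m)) x
  have he₁ : e₁ ∈ atlas (EuclideanSpace ℝ (Fin m)) M₁ := chart_mem_atlas _ x
  have hx₁ : x ∈ (e₁.extend (𝓡 m)).source := by
    rw [e₁.extend_source]
    exact mem_chart_source _ x
  have hq : (e₁.extend (𝓡 m) x, e.extend (𝓡 n) z) ∈
      (e₁.extend (𝓡 m)).target ×ˢ (e.extend (𝓡 n)).target :=
    ⟨(e₁.extend (𝓡 m)).map_source hx₁, (e.extend (𝓡 n)).map_source hz⟩
  refine hz'.2 ((isLocalTwist F₁ F₂ he₁ he hf hpos).meanCartan_right hq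
    (twistedWeaklyLandsberg_iff.1 h e₁ he₁ e he _ hq) (m := k) ?_ hv i)
  rw [dd_prodRep he₁ he hf hq]
  simpa only [(e.extend (𝓡 n)).left_inv hz] using hk

end Twisted

end Finsler

end

open Finsler

theorem theorem5p2 {m n : ℕ} {M₁ M₂ : Type*}
    [TopologicalSpace M₁] [ChartedSpace (EuclideanSpace ℝ (Fin m)) M₁] [IsManifold (𝓡 m) ∞ M₁]
    [TopologicalSpace M₂] [ChartedSpace (EuclideanSpace ℝ (Fin n)) M₂] [IsManifold (𝓡 n) ∞ M₂]
    [Nonempty M₂] (hn : 1 ≤ n)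
    (F₁ : FinslerMetric m M₁) (F₂ : FinslerMetric n M₂) (hrev : n = 1 → F₂.IsReversible)
    (f : M₁ × M₂ → ℝ) (hf : ContMDiff ((𝓡 m).prod (𝓡 n)) 𝓘(ℝ, ℝ) ∞ f) (hpos : ∀ q, 0 < f q)
    (hdep : ∀ V : Set M₂, IsOpen V → V.Nonempty →
      ∃ z ∈ V, ∃ x : M₁, mfderiv (𝓡 m) 𝓘(ℝ, ℝ) (fun x' : M₁ => f (x', z)) x ≠ 0) :
    TwistedWeaklyLandsberg F₁ F₂ f ↔
      F₁.IsWeaklyLandsberg ∧ F₂.IsRiemannian ∧ TwistEquation F₁ f := by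
  have hchart : ∀ z : M₂, z ∈ ((chartAt (EuclideanSpace ℝ (Fin n)) z).extend (𝓡 n)).source :=
    fun z => by
      rw [OpenPartialHomeomorph.extend_source]
      exact mem_chart_source _ z
  constructor
  · intro h
    have h' := twistedWeaklyLandsberg_iff.1 h
    have : Nonempty (Fin n) := ⟨⟨0, hn⟩⟩
    -- A nonzero vector in the second factor is indispensable: for n = 0 the domain of the twisted
    -- product is empty.
    have : Nontrivial (EuclideanSpace ℝ (Fin n)) := (stdBasis n).repr.toEquiv.nontrivial
    have hz := fun z => PartialEquiv.map_source _ (hchart z)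
    have he₂ := fun z : M₂ => chart_mem_atlas (EuclideanSpace ℝ (Fin n)) z
    refine ⟨isWeaklyLandsberg_iff.2 fun e₁ he₁ x hx y hy i => ?_,
      isRiemannian_of_meanCartan_eq_zero hn hrev fun e he u hu v hv i =>
        meanCartan_eq_zero_of_twistedWeaklyLandsberg hf hpos hdep h he hu hv i,
      fun e₁ he₁ p hp hy z => ?_⟩
    -- The curvature of the first factor does not depend on the second, so any single point of M₂
    -- serves.
    · obtain ⟨z⟩ := ‹Nonempty M₂›
      have hq := Set.mk_mem_prod hx (hz z)
      exact (isLocalTwist F₁ F₂ he₁ (he₂ z) hf hpos).meanLandsberg_left hq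
        (h' e₁ he₁ _ (he₂ z) _ hq) hy i
    · have hq := Set.mk_mem_prod hp (hz z)
      have h1 := (isLocalTwist F₁ F₂ he₁ (he₂ z) hf hpos).twist_equation hq
        (h' e₁ he₁ _ (he₂ z) _ hq) hy
      simp only [dd_prodRep he₁ (he₂ z) hf hq, PartialEquiv.left_inv _ (hchart z)] at h1
      exact h1
  · rintro ⟨hL, hR, hT⟩
    refine twistedWeaklyLandsberg_iff.2 fun e₁ he₁ e₂ he₂ q hq z hz α => ?_
    refine (isLocalTwist F₁ F₂ he₁ he₂ hf hpos).meanLandsberg_eq_zero hq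
      (fun y hy i => isWeaklyLandsberg_iff.1 hL e₁ he₁ _ hq.1 y hy i)
      (fun u _ => isQuadratic_of_isRiemannian hR) (fun y hy => ?_) hz.1 hz.2 α
    simp only [dd_prodRep he₁ he₂ hf hq]
    exact hT e₁ he₁ (q.1, y) hq.1 hy _
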